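/- Let $n\ge 1$, let $\overline{M}$ be a smooth $(n+1)$-manifold with boundary $\partial M$ and interior $M$, and let $g=g_{ij}$ be a smooth pseudo-Riemannian metric on $M$ with Levi-Civita connection $\nabla$, inverse metric $g^{ij}$ and scalar curvature $S=g^{ij}\mathrm{Ric}_{ij}$. Assume that the projective structure of $\nabla$ extends smoothly to $\overline{M}$: every $x\in\partial M$ has an open neighbourhood $U\subset\overline{M}$ with a smooth one-form $\Upsilon$ on $U\cap M$ such that, for all vector fields $\xi,\eta$ on $U$ that are smooth up to the boundary, $\nabla_\xi\eta+\Upsilon(\xi)\eta+\Upsilon(\eta)\xi$ extends smoothly from $U\cap M$ to $U$. Notation. $\mathcal E(w)$ is the real power of the bundle of volume densities normalized so that $\mathcal E(-n-2)$ is the bundle of volume densities, and $(w)$ denotes a tensor product with $\mathcal E(w)$. Put $\tau=\mathrm{vol}(g)^{-2/(n+2)}\in\Gamma(\mathcal E(2)|_M)$. The standard cotractor bundle is $\mathcal T^*=J^1\mathcal E(1)$, and $S^2\mathcal T$ is the bundle of symmetric bilinear forms on $\mathcal T^*$, with canonical projection $S^2\mathcal T\to\mathcal E^{(ij)}(-2)$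 given by restriction to $\mathcal E_i(1)\subset J^1\mathcal E(1)$. A connection $\nabla$ in the projective class splits $\mathcal T^*$ by $j^1f\mapsto(f,\nabla_if)$; a triple $(\sigma^{ij},\nu^i,\rho)$ with entries in $\mathcal E^{(ij)}(-2)$, $\mathcal E^i(-2)$, $\mathcal E(-2)$ then stands for the bilinear form $\rho ff'+\nu^i(f\mu'_i+f'\mu_i)+\sigma^{ij}\mu_i\mu'_j$ on pairs $(f,\mu_i)$. The splitting operator $L$ is $$L(\sigma^{ij})=\Bigl(\sigma^{ij},\ -\tfrac1{n+2}\nabla_i\sigma^{ij},\ \tfrac1{n+1}\bigl(\mathsf P_{ij}\sigma^{ij}+\tfrac1{n+2}\nabla_j\nabla_i\sigma^{ij}\bigr)\Bigr),\qquad \mathsf P_{ij}=\tfrac1n\mathrm{Ric}_{ij},$$ computed here with the Levi-Civita connection $\nabla$. The tractor determinant of a section of $S^2\mathcal T$ is the determinant of its matrix in the frame of $\mathcal T^*$ given by the 1-jet coordinates $(f,\partial_if)$ of a chart, where sections of $\mathcal E(1)$ are written $f\,|dx|^{-1/(n+2)}$ with $|dx|$ the coordinate volume density; it does not depend on the chart.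 Then: 1. $\tau^{-1}g^{ij}\in\Gamma(\mathcal E^{(ij)}(-2)|_M)$ and $L(\tau^{-1}g^{ij})\in\Gamma(S^2\mathcal T|_M)$ extend to smooth sections over all of $\overline{M}$, and the extension of the second projects onto the extension of the first. 2. $S$ extends to a smooth function on all of $\overline{M}$. 3. Up to a constant factor, $S$ is the tractor determinant of $L(\tau^{-1}g^{ij})$: there is a locally constant function $\varepsilon:\overline{M}\to\{1,-1\}$, equal on $M$ to the sign of $\det(g_{ij})$, such that the extensions satisfy, on all of $\overline{M}$, $$S=\varepsilon\,n(n+1)\,\det\bigl(L(\tau^{-1}g^{ij})\bigr).$$ -/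

import Mathlib

open scoped Manifold ContDiff

noncomputable section

namespace ProjectiveTractor

/-- The model vector space of an `(n+1)`-dimensional manifold. -/
abbrev Model (n : ℕ) : Type := EuclideanSpace ℝ (Fin (n + 1))

/-- Charts of an `(n+1)`-dimensional manifold with boundary. -/
abbrev Chart (n : ℕ) (M : Type*) [TopologicalSpace M] : Type _ :=
  OpenPartialHomeomorph M (EuclideanHalfSpace (n + 1))

/-- The standard basis vectors of the model space. -/
def stdVec {n : ℕ} (i : Fin (n + 1)) : Model n := EuclideanSpace.single i 1

/-! ### Smooth tensor fields, connections, curvature -/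

section Fields

variable {n : ℕ} {M : Type*} [TopologicalSpace M] [ChartedSpace (EuclideanHalfSpace (n + 1)) M]

/-- The interior `M` of the manifold with boundary. -/
def interiorSet (n : ℕ) (M : Type*) [TopologicalSpace M]
    [ChartedSpace (EuclideanHalfSpace (n + 1)) M] : Set M :=
  (𝓡∂ (n + 1)).interior M

/-- The smooth charts of the manifold with boundary (the maximal smooth atlas). -/
def smoothCharts (n : ℕ) (M : Type*) [TopologicalSpace M]
    [ChartedSpace (EuclideanHalfSpace (n + 1)) M] : Set (Chart n M) :=
  IsManifold.maximalAtlas (𝓡∂ (n + 1)) ∞ M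

/-- A vector field is smooth (up to the boundary) on `U`. -/
def SmoothField [IsManifold (𝓡∂ (n + 1)) ∞ M]
    (X : (x : M) → TangentSpace (𝓡∂ (n + 1)) x) (U : Set M) : Prop :=
  ContMDiffOn (𝓡∂ (n + 1)) ((𝓡∂ (n + 1)).prod 𝓘(ℝ, Model n)) ∞
    (fun x => Bundle.TotalSpace.mk' (Model n) x (X x)) U

/-- A one-form is smooth on `U`. -/
def SmoothOneForm [IsManifold (𝓡∂ (n + 1)) ∞ M]
    (Υ : (x : M) → TangentSpace (𝓡∂ (n + 1)) x →L[ℝ] ℝ) (U : Set M) : Prop :=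
  ContMDiffOn (𝓡∂ (n + 1)) ((𝓡∂ (n + 1)).prod 𝓘(ℝ, Model n →L[ℝ] ℝ)) ∞
    (fun x => Bundle.TotalSpace.mk' (Model n →L[ℝ] ℝ)
      (E := fun x : M => TangentSpace (𝓡∂ (n + 1)) x →L[ℝ] Bundle.Trivial M ℝ x) x (Υ x)) U

/-- A smooth pseudo-Riemannian metric (of arbitrary signature) on the interior.
The values of `g` at boundary points are irrelevant. -/
structure IsPseudoRiemannianMetric [IsManifold (𝓡∂ (n + 1)) ∞ M]
    (g : (x : M) → TangentSpace (𝓡∂ (n + 1)) x →L[ℝ] TangentSpace (𝓡∂ (n + 1)) x →L[ℝ] ℝ) :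
    Prop where
  symm : ∀ x ∈ interiorSet n M, ∀ v w, g x v w = g x w v
  nondegenerate : ∀ x ∈ interiorSet n M, ∀ v, (∀ w, g x v w = 0) → v = 0
  smooth : ContMDiffOn (𝓡∂ (n + 1))
    ((𝓡∂ (n + 1)).prod 𝓘(ℝ, Model n →L[ℝ] Model n →L[ℝ] ℝ)) ∞
    (fun x => Bundle.TotalSpace.mk' (Model n →L[ℝ] Model n →L[ℝ] ℝ)
      (E := fun x : M => TangentSpace (𝓡∂ (n + 1)) x →L[ℝ]
        TangentSpace (𝓡∂ (n + 1)) x →L[ℝ] Bundle.Trivial M ℝ x) x (g x)) (interiorSet n M)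

/-- `cov` is the Levi-Civita connection of `g` on the interior: the torsion-free covariant
derivative on `TM` compatible with `g`. Here `cov η x (ξ x)` is `(∇_ξ η)(x)`. -/
structure IsLeviCivita [IsManifold (𝓡∂ (n + 1)) ∞ M]
    (g : (x : M) → TangentSpace (𝓡∂ (n + 1)) x →L[ℝ] TangentSpace (𝓡∂ (n + 1)) x →L[ℝ] ℝ)
    (cov : ((x : M) → TangentSpace (𝓡∂ (n + 1)) x) →
      ((x : M) → TangentSpace (𝓡∂ (n + 1)) x →L[ℝ] TangentSpace (𝓡∂ (n + 1)) x)) : Prop where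
  isCovariantDerivative : IsCovariantDerivativeOn (Model n) cov (interiorSet n M)
  torsion_free : ∀ x ∈ interiorSet n M, ∀ X Y : (x : M) → TangentSpace (𝓡∂ (n + 1)) x,
    MDifferentiableAt (𝓡∂ (n + 1)) ((𝓡∂ (n + 1)).prod 𝓘(ℝ, Model n))
      (fun y => Bundle.TotalSpace.mk' (Model n) y (X y)) x →
    MDifferentiableAt (𝓡∂ (n + 1)) ((𝓡∂ (n + 1)).prod 𝓘(ℝ, Model n))
      (fun y => Bundle.TotalSpace.mk' (Model n) y (Y y)) x →
    cov Y x (X x) - cov X x (Y x) = VectorField.mlieBracket (𝓡∂ (n + 1)) X Y x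
  metric : ∀ x ∈ interiorSet n M, ∀ (v : TangentSpace (𝓡∂ (n + 1)) x)
    (Y Z : (x : M) → TangentSpace (𝓡∂ (n + 1)) x),
    MDifferentiableAt (𝓡∂ (n + 1)) ((𝓡∂ (n + 1)).prod 𝓘(ℝ, Model n))
      (fun y => Bundle.TotalSpace.mk' (Model n) y (Y y)) x →
    MDifferentiableAt (𝓡∂ (n + 1)) ((𝓡∂ (n + 1)).prod 𝓘(ℝ, Model n))
      (fun y => Bundle.TotalSpace.mk' (Model n) y (Z y)) x →
    (mfderiv (𝓡∂ (n + 1)) 𝓘(ℝ, ℝ) (fun y => g y (Y y) (Z y)) x v : ℝ) =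
      g x (cov Y x v) (Z x) + g x (Y x) (cov Z x v)

/-- The projective structure of the connection `cov`, given on the interior, admits a smooth
extension to the whole manifold with boundary: around each boundary point there are an open set `U`
and a smooth one-form `Υ` on the interior part of `U` such that, for all vector fields `ξ, η` smooth
up to the boundary on `U`, the field `∇_ξ η + Υ(ξ) η + Υ(η) ξ` extends smoothly to `U`. -/
def ProjectiveStructureExtends [IsManifold (𝓡∂ (n + 1)) ∞ M]
    (cov : ((x : M) → TangentSpace (𝓡∂ (n + 1)) x) →
      ((x : M) → TangentSpace (𝓡∂ (n + 1)) x →L[ℝ] TangentSpace (𝓡∂ (n + 1)) x)) : Prop :=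
  ∀ x ∈ (𝓡∂ (n + 1)).boundary M, ∃ U : Set M, IsOpen U ∧ x ∈ U ∧
    ∃ Υ : (y : M) → TangentSpace (𝓡∂ (n + 1)) y →L[ℝ] ℝ,
      SmoothOneForm Υ (U ∩ interiorSet n M) ∧
      ∀ ξ η : (y : M) → TangentSpace (𝓡∂ (n + 1)) y, SmoothField ξ U → SmoothField η U →
        ∃ ζ : (y : M) → TangentSpace (𝓡∂ (n + 1)) y, SmoothField ζ U ∧
          ∀ y ∈ U ∩ interiorSet n M,
            ζ y = cov η y (ξ y) + Υ y (ξ y) • η y + Υ y (η y) • ξ y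

/-- The coordinate vector field `∂_i` of a chart (meaningful on the chart domain). -/
def coordField (φ : Chart n M) (i : Fin (n + 1)) : (x : M) → TangentSpace (𝓡∂ (n + 1)) x :=
  VectorField.mpullback (𝓡∂ (n + 1)) 𝓘(ℝ, Model n) (φ.extend (𝓡∂ (n + 1))) (fun _ => stdVec i)

/-- The coordinate one-form `dx^k` of a chart at a point of its domain. -/
def coordForm (φ : Chart n M) (k : Fin (n + 1)) (x : M)
    (v : TangentSpace (𝓡∂ (n + 1)) x) : ℝ :=
  (show Model n from
    mfderiv (𝓡∂ (n + 1)) 𝓘(ℝ, Model n) (φ.extend (𝓡∂ (n + 1))) x v) k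

/-- The partial derivative `∂_i f` in a chart. -/
def partialDeriv (φ : Chart n M) (i : Fin (n + 1)) (f : M → ℝ) (x : M) : ℝ :=
  fderivWithin ℝ (f ∘ (φ.extend (𝓡∂ (n + 1))).symm) (Set.range (𝓡∂ (n + 1)))
    (φ.extend (𝓡∂ (n + 1)) x) (stdVec i)

/-- The components `g_{ij}` of the metric in a chart. -/
def metricMatrix
    (g : (x : M) → TangentSpace (𝓡∂ (n + 1)) x →L[ℝ] TangentSpace (𝓡∂ (n + 1)) x →L[ℝ] ℝ)
    (φ : Chart n M) (x : M) : Matrix (Fin (n + 1)) (Fin (n + 1)) ℝ :=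
  Matrix.of fun i j => g x (coordField φ i x) (coordField φ j x)

variable (cov : ((x : M) → TangentSpace (𝓡∂ (n + 1)) x) →
  ((x : M) → TangentSpace (𝓡∂ (n + 1)) x →L[ℝ] TangentSpace (𝓡∂ (n + 1)) x))

/-- The connection coefficients `Γ^k_{ij}`, with `∇_{∂_i} ∂_j = ∑_k Γ^k_{ij} ∂_k`. -/
def christoffel (φ : Chart n M) (x : M) (k i j : Fin (n + 1)) : ℝ :=
  coordForm φ k x (cov (coordField φ j) x (coordField φ i x))

/-- The trace `γ_i = ∑_k Γ^k_{ik}` of the connection coefficients. -/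
def christoffelTrace (φ : Chart n M) (x : M) (i : Fin (n + 1)) : ℝ :=
  ∑ k, christoffel cov φ x k i k

/-- The curvature `R(X,Y)Z = ∇_X ∇_Y Z - ∇_Y ∇_X Z - ∇_{[X,Y]} Z`. -/
def curvature (X Y Z : (x : M) → TangentSpace (𝓡∂ (n + 1)) x) (x : M) :
    TangentSpace (𝓡∂ (n + 1)) x :=
  cov (fun y => cov Z y (Y y)) x (X x) - cov (fun y => cov Z y (X y)) x (Y x)
    - cov Z x (VectorField.mlieBracket (𝓡∂ (n + 1)) X Y x)

/-- The components `Ric_{ij} = R_{ki}{}^k{}_j` of the Ricci curvature in a chart. -/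
def ricci (φ : Chart n M) (x : M) (i j : Fin (n + 1)) : ℝ :=
  ∑ k, coordForm φ k x (curvature cov (coordField φ k) (coordField φ i) (coordField φ j) x)

/-- The components `P_{ij} = Ric_{ij} / n` of the projective Schouten tensor in a chart
(`n + 1` is the dimension). For a general torsion-free connection this is only correct for the
symmetric part, which is all that enters below. -/
def schouten (φ : Chart n M) (x : M) (i j : Fin (n + 1)) : ℝ :=
  (1 / (n : ℝ)) * ricci cov φ x i j

/-- The scalar curvature `S = g^{ij} Ric_{ij}`, computed at `x` in the preferred chart at `x`. -/
def scalarCurvature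
    (g : (x : M) → TangentSpace (𝓡∂ (n + 1)) x →L[ℝ] TangentSpace (𝓡∂ (n + 1)) x →L[ℝ] ℝ)
    (x : M) : ℝ :=
  ∑ i, ∑ j, (metricMatrix g (chartAt (EuclideanHalfSpace (n + 1)) x) x)⁻¹ i j *
    ricci cov (chartAt (EuclideanHalfSpace (n + 1)) x) x i j

end Fields

/-! ### Weighted bundles and tractor bundles

With `|dx|` the coordinate volume density of a chart, a section of the density bundle `E(w)` is
written `f |dx|^{-w/(n+2)}`; thus the bundle of volume densities is `E(-n-2)`. Sections of the
bundles below are given by their component functions in the induced frames, one family for every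
smooth chart, subject to the transition law of the bundle. -/

section Bundles

variable {n : ℕ} {M : Type*} [TopologicalSpace M]

/-- For charts `φ = (x^k)` and `ψ = (y^i)`, the Jacobian matrix `∂x^k/∂y^i` of the
coordinate change, as a function of the coordinates of `ψ`. -/
def jacobian (φ ψ : Chart n M) (p : Model n) : Matrix (Fin (n + 1)) (Fin (n + 1)) ℝ :=
  Matrix.of fun k i =>
    (fderivWithin ℝ (φ.extend (𝓡∂ (n + 1)) ∘ (ψ.extend (𝓡∂ (n + 1))).symm)
      (Set.range (𝓡∂ (n + 1))) p (stdVec i)) k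

/-- The transition function of the density bundle `E(w)`: the component in the chart `ψ` is this
factor times the component in the chart `φ`. -/
def densityFactor (w : ℝ) (φ ψ : Chart n M) (p : Model n) : ℝ :=
  |(jacobian φ ψ p).det| ^ (-w / ((n : ℝ) + 2))

/-- The transition function of the standard cotractor bundle `T* = J¹E(1)`. In a chart, the 1-jet of
the section `f |dx|^{-1/(n+2)}` has components `(f, ∂_i f)`; this matrix maps the components in the
chart `φ` to those in the chart `ψ`. It comes from differentiating `f_ψ = c f_φ` with
`c = densityFactor 1 φ ψ`. -/
def cotractorTransition (φ ψ : Chart n M) (x : M) :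
    Matrix (Unit ⊕ Fin (n + 1)) (Unit ⊕ Fin (n + 1)) ℝ :=
  Matrix.fromBlocks
    (Matrix.of fun _ _ => densityFactor 1 φ ψ (ψ.extend (𝓡∂ (n + 1)) x))
    0
    (Matrix.of fun i _ => fderivWithin ℝ (densityFactor 1 φ ψ) (Set.range (𝓡∂ (n + 1)))
      (ψ.extend (𝓡∂ (n + 1)) x) (stdVec i))
    (densityFactor 1 φ ψ (ψ.extend (𝓡∂ (n + 1)) x) •
      (jacobian φ ψ (ψ.extend (𝓡∂ (n + 1)) x)).transpose)

/-- A smooth section over `W` of the bundle `E^{(ij)}(-2)` of symmetric bivectors of weight `-2`,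
given by its components in all smooth charts. -/
structure IsSmoothBivectorDensity [ChartedSpace (EuclideanHalfSpace (n + 1)) M]
    (s : Chart n M → M → Matrix (Fin (n + 1)) (Fin (n + 1)) ℝ) (W : Set M) : Prop where
  symm : ∀ φ ∈ smoothCharts n M, ∀ x ∈ φ.source ∩ W, (s φ x).IsSymm
  transition : ∀ φ ∈ smoothCharts n M, ∀ ψ ∈ smoothCharts n M,
    ∀ x ∈ φ.source ∩ ψ.source ∩ W, ∀ k l,
      densityFactor (-2) φ ψ (ψ.extend (𝓡∂ (n + 1)) x) * s φ x k l =
        ∑ i, ∑ j, jacobian φ ψ (ψ.extend (𝓡∂ (n + 1)) x) k i *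
          jacobian φ ψ (ψ.extend (𝓡∂ (n + 1)) x) l j * s ψ x i j
  smooth : ∀ φ ∈ smoothCharts n M, ∀ i j,
    ContMDiffOn (𝓡∂ (n + 1)) 𝓘(ℝ, ℝ) ∞ (fun x => s φ x i j) (φ.source ∩ W)

/-- A smooth section over `W` of `S²T`, i.e. a smooth symmetric bilinear form on the cotractor bundle
`T* = J¹E(1)`, given by its matrix with respect to the jet coordinates of every smooth chart. -/
structure IsSmoothTractorForm [ChartedSpace (EuclideanHalfSpace (n + 1)) M]
    (h : Chart n M → M → Matrix (Unit ⊕ Fin (n + 1)) (Unit ⊕ Fin (n + 1)) ℝ) (W : Set M) :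
    Prop where
  symm : ∀ φ ∈ smoothCharts n M, ∀ x ∈ φ.source ∩ W, (h φ x).IsSymm
  transition : ∀ φ ∈ smoothCharts n M, ∀ ψ ∈ smoothCharts n M,
    ∀ x ∈ φ.source ∩ ψ.source ∩ W,
      h φ x = (cotractorTransition φ ψ x).transpose * h ψ x * cotractorTransition φ ψ x
  smooth : ∀ φ ∈ smoothCharts n M, ∀ a b,
    ContMDiffOn (𝓡∂ (n + 1)) 𝓘(ℝ, ℝ) ∞ (fun x => h φ x a b) (φ.source ∩ W)

/-- The canonical projection `S²T → E^{(ij)}(-2)`: restriction of a bilinear form on `J¹E(1)` to the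
subbundle `E_i(1)` of jets with vanishing value. -/
def tractorProjection (h : Chart n M → M → Matrix (Unit ⊕ Fin (n + 1)) (Unit ⊕ Fin (n + 1)) ℝ) :
    Chart n M → M → Matrix (Fin (n + 1)) (Fin (n + 1)) ℝ :=
  fun φ x => (h φ x).toBlocks₂₂

/-- The tractor determinant of a section of `S²T`. The matrices `cotractorTransition` have
determinant `±1`, so the determinant of the matrix in a chart does not depend on the chart; this is
the determinant for the parallel trivialization of the square of the top exterior power of `T`. -/
def tractorDet (h : Chart n M → M → Matrix (Unit ⊕ Fin (n + 1)) (Unit ⊕ Fin (n + 1)) ℝ)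
    (φ : Chart n M) (x : M) : ℝ :=
  (h φ x).det

end Bundles

/-! ### The BGG splitting operator -/

section Splitting

variable {n : ℕ} {M : Type*} [TopologicalSpace M] [ChartedSpace (EuclideanHalfSpace (n + 1)) M]
variable (cov : ((x : M) → TangentSpace (𝓡∂ (n + 1)) x) →
  ((x : M) → TangentSpace (𝓡∂ (n + 1)) x →L[ℝ] TangentSpace (𝓡∂ (n + 1)) x))

/-- `∇_i σ^{jk}` for a section `σ` of `E^{(ij)}(-2)`. The last term comes from the weight: the
connection induced on `E(w)` acts on components as `∂_i + (w/(n+2)) γ_i`. -/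
def covBivectorDensity (s : Chart n M → M → Matrix (Fin (n + 1)) (Fin (n + 1)) ℝ)
    (φ : Chart n M) (x : M) (i j k : Fin (n + 1)) : ℝ :=
  partialDeriv φ i (fun y => s φ y j k) x
    + ∑ l, christoffel cov φ x j i l * s φ x l k
    + ∑ l, christoffel cov φ x k i l * s φ x j l
    - (2 / ((n : ℝ) + 2)) * christoffelTrace cov φ x i * s φ x j k

/-- The middle slot `-(1/(n+2)) ∇_i σ^{ij}`, a section of `E^i(-2)`. -/
def middleSlot (s : Chart n M → M → Matrix (Fin (n + 1)) (Fin (n + 1)) ℝ)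
    (φ : Chart n M) (j : Fin (n + 1)) (x : M) : ℝ :=
  -(1 / ((n : ℝ) + 2)) * ∑ i, covBivectorDensity cov s φ x i i j

/-- The divergence `∇_j μ^j` of a section `μ` of `E^i(-2)`. -/
def divVectorDensity (m : Fin (n + 1) → M → ℝ) (φ : Chart n M) (x : M) : ℝ :=
  ∑ j, (partialDeriv φ j (m j) x + ∑ l, christoffel cov φ x j j l * m l x
    - (2 / ((n : ℝ) + 2)) * christoffelTrace cov φ x j * m j x)

/-- The bottom slot `(1/(n+1)) (P_{ij} σ^{ij} + (1/(n+2)) ∇_j ∇_i σ^{ij})`, a section of `E(-2)`. -/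
def bottomSlot (s : Chart n M → M → Matrix (Fin (n + 1)) (Fin (n + 1)) ℝ)
    (φ : Chart n M) (x : M) : ℝ :=
  (1 / ((n : ℝ) + 1)) * ((∑ i, ∑ j, schouten cov φ x i j * s φ x i j)
    - divVectorDensity cov (middleSlot cov s φ) φ x)

/-- The section of `S²T` which has components `(σ^{ij}, ν^i, ρ)` in the splitting determined by the
connection `cov`. The splitting identifies the 1-jet of `f` (a section of `E(1)`) with
`(f, μ_i) = (f, ∇_i f)`, where `∇_i f = ∂_i f + γ_i f / (n+2)`, and the triple stands for the
bilinear form `ρ f f' + ν^i (f μ'_i + f' μ_i) + σ^{ij} μ_i μ'_j` on pairs `(f, μ_i)`. -/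
def fromSplitting (φ : Chart n M) (x : M) (s : Matrix (Fin (n + 1)) (Fin (n + 1)) ℝ)
    (ν : Fin (n + 1) → ℝ) (ρ : ℝ) : Matrix (Unit ⊕ Fin (n + 1)) (Unit ⊕ Fin (n + 1)) ℝ :=
  let B : Matrix (Unit ⊕ Fin (n + 1)) (Unit ⊕ Fin (n + 1)) ℝ :=
    Matrix.fromBlocks 1 0
      (Matrix.of fun i _ => christoffelTrace cov φ x i / ((n : ℝ) + 2)) 1
  B.transpose *
    Matrix.fromBlocks (Matrix.of fun _ _ => ρ) (Matrix.of fun _ j => ν j)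
      (Matrix.of fun i _ => ν i) s * B

/-- The splitting operator `L` from sections of `E^{(ij)}(-2)` to sections of `S²T`. -/
def splittingOperator (s : Chart n M → M → Matrix (Fin (n + 1)) (Fin (n + 1)) ℝ) :
    Chart n M → M → Matrix (Unit ⊕ Fin (n + 1)) (Unit ⊕ Fin (n + 1)) ℝ :=
  fun φ x => fromSplitting cov φ x (s φ x) (fun j => middleSlot cov s φ j x)
    (bottomSlot cov s φ x)

/-- The component in a chart of the volume density `vol(g)`, a section of `E(-n-2)`. -/
def volComponent
    (g : (x : M) → TangentSpace (𝓡∂ (n + 1)) x →L[ℝ] TangentSpace (𝓡∂ (n + 1)) x →L[ℝ] ℝ)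
    (φ : Chart n M) (x : M) : ℝ :=
  Real.sqrt |(metricMatrix g φ x).det|

/-- The component in a chart of `τ = vol(g)^{-2/(n+2)}`, a section of `E(2)`. -/
def tauComponent
    (g : (x : M) → TangentSpace (𝓡∂ (n + 1)) x →L[ℝ] TangentSpace (𝓡∂ (n + 1)) x →L[ℝ] ℝ)
    (φ : Chart n M) (x : M) : ℝ :=
  volComponent g φ x ^ (-2 / ((n : ℝ) + 2))

/-- The components of `τ⁻¹ g^{ij}`, a section of `E^{(ij)}(-2)` over the interior. -/
def metricBivectorDensity
    (g : (x : M) → TangentSpace (𝓡∂ (n + 1)) x →L[ℝ] TangentSpace (𝓡∂ (n + 1)) x →L[ℝ] ℝ) :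
    Chart n M → M → Matrix (Fin (n + 1)) (Fin (n + 1)) ℝ :=
  fun φ x => (tauComponent g φ x)⁻¹ • (metricMatrix g φ x)⁻¹

end Splitting

end ProjectiveTractor

end

/-! # Scalar curvature at the boundary when the projective structure extends

Write `σ = τ⁻¹ g^{ij}` and, in a chart, `b_i = Γ^k_{ik} / (n+2)`. The proof rests on the following
observations.

*The projective class determines the Thomas symbols.* The trace-free parts
`Γ^k_{ij} - b_i δ^k_j - b_j δ^k_i` of the connection coefficients are unchanged by a projective change
of connection, so they are smooth up to the boundary (`exists_contDiffOn_thomas`) although the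
coefficients `Γ^k_{ij}` themselves are not.

*The metrizability equation is of finite type.* As `σ` is parallel for the Levi-Civita connection, its
derivative in terms of the Thomas symbols is linear in `σ`, up to a trace built from
`m^k = b_l σ^{lk}` (`IsChristoffel.metrizability`). Equality of mixed partial derivatives turns this
into a closed linear first-order system for `σ`, `m` and the divergence of `m`, with coefficients
smooth up to the boundary (`exists_contDiffOn_extension_of_metrizability`). On a half-ball Gronwall's
inequality bounds every solution of such a system, and the equation then yields extensions of all
derivatives (`exists_contDiffOn_extension_of_linear_system`).

*These functions are the entries of `L(σ)`.* Since `σ` is parallel, `L(σ)` is block diagonal in the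
splitting given by the Levi-Civita connection, with blocks `τ⁻¹ S / (n(n+1))` and `σ`
(`splittingOperator_eq`, `bottomSlot_metricBivectorDensity`). Passing to jet coordinates conjugates by
a unipotent matrix with entries `b_i`; the resulting entries are `σ^{ij}`, `m^k` and a function which,
by the behaviour of the Ricci curvature under the projective change to the Thomas symbols, is a
combination of `σ` and `div m` with coefficients smooth up to the boundary
(`IsChristoffel.exists_contDiffOn_extension`, `exists_contDiffOn_splittingOperator`).

*The determinant.* The determinant of the block diagonal form is `S / (n(n+1))` up to the sign of
`det g` (`scalarCurvature_eq_det`), because `det σ` is `τ⁻¹` to the power `n+1` times `(det g)⁻¹` and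
`τ⁻¹` to the power `n+2` is `|det g|`. Hence `S` is smooth up to the boundary as well.

The extensions are the limits from the dense interior. The transition laws, which hold in the interior
by tensoriality of the curvature and the transformation of `b_i` as the logarithmic derivative of a
density (`metricBivectorDensity_transition`, `splittingOperator_transition`), hold at the boundary by
continuity (`eq_of_eqOn_interior`).
-/

set_option linter.unusedSectionVars false

/-! ### Linear systems of finite type up to the boundary -/

namespace ProjectiveTractor

open Set Filter Topology

section LinearSystem

variable {E F : Type*} [NormedAddCommGroup E] [NormedSpace ℝ E] [NormedAddCommGroup F]
  [NormedSpace ℝ F]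

/-- Gronwall's inequality along segments: solutions of a linear system with bounded coefficients on a
bounded convex set are bounded. -/
lemma exists_norm_bound_of_linear_system {O : Set E} (hOc : Convex ℝ O)
    (hOb : Bornology.IsBounded O) {A : E → F →L[ℝ] E →L[ℝ] F} {C : ℝ}
    (hA : ∀ x ∈ O, ‖A x‖ ≤ C) {V : E → F}
    (hV : ∀ x ∈ O, HasFDerivAt V (A x (V x)) x) : ∃ B, ∀ x ∈ O, ‖V x‖ ≤ B := by
  rcases O.eq_empty_or_nonempty with rfl | ⟨x₀, hx₀⟩
  · exact ⟨0, by simp⟩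
  obtain ⟨R, hR⟩ := hOb.subset_closedBall x₀
  have hC : 0 ≤ C := (norm_nonneg (A x₀)).trans (hA x₀ hx₀)
  refine ⟨gronwallBound ‖V x₀‖ (C * R) 0 (1 - 0), fun x hx => ?_⟩
  have hxR : ‖x - x₀‖ ≤ R := by simpa [dist_eq_norm] using hR hx
  have hγ : ∀ t ∈ Icc (0 : ℝ) 1, x₀ + t • (x - x₀) ∈ O := fun t ht =>
    hOc.add_smul_sub_mem hx₀ hx ht
  have hd : ∀ t ∈ Icc (0 : ℝ) 1, HasDerivAt (fun t : ℝ => V (x₀ + t • (x - x₀)))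
      (A (x₀ + t • (x - x₀)) (V (x₀ + t • (x - x₀))) (x - x₀)) t := by
    intro t ht
    have h1 : HasDerivAt (fun t : ℝ => x₀ + t • (x - x₀)) (x - x₀) t := by
      simpa using ((hasDerivAt_id t).smul_const (x - x₀)).const_add x₀
    exact (hV _ (hγ t ht)).comp_hasDerivAt t h1
  have := norm_le_gronwallBound_of_norm_deriv_right_le (K := C * R) (ε := 0) (δ := ‖V x₀‖)
    (a := 0) (b := 1) (f := fun t : ℝ => V (x₀ + t • (x - x₀)))
    (fun t ht => (hd t ht).continuousAt.continuousWithinAt)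
    (fun t ht => (hd t (Ico_subset_Icc_self ht)).hasDerivWithinAt) (by simp)
    (fun t ht => by
      have htO := hγ t (Ico_subset_Icc_self ht)
      calc _ ≤ ‖A (x₀ + t • (x - x₀)) (V (x₀ + t • (x - x₀)))‖ * ‖x - x₀‖ :=
            ContinuousLinearMap.le_opNorm _ _
        _ ≤ (‖A (x₀ + t • (x - x₀))‖ * ‖V (x₀ + t • (x - x₀))‖) * ‖x - x₀‖ := by
            gcongr; exact ContinuousLinearMap.le_opNorm _ _
        _ ≤ (C * ‖V (x₀ + t • (x - x₀))‖) * R := by gcongr; exact hA _ htO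
        _ = _ := by ring) 1 (by simp)
  simpa using this

/-- Solutions on the interior of a compact convex body of a closed linear first-order system whose
coefficients are smooth up to the boundary are themselves smooth up to the boundary: Gronwall's
inequality bounds the solution, hence its derivative, so that it extends continuously, and the
equation then gives one more derivative at each step. -/
theorem exists_contDiffOn_extension_of_linear_system {ι : Type*} [Fintype ι] {K : Set E}
    (hK : IsCompact K) (hKc : Convex ℝ K) (hKi : (interior K).Nonempty)
    {A : E → (ι → ℝ) →L[ℝ] E →L[ℝ] (ι → ℝ)} (hA : ContDiffOn ℝ ∞ A K) {V : E → ι → ℝ}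
    (hV : ∀ x ∈ interior K, HasFDerivAt V (A x (V x)) x) :
    ∃ W : E → ι → ℝ, ContDiffOn ℝ ∞ W K ∧ EqOn V W (interior K) := by
  have hcl : closure (interior K) = K := by
    rw [hKc.closure_interior_eq_closure_of_nonempty_interior hKi, hK.isClosed.closure_eq]
  have hU : UniqueDiffOn ℝ K := uniqueDiffOn_convex hKc hKi
  obtain ⟨C, hC⟩ := hK.exists_bound_of_continuousOn (f := A) hA.continuousOn
  obtain ⟨B, hB⟩ := exists_norm_bound_of_linear_system hKc.interior
    (hK.isBounded.subset interior_subset) (fun x hx => hC x (interior_subset hx)) hV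
  obtain ⟨x₀, hx₀⟩ := hKi
  have hC0 : 0 ≤ C := (norm_nonneg (A x₀)).trans (hC x₀ (interior_subset hx₀))
  have hB0 : 0 ≤ B := (norm_nonneg _).trans (hB x₀ hx₀)
  have hLip : LipschitzOnWith (Real.toNNReal (C * B)) V (interior K) := by
    refine hKc.interior.lipschitzOnWith_of_nnnorm_hasFDerivWithin_le
      (fun x hx => (hV x hx).hasFDerivWithinAt) fun x hx => ?_
    rw [← NNReal.coe_le_coe, coe_nnnorm, Real.coe_toNNReal _ (by positivity)]
    exact ((A x).le_opNorm _).trans (by gcongr; exacts [hC x (interior_subset hx), hB x hx])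
  obtain ⟨W, hWL, hVW⟩ := hLip.extend_pi
  refine ⟨W, ?_, hVW⟩
  have hW' : ∀ x ∈ interior K, HasFDerivAt W (A x (W x)) x := by
    intro x hx
    rw [← hVW hx]
    exact (hV x hx).congr_of_eventuallyEq
      ((hVW.eventuallyEq_of_mem (isOpen_interior.mem_nhds hx)).symm)
  have hAW : ContinuousOn (fun x => A x (W x)) K :=
    hA.continuousOn.clm_apply hWL.continuous.continuousOn
  have hWK : ∀ x ∈ K, HasFDerivWithinAt W (A x (W x)) K x := by
    intro x hx
    have := hasFDerivWithinAt_closure_of_tendsto_fderiv (f := W) (s := interior K) (x := x)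
      (f' := A x (W x)) (fun y hy => (hW' y hy).differentiableAt.differentiableWithinAt)
      hKc.interior isOpen_interior (fun y _ => hWL.continuous.continuousWithinAt) (by
        refine ((hAW x hx).mono_left (nhdsWithin_mono x interior_subset)).congr' ?_
        filter_upwards [self_mem_nhdsWithin] with y hy using (hW' y hy).fderiv.symm)
    rwa [hcl] at this
  rw [contDiffOn_infty]
  intro k
  induction k with
  | zero => exact contDiffOn_zero.2 hWL.continuous.continuousOn
  | succ k ih =>
    refine contDiffOn_succ_of_fderivWithin (n := k)
      (fun x hx => (hWK x hx).differentiableWithinAt) (by simp) ?_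
    exact ((hA.of_le (by exact_mod_cast le_top)).clm_apply ih).congr fun x hx =>
      (hWK x hx).fderivWithin (hU x hx)

end LinearSystem

section SmoothSpan

variable {E : Type*} [NormedAddCommGroup E] [NormedSpace ℝ E]

/-- The algebra of functions that are smooth up to the boundary of `K`. -/
def smoothFunctions (K : Set E) : Subalgebra ℝ (E → ℝ) where
  carrier := {f | ContDiffOn ℝ ∞ f K}
  mul_mem' hf hg := ContDiffOn.mul hf hg
  add_mem' hf hg := ContDiffOn.add hf hg
  algebraMap_mem' _ := contDiffOn_const

/-- The functions which on the interior of `K` are linear combinations of elements of `S`, with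
coefficients smooth up to the boundary of `K`. -/
def smoothSpan (K : Set E) (S : Set (E → ℝ)) : Submodule (smoothFunctions K) (E → ℝ) :=
  Submodule.span (smoothFunctions K) (S ∪ {f | ∀ x ∈ interior K, f x = 0})

variable {K : Set E} {S T : Set (E → ℝ)} {f g : E → ℝ}

lemma subset_smoothSpan (hf : f ∈ S) : f ∈ smoothSpan K S :=
  Submodule.subset_span (Or.inl hf)

lemma smoothSpan_mono (h : S ⊆ T) : smoothSpan K S ≤ smoothSpan K T :=
  Submodule.span_mono (union_subset_union_left _ h)

/-- Membership in `smoothSpan K S` only depends on the values on the interior of `K`. -/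
lemma smoothSpan_congr (hf : f ∈ smoothSpan K S) (h : ∀ x ∈ interior K, g x = f x) :
    g ∈ smoothSpan K S := by
  have : g = f + (g - f) := by ring
  rw [this]
  exact add_mem hf (Submodule.subset_span (Or.inr fun x hx => by simp [h x hx]))

lemma mul_mem_smoothSpan {r : E → ℝ} (hr : ContDiffOn ℝ ∞ r K) (hf : f ∈ smoothSpan K S) :
    (fun x => r x * f x) ∈ smoothSpan K S :=
  (smoothSpan K S).smul_mem (⟨r, hr⟩ : smoothFunctions K) hf

lemma const_mul_mem_smoothSpan (c : ℝ) (hf : f ∈ smoothSpan K S) :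
    (fun x => c * f x) ∈ smoothSpan K S :=
  mul_mem_smoothSpan contDiffOn_const hf

lemma sum_mem_smoothSpan {ι : Type*} [Fintype ι] {F : ι → E → ℝ}
    (h : ∀ i, F i ∈ smoothSpan K S) : (fun x => ∑ i, F i x) ∈ smoothSpan K S := by
  have : (fun x => ∑ i, F i x) = ∑ i, F i := by ext; simp
  rw [this]
  exact sum_mem fun i _ => h i

/-- The product rule: if the derivatives of the elements of `S` in a direction lie in a span
containing `S`, so do the derivatives of all elements of the span of `S`. -/
lemma differentiableAt_and_fderiv_mem_smoothSpan (hU : UniqueDiffOn ℝ K)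
    (hST : S ⊆ smoothSpan K T) (v : E)
    (hd : ∀ f ∈ S, ∀ x ∈ interior K, DifferentiableAt ℝ f x)
    (hS : ∀ f ∈ S, (fun x => fderiv ℝ f x v) ∈ smoothSpan K T) (hf : f ∈ smoothSpan K S) :
    (∀ x ∈ interior K, DifferentiableAt ℝ f x) ∧ (fun x => fderiv ℝ f x v) ∈ smoothSpan K T := by
  have hle : smoothSpan K S ≤ smoothSpan K T := Submodule.span_le.2 <|
    union_subset hST fun f hf => Submodule.subset_span (Or.inr hf)
  refine (Submodule.span_induction (p := fun f _ =>
    f ∈ smoothSpan K S ∧ (∀ x ∈ interior K, DifferentiableAt ℝ f x) ∧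
      (fun x => fderiv ℝ f x v) ∈ smoothSpan K T) ?_ ?_ ?_ ?_ hf).2
  · rintro f (hf | hf)
    · exact ⟨subset_smoothSpan hf, hd f hf, hS f hf⟩
    · have h0 : ∀ x ∈ interior K, f =ᶠ[𝓝 x] fun _ => 0 := fun x hx =>
        Filter.eventuallyEq_of_mem (isOpen_interior.mem_nhds hx) hf
      refine ⟨Submodule.subset_span (Or.inr hf),
        fun x hx => (differentiableAt_const 0).congr_of_eventuallyEq (h0 x hx), ?_⟩
      exact Submodule.subset_span (Or.inr fun x hx => by simp [(h0 x hx).fderiv_eq])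
  · exact ⟨zero_mem _, fun x _ => differentiableAt_const 0,
      Submodule.subset_span (Or.inr fun x _ => by simp)⟩
  · rintro f g - - ⟨hf, hfd, hf'⟩ ⟨hg, hgd, hg'⟩
    refine ⟨add_mem hf hg, fun x hx => (hfd x hx).add (hgd x hx),
      smoothSpan_congr (add_mem hf' hg') fun x hx => ?_⟩
    simp [fderiv_add (hfd x hx) (hgd x hx)]
  · rintro ⟨r, hr : ContDiffOn ℝ ∞ r K⟩ f - ⟨hf, hfd, hf'⟩
    have hrd : ∀ x ∈ interior K, DifferentiableAt ℝ r x := fun x hx =>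
      (hr.contDiffAt (mem_interior_iff_mem_nhds.1 hx)).differentiableAt (by simp)
    refine ⟨Submodule.smul_mem _ _ hf, fun x hx => (hrd x hx).mul (hfd x hx), ?_⟩
    have hr' : ContDiffOn ℝ ∞ (fun x => fderivWithin ℝ r K x v) K :=
      (hr.fderivWithin hU (by simp)).clm_apply contDiffOn_const
    refine smoothSpan_congr (add_mem (mul_mem_smoothSpan hr hf')
      (mul_mem_smoothSpan hr' (hle hf))) fun x hx => ?_
    have : ((⟨r, hr⟩ : smoothFunctions K) • f) = fun y => r y * f y := rfl
    rw [this, fderiv_fun_mul (hrd x hx) (hfd x hx)]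
    simp [fderivWithin_of_mem_nhds (mem_interior_iff_mem_nhds.1 hx), mul_comm]

lemma exists_coeff_of_mem_smoothSpan {ι : Type*} [Fintype ι] {V : ι → E → ℝ}
    (hf : f ∈ smoothSpan K (range V)) : ∃ c : ι → E → ℝ, (∀ a, ContDiffOn ℝ ∞ (c a) K) ∧
      ∀ x ∈ interior K, f x = ∑ a, c a x * V a x := by
  classical
  refine Submodule.span_induction (p := fun f _ => ∃ c : ι → E → ℝ,
    (∀ a, ContDiffOn ℝ ∞ (c a) K) ∧ ∀ x ∈ interior K, f x = ∑ a, c a x * V a x) ?_ ?_ ?_ ?_ hf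
  · rintro f (⟨a, rfl⟩ | hf)
    · exact ⟨fun b _ => if b = a then 1 else 0, fun b => contDiffOn_const, by simp⟩
    · exact ⟨fun b _ => 0, fun b => contDiffOn_const, fun x hx => by simp [hf x hx]⟩
  · exact ⟨fun b _ => 0, fun b => contDiffOn_const, by simp⟩
  · rintro f g - - ⟨c, hc, hf⟩ ⟨d, hd, hg⟩
    exact ⟨fun a x => c a x + d a x, fun a => (hc a).add (hd a), fun x hx => by
      simp [hf x hx, hg x hx, add_mul, Finset.sum_add_distrib]⟩
  · rintro ⟨r, hr : ContDiffOn ℝ ∞ r K⟩ f - ⟨c, hc, hf⟩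
    refine ⟨fun a x => r x * c a x, fun a => hr.mul (hc a), fun x hx => ?_⟩
    have : ((⟨r, hr⟩ : smoothFunctions K) • f) x = r x * f x := rfl
    rw [this, hf x hx, Finset.mul_sum]
    exact Finset.sum_congr rfl fun a _ => by ring

end SmoothSpan

lemma contDiffOn_sum_smul {E G κ : Type*} [NormedAddCommGroup E] [NormedSpace ℝ E]
    [NormedAddCommGroup G] [NormedSpace ℝ G] {s : Finset κ} {K : Set E} {c : κ → E → ℝ}
    (hc : ∀ k, ContDiffOn ℝ ∞ (c k) K) (T : κ → G) :
    ContDiffOn ℝ ∞ (fun x => ∑ k ∈ s, c k x • T k) K :=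
  ContDiffOn.sum fun k _ => (hc k).smul contDiffOn_const

/-- If a finite family of functions spans a module closed under partial derivatives, then all
members of this module extend smoothly to the boundary of `K`. -/
theorem exists_contDiffOn_extension_of_mem_smoothSpan {m : ℕ} {ι : Type*} [Fintype ι]
    {K : Set (EuclideanSpace ℝ (Fin m))}
    (hK : IsCompact K) (hKc : Convex ℝ K) (hKi : (interior K).Nonempty)
    {V : ι → EuclideanSpace ℝ (Fin m) → ℝ}
    (hVd : ∀ a, ∀ x ∈ interior K, DifferentiableAt ℝ (V a) x)
    (hV : ∀ a i, (fun x => fderiv ℝ (V a) x (EuclideanSpace.single i 1)) ∈ smoothSpan K (range V))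
    {f : EuclideanSpace ℝ (Fin m) → ℝ} (hf : f ∈ smoothSpan K (range V)) :
    ∃ g : EuclideanSpace ℝ (Fin m) → ℝ, ContDiffOn ℝ ∞ g K ∧ ∀ x ∈ interior K, f x = g x := by
  classical
  choose c hc hVc using fun a i => exists_coeff_of_mem_smoothSpan (hV a i)
  let T : Fin m → ι → ι → (ι → ℝ) →L[ℝ] EuclideanSpace ℝ (Fin m) →L[ℝ] (ι → ℝ) := fun i a b =>
    (ContinuousLinearMap.proj b : (ι → ℝ) →L[ℝ] ℝ).smulRight
      ((EuclideanSpace.proj i : EuclideanSpace ℝ (Fin m) →L[ℝ] ℝ).smulRight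
        (Pi.single a (1 : ℝ) : ι → ℝ))
  let A : EuclideanSpace ℝ (Fin m) → (ι → ℝ) →L[ℝ] EuclideanSpace ℝ (Fin m) →L[ℝ] (ι → ℝ) :=
    fun x => ∑ k : Fin m × ι × ι, c k.2.1 k.1 k.2.2 x • T k.1 k.2.1 k.2.2
  have hA : ContDiffOn ℝ ∞ A K := contDiffOn_sum_smul (fun k : Fin m × ι × ι => hc k.2.1 k.1 k.2.2) _
  obtain ⟨W, hW, hVW⟩ := exists_contDiffOn_extension_of_linear_system hK hKc hKi hA
    (V := fun x a => V a x) (by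
      intro x hx
      rw [hasFDerivAt_pi']
      intro a
      convert! (hVd a x hx).hasFDerivAt using 1
      ext v
      have hv : v = ∑ i, v i • EuclideanSpace.single i (1 : ℝ) := by
        ext j
        simp [Finset.sum_apply, Pi.single_apply]
      conv_rhs => rw [hv]
      simp only [map_sum, map_smul, hVc a _ x hx]
      simp [A, T, Fintype.sum_prod_type, Pi.single_apply, Finset.mul_sum, mul_comm, mul_left_comm, mul_assoc])
  obtain ⟨d, hd, hfd⟩ := exists_coeff_of_mem_smoothSpan hf
  refine ⟨fun x => ∑ a, d a x * W x a, ContDiffOn.sum fun a _ =>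
    (hd a).mul (contDiffOn_pi.1 hW a), fun x hx => ?_⟩
  rw [hfd x hx]
  exact Finset.sum_congr rfl fun a _ => by rw [← hVW hx]

end ProjectiveTractor

/-! ### Prolongation of the metrizability equation -/

namespace ProjectiveTractor

open Set Filter Topology

section Prolongation

variable {n : ℕ}

/-- The partial derivative in the direction of the `i`-th coordinate of the model space. -/
noncomputable def pd (i : Fin (n + 1)) (f : Model n → ℝ) (x : Model n) : ℝ :=
  fderiv ℝ f x (stdVec i)

variable {O K : Set (Model n)} {f g : Model n → ℝ} {x : Model n}

lemma pd_congr (hO : IsOpen O) (h : ∀ y ∈ O, f y = g y) (i : Fin (n + 1)) (hx : x ∈ O) :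
    pd i f x = pd i g x := by
  rw [pd, (Filter.eventuallyEq_of_mem (hO.mem_nhds hx) h).fderiv_eq, pd]

lemma contDiffOn_pd (hO : IsOpen O) (hf : ContDiffOn ℝ ∞ f O) (i : Fin (n + 1)) :
    ContDiffOn ℝ ∞ (pd i f) O :=
  (hf.fderiv_of_isOpen hO (by simp)).clm_apply contDiffOn_const

lemma differentiableAt_of_contDiffOn (hO : IsOpen O) (hf : ContDiffOn ℝ ∞ f O) (hx : x ∈ O) :
    DifferentiableAt ℝ f x :=
  (hf.contDiffAt (hO.mem_nhds hx)).differentiableAt (by simp)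

lemma pd_comm (hO : IsOpen O) (hf : ContDiffOn ℝ ∞ f O) (i j : Fin (n + 1)) (hx : x ∈ O) :
    pd i (pd j f) x = pd j (pd i f) x := by
  have hfx := hf.contDiffAt (hO.mem_nhds hx)
  have hd : DifferentiableAt ℝ (fderiv ℝ f) x :=
    (hfx.fderiv_right (m := ∞) (by simp)).differentiableAt (by simp)
  have key : ∀ i j : Fin (n + 1), pd i (pd j f) x = fderiv ℝ (fderiv ℝ f) x (stdVec i) (stdVec j) := by
    intro i j
    change fderiv ℝ (fun y => fderiv ℝ f y (stdVec j)) x (stdVec i) = _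
    rw [fderiv_clm_apply hd (differentiableAt_const _)]
    simp
  rw [key, key]
  exact (hfx.isSymmSndFDerivAt (by simpa using (ENat.LEInfty.out : (2 : ℕ∞ω) ≤ ∞))) _ _

lemma pd_add (i : Fin (n + 1)) (hf : DifferentiableAt ℝ f x) (hg : DifferentiableAt ℝ g x) :
    pd i (fun y => f y + g y) x = pd i f x + pd i g x := by
  simp [pd, fderiv_fun_add hf hg]

lemma pd_sub (i : Fin (n + 1)) (hf : DifferentiableAt ℝ f x) (hg : DifferentiableAt ℝ g x) :
    pd i (fun y => f y - g y) x = pd i f x - pd i g x := by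
  simp [pd, fderiv_fun_sub hf hg]

lemma pd_mul (i : Fin (n + 1)) (hf : DifferentiableAt ℝ f x) (hg : DifferentiableAt ℝ g x) :
    pd i (fun y => f y * g y) x = pd i f x * g x + f x * pd i g x := by
  simp [pd, fderiv_fun_mul hf hg]; ring

lemma pd_const_mul (i : Fin (n + 1)) (c : ℝ) (hf : DifferentiableAt ℝ f x) :
    pd i (fun y => c * f y) x = c * pd i f x := by
  simp [pd, fderiv_const_mul hf]

lemma pd_const (i : Fin (n + 1)) (c : ℝ) : pd i (fun _ => c) x = 0 := by
  simp [pd]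

lemma pd_sum {ι : Type*} [Fintype ι] {F : ι → Model n → ℝ} (i : Fin (n + 1))
    (hF : ∀ a, DifferentiableAt ℝ (F a) x) :
    pd i (fun y => ∑ a, F a y) x = ∑ a, pd i (F a) x := by
  simp [pd, fderiv_fun_sum fun a _ => hF a]

/-- Prolongation of the metrizability equation. Suppose that
`∂_i σ^{jk} = -δ_i^j m^k - δ_i^k m^j + (terms linear in σ)` with coefficients smooth up to the
boundary. Commuting second derivatives of `σ` gives `∂_p m^k = δ_p^k q` up to terms linear in
`(σ, m)`, where `q` is proportional to the divergence of `m`; commuting second derivatives of `m`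
gives `∂_i q` up to terms linear in `(σ, m, q)`, as the dimension is at least two. The resulting
closed system forces all these functions to extend smoothly. -/
theorem exists_contDiffOn_extension_of_metrizability (hn : 1 ≤ n) (hK : IsCompact K)
    (hKc : Convex ℝ K) (hKi : (interior K).Nonempty)
    {σ : Fin (n + 1) × Fin (n + 1) → Model n → ℝ} {m : Fin (n + 1) → Model n → ℝ}
    (hσ : ∀ a, ContDiffOn ℝ ∞ (σ a) (interior K)) (hm : ∀ k, ContDiffOn ℝ ∞ (m k) (interior K))
    (h : ∀ i j k, (fun x => pd i (σ (j, k)) x + (if i = j then m k x else 0)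
      + (if i = k then m j x else 0)) ∈ smoothSpan K (range σ))
    (hf : f ∈ smoothSpan K (range σ ∪ range m ∪ {fun x => ∑ k, pd k (m k) x})) :
    ∃ g : Model n → ℝ, ContDiffOn ℝ ∞ g K ∧ ∀ x ∈ interior K, f x = g x := by
  have hO : IsOpen (interior K) := isOpen_interior
  have hU : UniqueDiffOn ℝ K := uniqueDiffOn_convex hKc hKi
  have hN : ((n : ℝ) + 1) ≠ 0 := by positivity
  set q : Model n → ℝ := fun x => ∑ k, pd k (m k) x with hq
  have hqs : ContDiffOn ℝ ∞ q (interior K) := ContDiffOn.sum fun k _ => contDiffOn_pd hO (hm k) k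
  set S₀ : Set (Model n → ℝ) := range σ with hS₀
  set S₁ : Set (Model n → ℝ) := S₀ ∪ range m with hS₁
  have hS₀₁ : S₀ ⊆ S₁ := subset_union_left
  have hS₁₂ : S₁ ⊆ S₁ ∪ {q} := subset_union_left
  have hd : ∀ f ∈ S₁ ∪ {q}, ContDiffOn ℝ ∞ f (interior K) := by
    rintro f ((⟨a, rfl⟩ | ⟨k, rfl⟩) | hf)
    · exact hσ a
    · exact hm k
    · rw [mem_singleton_iff.1 hf]; exact hqs
  have hite : ∀ {S : Set (Model n → ℝ)} {f : Model n → ℝ} (p : Prop) [Decidable p],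
      f ∈ smoothSpan K S → (fun x => if p then f x else 0) ∈ smoothSpan K S := by
    intro S f p _ hf
    split_ifs
    · exact hf
    · exact zero_mem _
  have hm₁ : ∀ k, m k ∈ smoothSpan K S₁ := fun k => subset_smoothSpan (Or.inr ⟨k, rfl⟩)
  have hq₂ : q ∈ smoothSpan K (S₁ ∪ {q}) := subset_smoothSpan (Or.inr rfl)
  -- derivatives of `σ`, and of all linear combinations of its components
  have hσ' : ∀ i a, pd i (σ a) ∈ smoothSpan K S₁ := by
    rintro i ⟨j, k⟩
    refine smoothSpan_congr (sub_mem (sub_mem (smoothSpan_mono hS₀₁ (h i j k))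
      (hite (i = j) (hm₁ k))) (hite (i = k) (hm₁ j))) fun x _ => ?_
    simp only [Pi.sub_apply]
    ring
  have h₀ : ∀ f ∈ smoothSpan K S₀, ∀ i, pd i f ∈ smoothSpan K S₁ := fun f hf i =>
    (differentiableAt_and_fderiv_mem_smoothSpan hU (fun g hg => subset_smoothSpan (hS₀₁ hg))
      (stdVec i) (fun g hg x hx => differentiableAt_of_contDiffOn hO (hd g (hS₁₂ (hS₀₁ hg))) hx)
      (by rintro _ ⟨a, rfl⟩; exact hσ' i a) hf).2
  -- commuting the second derivatives of `σ`
  have hite_d : ∀ (p : Prop) [Decidable p] (i k : Fin (n + 1)), ∀ x ∈ interior K,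
      pd i (fun y => if p then m k y else 0) x = if p then pd i (m k) x else 0 := by
    intro p _ i k x hx
    split_ifs
    · rfl
    · exact pd_const i 0
  have hite_diff : ∀ (p : Prop) [Decidable p] (k : Fin (n + 1)), ∀ x ∈ interior K,
      DifferentiableAt ℝ (fun y => if p then m k y else 0) x := by
    intro p _ k x hx
    split_ifs
    · exact differentiableAt_of_contDiffOn hO (hm k) hx
    · exact differentiableAt_const 0
  have hℓ : ∀ p i j k, ∀ x ∈ interior K, pd p (fun x => pd i (σ (j, k)) x
      + (if i = j then m k x else 0) + (if i = k then m j x else 0)) x = pd p (pd i (σ (j, k))) x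
        + (if i = j then pd p (m k) x else 0) + (if i = k then pd p (m j) x else 0) := by
    intro p i j k x hx
    have h1 := differentiableAt_of_contDiffOn hO (contDiffOn_pd hO (hσ (j, k)) i) hx
    rw [pd_add _ (h1.fun_add (hite_diff _ _ x hx)) (hite_diff _ _ x hx),
      pd_add _ h1 (hite_diff _ _ x hx), hite_d _ _ _ x hx, hite_d _ _ _ x hx]
  have hr : ∀ p k, (fun x => pd p (m k) x - (if p = k then ((n : ℝ) + 1)⁻¹ else 0) * q x) ∈
      smoothSpan K S₁ := by
    intro p k
    refine smoothSpan_congr (const_mul_mem_smoothSpan ((n : ℝ) + 1)⁻¹ (sum_mem_smoothSpan fun i =>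
      sub_mem (h₀ _ (h i i k) p) (h₀ _ (h p i k) i))) fun x hx => ?_
    have e : ∀ i, (pd p (fun x => pd i (σ (i, k)) x + (if i = i then m k x else 0)
        + (if i = k then m i x else 0)) - pd i (fun x => pd p (σ (i, k)) x
        + (if p = i then m k x else 0) + (if p = k then m i x else 0))) x =
        (pd p (m k) x + (if i = k then pd p (m i) x else 0))
          - ((if p = i then pd i (m k) x else 0) + if p = k then pd i (m i) x else 0) := by
      intro i
      rw [Pi.sub_apply, hℓ _ _ _ _ x hx, hℓ _ _ _ _ x hx, pd_comm hO (hσ _) p i hx, if_pos rfl]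
      ring
    rw [Finset.sum_congr rfl fun i _ => e i]
    simp only [Finset.sum_sub_distrib, Finset.sum_add_distrib, Finset.sum_ite_eq,
      Finset.sum_ite_eq', Finset.mem_univ, if_true, Finset.sum_const, Finset.card_univ,
      Fintype.card_fin, nsmul_eq_mul, Nat.cast_add, Nat.cast_one, hq]
    by_cases hpk : p = k
    · simp only [hpk, if_true]; field_simp; ring
    · simp only [hpk, if_false, Finset.sum_const_zero]; field_simp; ring
  -- commuting the second derivatives of `m`
  have hm' : ∀ i k, pd i (m k) ∈ smoothSpan K (S₁ ∪ {q}) := fun i k =>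
    smoothSpan_congr (add_mem (smoothSpan_mono hS₁₂ (hr i k))
      (const_mul_mem_smoothSpan (if i = k then ((n : ℝ) + 1)⁻¹ else 0) hq₂)) fun x _ => by simp
  have h₁ : ∀ f ∈ smoothSpan K S₁, ∀ i, pd i f ∈ smoothSpan K (S₁ ∪ {q}) := fun f hf i =>
    (differentiableAt_and_fderiv_mem_smoothSpan hU (fun g hg => subset_smoothSpan (hS₁₂ hg))
      (stdVec i) (fun g hg x hx => differentiableAt_of_contDiffOn hO (hd g (hS₁₂ hg)) hx)
      (by
        rintro _ (⟨a, rfl⟩ | ⟨k, rfl⟩)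
        exacts [smoothSpan_mono hS₁₂ (hσ' i a), hm' i k]) hf).2
  have hq' : ∀ i, pd i q ∈ smoothSpan K (S₁ ∪ {q}) := by
    intro i
    refine smoothSpan_congr (const_mul_mem_smoothSpan (-((n : ℝ) + 1) / n)
      (sum_mem_smoothSpan fun k => sub_mem (h₁ _ (hr k k) i) (h₁ _ (hr i k) k))) fun x hx => ?_
    have hpd : ∀ i p k, pd i (fun x => pd p (m k) x -
        (if p = k then ((n : ℝ) + 1)⁻¹ else 0) * q x) x = pd i (pd p (m k)) x -
        (if p = k then ((n : ℝ) + 1)⁻¹ else 0) * pd i q x := by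
      intro i p k
      have h2 := differentiableAt_of_contDiffOn hO hqs hx
      rw [pd_sub _ (differentiableAt_of_contDiffOn hO (contDiffOn_pd hO (hm k) p) hx)
        (h2.const_mul _), pd_const_mul _ _ h2]
    have e : ∀ k, (pd i (fun x => pd k (m k) x - (if k = k then ((n : ℝ) + 1)⁻¹ else 0) * q x)
        - pd k (fun x => pd i (m k) x - (if i = k then ((n : ℝ) + 1)⁻¹ else 0) * q x)) x =
        (if i = k then ((n : ℝ) + 1)⁻¹ * pd k q x else 0) - ((n : ℝ) + 1)⁻¹ * pd i q x := by
      intro k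
      rw [Pi.sub_apply, hpd, hpd, pd_comm hO (hm k) i k hx, if_pos rfl]
      split_ifs <;> ring
    have hn' : (n : ℝ) ≠ 0 := by positivity
    rw [Finset.sum_congr rfl fun i _ => e i]
    simp only [Finset.sum_sub_distrib, Finset.sum_ite_eq, Finset.mem_univ, if_true,
      Finset.sum_const, Finset.card_univ, Fintype.card_fin, nsmul_eq_mul, Nat.cast_add,
      Nat.cast_one]
    field_simp
    ring
  -- the closed system
  let V : (Fin (n + 1) × Fin (n + 1)) ⊕ Fin (n + 1) ⊕ Unit → Model n → ℝ :=
    Sum.elim σ (Sum.elim m fun _ => q)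
  have hV : range V = S₁ ∪ {q} := by
    simp only [V, Sum.elim_range, hS₁, hS₀, union_assoc, range_const]
  refine exists_contDiffOn_extension_of_mem_smoothSpan hK hKc hKi (V := V)
    (fun a x hx => differentiableAt_of_contDiffOn hO (hd _ (hV ▸ mem_range_self a)) hx) ?_
    (by rw [hV]; exact hf)
  rw [hV]
  rintro (a | k | _) i
  exacts [smoothSpan_mono hS₁₂ (hσ' i a), hm' i k, hq' i]

end Prolongation

end ProjectiveTractor

/-! ### Derivatives of determinants and inverses; Christoffel symbols -/

namespace ProjectiveTractor

open Set Filter Topology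

section MatrixCalculus

variable {n : ℕ} {ι : Type*} [Fintype ι] [DecidableEq ι] {O : Set (Model n)} {x : Model n}
  {G : Model n → Matrix ι ι ℝ}

lemma contDiffOn_det {E : Type*} [NormedAddCommGroup E] [NormedSpace ℝ E] {s : Set E}
    {G : E → Matrix ι ι ℝ} (hG : ∀ i j, ContDiffOn ℝ ∞ (fun x => G x i j) s) :
    ContDiffOn ℝ ∞ (fun x => (G x).det) s := by
  simp only [Matrix.det_apply']
  exact ContDiffOn.sum fun τ _ => contDiffOn_const.mul (contDiffOn_prod fun i _ => hG _ _)

lemma contDiffOn_inv_apply {E : Type*} [NormedAddCommGroup E] [NormedSpace ℝ E] {s : Set E}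
    {G : E → Matrix ι ι ℝ} (hG : ∀ i j, ContDiffOn ℝ ∞ (fun x => G x i j) s)
    (hdet : ∀ x ∈ s, (G x).det ≠ 0) (i j : ι) : ContDiffOn ℝ ∞ (fun x => (G x)⁻¹ i j) s := by
  simp only [Matrix.inv_def, Matrix.smul_apply, smul_eq_mul, Ring.inverse_eq_inv',
    Matrix.adjugate_apply]
  refine ((contDiffOn_det hG).inv hdet).mul (contDiffOn_det fun k l => ?_)
  simp only [Matrix.updateRow_apply]
  split_ifs
  · exact contDiffOn_const
  · exact hG k l

/-- Jacobi's formula for the derivative of a determinant. -/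
lemma pd_det (i : Fin (n + 1)) (hG : ∀ j k, DifferentiableAt ℝ (fun y => G y j k) x) :
    pd i (fun y => (G y).det) x =
      ((G x).adjugate * Matrix.of fun j k => pd i (fun y => G y j k) x).trace := by
  have h1 : HasFDerivAt (fun y => (G y).det) (∑ τ : Equiv.Perm ι, ((Equiv.Perm.sign τ : ℤ) : ℝ) •
      ∑ r, (∏ j ∈ Finset.univ.erase r, G x (τ j) j) • fderiv ℝ (fun y => G y (τ r) r) x) x := by
    simp only [Matrix.det_apply']
    exact HasFDerivAt.fun_sum fun τ _ =>
      (HasFDerivAt.finsetProd fun r _ => (hG (τ r) r).hasFDerivAt).const_mul _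
  have h2 : ∀ r, ((G x).adjugate * Matrix.of fun j k => pd i (fun y => G y j k) x) r r =
      ∑ τ : Equiv.Perm ι, ((Equiv.Perm.sign τ : ℤ) : ℝ) *
        ((∏ j ∈ Finset.univ.erase r, G x (τ j) j) * pd i (fun y => G y (τ r) r) x) := by
    intro r
    have : ((G x).adjugate * Matrix.of fun j k => pd i (fun y => G y j k) x) r r =
        ((G x).adjugate.mulVec fun j => pd i (fun y => G y j r) x) r := rfl
    rw [this, ← Matrix.cramer_eq_adjugate_mulVec, Matrix.cramer_apply, Matrix.det_apply']
    refine Finset.sum_congr rfl fun τ _ => ?_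
    rw [← Finset.prod_erase_mul _ _ (Finset.mem_univ r)]
    congr 2
    · exact Finset.prod_congr rfl fun j hj => by
        rw [Matrix.updateCol_ne (Finset.ne_of_mem_erase hj)]
    · simp
  rw [pd, h1.fderiv, Matrix.trace]
  simp only [Matrix.diag_apply, h2]
  rw [Finset.sum_comm]
  simp [pd, Finset.mul_sum]

lemma pd_inv (hO : IsOpen O) (hG : ∀ i j, ContDiffOn ℝ ∞ (fun x => G x i j) O)
    (hdet : ∀ x ∈ O, (G x).det ≠ 0) (i : Fin (n + 1)) (hx : x ∈ O) :
    (Matrix.of fun j k => pd i (fun y => (G y)⁻¹ j k) x) =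
      -((G x)⁻¹ * (Matrix.of fun j k => pd i (fun y => G y j k) x) * (G x)⁻¹) := by
  have hGd : ∀ j k, DifferentiableAt ℝ (fun y => G y j k) x := fun j k =>
    differentiableAt_of_contDiffOn hO (hG j k) hx
  have hHd : ∀ j k, DifferentiableAt ℝ (fun y => (G y)⁻¹ j k) x := fun j k =>
    differentiableAt_of_contDiffOn hO (contDiffOn_inv_apply hG hdet j k) hx
  have h0 : (Matrix.of fun j k => pd i (fun y => (G y)⁻¹ j k) x) * G x +
      (G x)⁻¹ * (Matrix.of fun j k => pd i (fun y => G y j k) x) = 0 := by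
    ext j k
    have h1 : pd i (fun y => ∑ l, (G y)⁻¹ j l * G y l k) x = 0 := by
      rw [pd_congr hO (g := fun _ => (1 : Matrix ι ι ℝ) j k) (fun y hy => ?_) i hx, pd_const]
      rw [← Matrix.mul_apply, Matrix.nonsing_inv_mul _ (isUnit_iff_ne_zero.2 (hdet y hy))]
    rw [pd_sum i fun l => (hHd j l).fun_mul (hGd l k)] at h1
    simp only [pd_mul i (hHd j _) (hGd _ k), Finset.sum_add_distrib] at h1
    simpa [Matrix.mul_apply] using h1
  have hu : G x * (G x)⁻¹ = 1 := Matrix.mul_nonsing_inv _ (isUnit_iff_ne_zero.2 (hdet x hx))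
  calc _ = (Matrix.of fun j k => pd i (fun y => (G y)⁻¹ j k) x) * (G x * (G x)⁻¹) := by simp [hu]
    _ = _ := by rw [← mul_assoc, eq_neg_of_add_eq_zero_left h0, neg_mul]

end MatrixCalculus

section MetricConnection

variable {n : ℕ}

/-- The functions `Γ^k_{ij}` (written `Γ x k i j`) are the Christoffel symbols of a smooth
pseudo-Riemannian metric with components `G` on the open set `O` of the model space. -/
structure IsChristoffel (O : Set (Model n)) (G : Model n → Matrix (Fin (n + 1)) (Fin (n + 1)) ℝ)
    (Γ : Model n → Fin (n + 1) → Fin (n + 1) → Fin (n + 1) → ℝ) : Prop where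
  smooth : ∀ i j, ContDiffOn ℝ ∞ (fun x => G x i j) O
  isSymm : ∀ x ∈ O, (G x).IsSymm
  det_ne_zero : ∀ x ∈ O, (G x).det ≠ 0
  torsion_free : ∀ x ∈ O, ∀ k i j, Γ x k i j = Γ x k j i
  metric : ∀ x ∈ O, ∀ i j k, pd i (fun y => G y j k) x =
    ∑ l, Γ x l i j * G x l k + ∑ l, G x j l * Γ x l i k

variable {O : Set (Model n)} {G : Model n → Matrix (Fin (n + 1)) (Fin (n + 1)) ℝ}
  {Γ : Model n → Fin (n + 1) → Fin (n + 1) → Fin (n + 1) → ℝ} {x : Model n}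

/-- Koszul's formula. -/
lemma IsChristoffel.koszul (h : IsChristoffel O G Γ) (hx : x ∈ O) (k i j : Fin (n + 1)) :
    Γ x k i j = ∑ l, (G x)⁻¹ k l * (1 / 2 * (pd i (fun y => G y j l) x + pd j (fun y => G y i l) x
      - pd l (fun y => G y i j) x)) := by
  have hs : ∀ a b, G x a b = G x b a := fun a b => (h.isSymm x hx).apply b a
  have h1 : ∀ l, 1 / 2 * (pd i (fun y => G y j l) x + pd j (fun y => G y i l) x
      - pd l (fun y => G y i j) x) = ∑ p, G x l p * Γ x p i j := by
    intro l
    have e1 : ∑ p, Γ x p i j * G x p l = ∑ p, G x l p * Γ x p i j :=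
      Finset.sum_congr rfl fun p _ => by rw [hs p l, mul_comm]
    have e2 : ∑ p, Γ x p j i * G x p l = ∑ p, G x l p * Γ x p i j :=
      Finset.sum_congr rfl fun p _ => by rw [hs p l, mul_comm, h.torsion_free x hx p j i]
    have e3 : ∑ p, G x j p * Γ x p i l = ∑ p, G x j p * Γ x p l i :=
      Finset.sum_congr rfl fun p _ => by rw [h.torsion_free x hx p i l]
    have e4 : ∑ p, G x i p * Γ x p j l = ∑ p, Γ x p l j * G x i p :=
      Finset.sum_congr rfl fun p _ => by rw [h.torsion_free x hx p j l, mul_comm]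
    have e5 : ∑ p, Γ x p l i * G x p j = ∑ p, G x j p * Γ x p l i :=
      Finset.sum_congr rfl fun p _ => by rw [hs p j, mul_comm]
    have e6 : ∑ p, G x i p * Γ x p l j = ∑ p, Γ x p l j * G x i p :=
      Finset.sum_congr rfl fun p _ => by rw [mul_comm]
    rw [h.metric x hx, h.metric x hx, h.metric x hx, e1, e2, e3, e4, e5, e6]
    ring
  simp only [h1]
  have h2 : ∑ l, (G x)⁻¹ k l * ∑ p, G x l p * Γ x p i j =
      ((G x)⁻¹.mulVec ((G x).mulVec fun p => Γ x p i j)) k := rfl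
  rw [h2, Matrix.mulVec_mulVec,
    Matrix.nonsing_inv_mul _ (isUnit_iff_ne_zero.2 (h.det_ne_zero x hx)), Matrix.one_mulVec]

/-- Koszul's formula shows that the Christoffel symbols are smooth. -/
lemma IsChristoffel.contDiffOn (hO : IsOpen O) (h : IsChristoffel O G Γ) (k i j : Fin (n + 1)) :
    ContDiffOn ℝ ∞ (fun x => Γ x k i j) O := by
  refine ContDiffOn.congr ?_ fun x hx => h.koszul hx k i j
  exact ContDiffOn.sum fun l _ => (contDiffOn_inv_apply h.smooth h.det_ne_zero k l).mul
    (contDiffOn_const.mul (((contDiffOn_pd hO (h.smooth j l) i).add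
      (contDiffOn_pd hO (h.smooth i l) j)).sub (contDiffOn_pd hO (h.smooth i j) l)))

lemma IsChristoffel.pd_matrix (h : IsChristoffel O G Γ) (hx : x ∈ O) (i : Fin (n + 1)) :
    (Matrix.of fun j k => pd i (fun y => G y j k) x) =
      (Matrix.of fun l j => Γ x l i j).transpose * G x + G x * Matrix.of fun l j => Γ x l i j := by
  ext j k
  simp [h.metric x hx, Matrix.mul_apply]

/-- The inverse metric is parallel. -/
lemma IsChristoffel.pd_inv (hO : IsOpen O) (h : IsChristoffel O G Γ) (hx : x ∈ O)
    (i j k : Fin (n + 1)) : pd i (fun y => (G y)⁻¹ j k) x =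
      -(∑ l, Γ x j i l * (G x)⁻¹ l k) - ∑ l, Γ x k i l * (G x)⁻¹ j l := by
  have hu := isUnit_iff_ne_zero.2 (h.det_ne_zero x hx)
  have h1 : (Matrix.of fun j k => pd i (fun y => (G y)⁻¹ j k) x) =
      -((Matrix.of fun l j => Γ x l i j) * (G x)⁻¹) -
        (G x)⁻¹ * (Matrix.of fun l j => Γ x l i j).transpose := by
    rw [ProjectiveTractor.pd_inv hO h.smooth h.det_ne_zero i hx, h.pd_matrix hx i, mul_add, add_mul,
      ← mul_assoc, mul_assoc _ (G x) (G x)⁻¹, Matrix.mul_nonsing_inv _ hu, mul_one, ← mul_assoc,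
      Matrix.nonsing_inv_mul _ hu, one_mul]
    abel
  have := congrFun (congrFun h1 j) k
  simp only [Matrix.of_apply, Matrix.sub_apply, Matrix.neg_apply, Matrix.mul_apply,
    Matrix.transpose_apply] at this
  rw [this]
  simp only [mul_comm]

/-- The trace of the Christoffel symbols is the logarithmic derivative of the volume density. Here
`Real.log` is the logarithm of the absolute value. -/
lemma IsChristoffel.pd_log_det (hO : IsOpen O) (h : IsChristoffel O G Γ) (hx : x ∈ O)
    (i : Fin (n + 1)) : pd i (fun y => Real.log (G y).det) x = 2 * ∑ k, Γ x k i k := by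
  have hd := h.det_ne_zero x hx
  have hu := isUnit_iff_ne_zero.2 hd
  have h1 : pd i (fun y => (G y).det) x = (G x).det * (2 * ∑ k, Γ x k i k) := by
    have ha : (G x).adjugate = (G x).det • (G x)⁻¹ := by
      rw [Matrix.inv_def, smul_smul, Ring.inverse_eq_inv', mul_inv_cancel₀ hd, one_smul]
    rw [pd_det i fun j k => differentiableAt_of_contDiffOn hO (h.smooth j k) hx, h.pd_matrix hx i,
      ha, Matrix.smul_mul, Matrix.trace_smul, mul_add, Matrix.trace_add, ← mul_assoc, ← mul_assoc,
      Matrix.nonsing_inv_mul _ hu, one_mul, Matrix.trace_mul_comm, ← mul_assoc,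
      Matrix.mul_nonsing_inv _ hu, one_mul, Matrix.trace_transpose]
    simp only [Matrix.trace, Matrix.diag_apply, Matrix.of_apply, smul_eq_mul]
    ring
  have h2 := differentiableAt_of_contDiffOn hO (contDiffOn_det h.smooth) hx
  rw [pd, fderiv.log h2 hd]
  simp only [smul_apply, smul_eq_mul]
  rw [← pd, h1]
  field_simp

end MetricConnection

end ProjectiveTractor

/-! ### Thomas symbols and projective changes -/

namespace ProjectiveTractor

open Set Filter Topology

section ProjectiveInvariants

variable {n : ℕ}

/-- The normalized trace `b_i = Γ^k_{ik} / (n+2)` of connection coefficients. -/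
noncomputable def normalizedTrace (Γ : Model n → Fin (n + 1) → Fin (n + 1) → Fin (n + 1) → ℝ)
    (x : Model n) (i : Fin (n + 1)) : ℝ :=
  (∑ k, Γ x k i k) / ((n : ℝ) + 2)

/-- The Thomas symbols `Γ^k_{ij} - b_i δ^k_j - b_j δ^k_i`: the trace-free part of the connection
coefficients, which only depends on the projective class. -/
noncomputable def thomas (Γ : Model n → Fin (n + 1) → Fin (n + 1) → Fin (n + 1) → ℝ)
    (x : Model n) (k i j : Fin (n + 1)) : ℝ :=
  Γ x k i j - (if k = j then normalizedTrace Γ x i else 0)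
    - (if k = i then normalizedTrace Γ x j else 0)

/-- The Ricci curvature `Ric_{ij} = R_{ki}{}^k{}_j` in terms of connection coefficients. -/
noncomputable def ricciCoord (Γ : Model n → Fin (n + 1) → Fin (n + 1) → Fin (n + 1) → ℝ)
    (x : Model n) (i j : Fin (n + 1)) : ℝ :=
  ∑ k, (pd k (fun y => Γ y k i j) x - pd i (fun y => Γ y k k j) x
    + ∑ l, (Γ x l i j * Γ x k k l - Γ x l k j * Γ x k i l))

lemma sum_thomas {Γ : Model n → Fin (n + 1) → Fin (n + 1) → Fin (n + 1) → ℝ} (x : Model n)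
    (i : Fin (n + 1)) : ∑ k, thomas Γ x k i k = 0 := by
  have hb : ∑ k, Γ x k i k = ((n : ℝ) + 2) * normalizedTrace Γ x i := by
    rw [normalizedTrace]; field_simp
  simp only [thomas, Finset.sum_sub_distrib, hb, if_true, Finset.sum_const, Finset.card_univ,
    Fintype.card_fin, nsmul_eq_mul, Finset.sum_ite_eq', Finset.mem_univ]
  push_cast
  ring

lemma contDiffOn_thomas {Γ : Model n → Fin (n + 1) → Fin (n + 1) → Fin (n + 1) → ℝ}
    {U : Set (Model n)} (hΓ : ∀ k i j, ContDiffOn ℝ ∞ (fun p => Γ p k i j) U)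
    (k i j : Fin (n + 1)) : ContDiffOn ℝ ∞ (fun p => thomas Γ p k i j) U := by
  have h1 : ∀ i, ContDiffOn ℝ ∞ (fun p => normalizedTrace Γ p i) U := fun i =>
    (ContDiffOn.sum fun k _ => hΓ k i k).div_const _
  refine ((hΓ k i j).sub ?_).sub ?_ <;> split_ifs <;>
    first | exact h1 _ | exact contDiffOn_const

/-- The Thomas symbols of projectively equivalent connections agree. -/
lemma thomas_eq_of_projectively_equivalent
    {Γ Γ' : Model n → Fin (n + 1) → Fin (n + 1) → Fin (n + 1) → ℝ} {x : Model n}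
    {υ : Fin (n + 1) → ℝ} (h : ∀ k i j, Γ' x k i j = Γ x k i j +
      (if k = j then υ i else 0) + (if k = i then υ j else 0)) (k i j : Fin (n + 1)) :
    thomas Γ' x k i j = thomas Γ x k i j := by
  have hb : ∀ i, normalizedTrace Γ' x i = normalizedTrace Γ x i + υ i := by
    intro i
    simp only [normalizedTrace, h, Finset.sum_add_distrib, if_true, Finset.sum_const,
      Finset.card_univ, Fintype.card_fin, nsmul_eq_mul, Finset.sum_ite_eq', Finset.mem_univ]
    push_cast
    field_simp
    ring
  simp only [thomas, hb, h]
  split_ifs <;> ring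

/-- The behaviour of the Ricci curvature under a projective change of connection, for the
coefficients and their first derivatives at a point. -/
lemma ricci_projective_change_pointwise {Γ P : Fin (n + 1) → Fin (n + 1) → Fin (n + 1) → ℝ}
    {b : Fin (n + 1) → ℝ} {dΓ dP : Fin (n + 1) → Fin (n + 1) → Fin (n + 1) → Fin (n + 1) → ℝ}
    {db : Fin (n + 1) → Fin (n + 1) → ℝ}
    (hΓ : ∀ k i j, Γ k i j = P k i j + (if k = j then b i else 0) + (if k = i then b j else 0))
    (hdΓ : ∀ p k i j, dΓ p k i j =
      dP p k i j + (if k = j then db p i else 0) + (if k = i then db p j else 0))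
    (hP : ∀ k i j, P k i j = P k j i) (hP0 : ∀ i, ∑ k, P k i k = 0)
    (hdP : ∀ p k i j, dP p k i j = dP p k j i) (hdP0 : ∀ p i, ∑ k, dP p k i k = 0)
    (hdb : ∀ i j, db i j = db j i) (i j : Fin (n + 1)) :
    ∑ k, (dΓ k k i j - dΓ i k k j + ∑ l, (Γ l i j * Γ k k l - Γ l k j * Γ k i l)) =
      ∑ k, (dP k k i j - ∑ l, P l k j * P k i l) + n * (∑ l, b l * P l i j - db i j + b i * b j) := by
  have hP0' : ∀ i, ∑ k, P k k i = 0 := fun i => by simpa only [hP _ i] using hP0 i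
  have hdP0' : ∀ p i, ∑ k, dP p k k i = 0 := fun p i => by simpa only [hdP p _ i] using hdP0 p i
  have e1 : ∑ k, ∑ l, Γ l i j * Γ k k l =
      ((n : ℝ) + 2) * (∑ l, b l * P l i j + 2 * (b i * b j)) := by
    have hT : ∀ l, ∑ k, Γ k k l = ((n : ℝ) + 2) * b l := by
      intro l
      simp only [hΓ, Finset.sum_add_distrib, hP0', if_true, Finset.sum_const, Finset.card_univ,
        Fintype.card_fin, nsmul_eq_mul, Finset.sum_ite_eq', Finset.mem_univ]
      push_cast; ring
    rw [Finset.sum_comm]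
    simp only [← Finset.mul_sum, hT]
    simp only [hΓ, add_mul, ite_mul, zero_mul, Finset.sum_add_distrib,
      Finset.sum_ite_eq', Finset.mem_univ, if_true]
    have : ∑ l, P l i j * ((n : ℝ) * b l + 2 * b l) = ((n : ℝ) + 2) * ∑ l, b l * P l i j := by
      rw [Finset.mul_sum]
      exact Finset.sum_congr rfl fun l _ => by ring
    rw [this]; ring
  have e2 : ∑ k, ∑ l, Γ l k j * Γ k i l = ∑ k, ∑ l, P l k j * P k i l
      + 2 * ∑ l, b l * P l i j + ((n : ℝ) + 4) * (b i * b j) := by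
    have h1 : ∀ k, ∑ l, Γ l k j * Γ k i l =
        ∑ l, P l k j * Γ k i l + b k * Γ k i j + b j * Γ k i k := by
      intro k
      simp only [hΓ _ k j, add_mul, ite_mul, zero_mul, Finset.sum_add_distrib,
        Finset.sum_ite_eq', Finset.mem_univ, if_true]
    have h2 : ∀ k, ∑ l, P l k j * Γ k i l = ∑ l, P l k j * P k i l + b i * P k k j
        + if k = i then ∑ l, b l * P l i j else 0 := by
      intro k
      simp only [hΓ k i, mul_add, mul_ite, mul_zero, Finset.sum_add_distrib,
        Finset.sum_ite_eq, Finset.mem_univ, if_true, Finset.sum_ite_irrel, Finset.sum_const_zero]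
      rw [mul_comm (P k k j)]
      congr 1
      by_cases hk : k = i
      · simp only [hk, if_true, mul_comm]
      · simp only [hk, if_false]
    have h3 : ∑ k, b k * Γ k i j = ∑ l, b l * P l i j + 2 * (b i * b j) := by
      simp only [hΓ, mul_add, mul_ite, mul_zero, Finset.sum_add_distrib, Finset.sum_ite_eq',
        Finset.mem_univ, if_true]
      ring
    have h4 : ∑ k, Γ k i k = ((n : ℝ) + 2) * b i := by
      simp only [hΓ, Finset.sum_add_distrib, hP0, if_true, Finset.sum_const, Finset.card_univ,
        Fintype.card_fin, nsmul_eq_mul, Finset.sum_ite_eq', Finset.mem_univ]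
      push_cast; ring
    simp only [h1, h2, Finset.sum_add_distrib, ← Finset.mul_sum, h3, h4, hP0',
      Finset.sum_ite_eq', Finset.mem_univ, if_true]
    ring
  have e3 : ∑ k, dΓ k k i j = ∑ k, dP k k i j + db j i + db i j := by
    simp [hdΓ, Finset.sum_add_distrib]
  have e4 : ∑ k, dΓ i k k j = ((n : ℝ) + 2) * db i j := by
    simp only [hdΓ, Finset.sum_add_distrib, hdP0', if_true, Finset.sum_const, Finset.card_univ,
      Fintype.card_fin, nsmul_eq_mul, Finset.sum_ite_eq', Finset.mem_univ]
    push_cast; ring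
  simp only [Finset.sum_add_distrib, Finset.sum_sub_distrib, e1, e2, e3, e4, hdb j i]
  ring

end ProjectiveInvariants

end ProjectiveTractor

/-! ### The weighted inverse metric -/

namespace ProjectiveTractor

open Set Filter Topology

section WeightedBivector

variable {n : ℕ}

/-- The components of the weighted bivector `τ⁻¹ g^{ij}` of a metric with components `G`; the
weight factor is `|det G|^{1/(n+2)}`, as `Real.log` only sees the absolute value. -/
noncomputable def weightedInverse (G : Model n → Matrix (Fin (n + 1)) (Fin (n + 1)) ℝ)
    (x : Model n) : Matrix (Fin (n + 1)) (Fin (n + 1)) ℝ :=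
  Real.exp (Real.log (G x).det / ((n : ℝ) + 2)) • (G x)⁻¹

/-- The contraction `b_l σ^{lk}` of the normalized trace with the weighted bivector. -/
noncomputable def traceContraction (G : Model n → Matrix (Fin (n + 1)) (Fin (n + 1)) ℝ)
    (Γ : Model n → Fin (n + 1) → Fin (n + 1) → Fin (n + 1) → ℝ) (k : Fin (n + 1))
    (x : Model n) : ℝ :=
  ∑ l, normalizedTrace Γ x l * weightedInverse G x l k

variable {O : Set (Model n)} {G : Model n → Matrix (Fin (n + 1)) (Fin (n + 1)) ℝ}
  {Γ : Model n → Fin (n + 1) → Fin (n + 1) → Fin (n + 1) → ℝ} {x : Model n}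

lemma eq_thomas_add (Γ : Model n → Fin (n + 1) → Fin (n + 1) → Fin (n + 1) → ℝ) (x : Model n)
    (k i j : Fin (n + 1)) : Γ x k i j = thomas Γ x k i j +
      (if k = j then normalizedTrace Γ x i else 0) +
      (if k = i then normalizedTrace Γ x j else 0) := by
  rw [thomas]
  ring

lemma IsChristoffel.thomas_symm (h : IsChristoffel O G Γ) (hx : x ∈ O) (k i j : Fin (n + 1)) :
    thomas Γ x k i j = thomas Γ x k j i := by
  simp only [thomas, h.torsion_free x hx k i j]
  ring

lemma IsChristoffel.weightedInverse_symm (h : IsChristoffel O G Γ) (hx : x ∈ O)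
    (j k : Fin (n + 1)) : weightedInverse G x j k = weightedInverse G x k j := by
  have : (G x)⁻¹.IsSymm := by
    rw [Matrix.IsSymm, Matrix.transpose_nonsing_inv, (h.isSymm x hx).eq]
  simp [weightedInverse, this.apply j k]

lemma IsChristoffel.contDiffOn_log_det (h : IsChristoffel O G Γ) :
    ContDiffOn ℝ ∞ (fun x => Real.log (G x).det) O :=
  (contDiffOn_det h.smooth).log h.det_ne_zero

lemma IsChristoffel.contDiffOn_weightedInverse (h : IsChristoffel O G Γ) (j k : Fin (n + 1)) :
    ContDiffOn ℝ ∞ (fun x => weightedInverse G x j k) O :=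
  (h.contDiffOn_log_det.div_const _).exp.mul
    (contDiffOn_inv_apply h.smooth h.det_ne_zero j k)

lemma IsChristoffel.contDiffOn_normalizedTrace (hO : IsOpen O) (h : IsChristoffel O G Γ)
    (i : Fin (n + 1)) : ContDiffOn ℝ ∞ (fun x => normalizedTrace Γ x i) O :=
  (ContDiffOn.sum fun k _ => h.contDiffOn hO k i k).div_const _

lemma IsChristoffel.contDiffOn_thomas (hO : IsOpen O) (h : IsChristoffel O G Γ)
    (k i j : Fin (n + 1)) : ContDiffOn ℝ ∞ (fun x => thomas Γ x k i j) O :=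
  ProjectiveTractor.contDiffOn_thomas (h.contDiffOn hO) k i j

lemma IsChristoffel.contDiffOn_traceContraction (hO : IsOpen O) (h : IsChristoffel O G Γ)
    (k : Fin (n + 1)) : ContDiffOn ℝ ∞ (traceContraction G Γ k) O :=
  ContDiffOn.sum fun l _ =>
    (h.contDiffOn_normalizedTrace hO l).mul (h.contDiffOn_weightedInverse l k)

/-- The normalized trace of a metric connection is the differential of a function of `det G`. -/
lemma IsChristoffel.normalizedTrace_eq (hO : IsOpen O) (h : IsChristoffel O G Γ) (hx : x ∈ O)
    (i : Fin (n + 1)) : normalizedTrace Γ x i =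
      pd i (fun y => (2 * ((n : ℝ) + 2))⁻¹ * Real.log (G y).det) x := by
  rw [pd_const_mul _ _ (differentiableAt_of_contDiffOn hO h.contDiffOn_log_det hx),
    h.pd_log_det hO hx, normalizedTrace]
  field_simp

/-- The normalized trace of a metric connection is a closed one-form. -/
lemma IsChristoffel.pd_normalizedTrace_comm (hO : IsOpen O) (h : IsChristoffel O G Γ) (hx : x ∈ O)
    (i j : Fin (n + 1)) : pd i (fun y => normalizedTrace Γ y j) x =
      pd j (fun y => normalizedTrace Γ y i) x := by
  rw [pd_congr hO (fun y hy => h.normalizedTrace_eq hO hy j) i hx,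
    pd_congr hO (fun y hy => h.normalizedTrace_eq hO hy i) j hx]
  exact pd_comm hO (contDiffOn_const.mul h.contDiffOn_log_det) i j hx

/-- The weighted bivector `τ⁻¹ g^{ij}` is parallel for the Levi-Civita connection. -/
lemma IsChristoffel.pd_weightedInverse (hO : IsOpen O) (h : IsChristoffel O G Γ) (hx : x ∈ O)
    (i j k : Fin (n + 1)) : pd i (fun y => weightedInverse G y j k) x =
      2 * normalizedTrace Γ x i * weightedInverse G x j k
        - ∑ l, Γ x j i l * weightedInverse G x l k - ∑ l, Γ x k i l * weightedInverse G x j l := by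
  have hd := differentiableAt_of_contDiffOn hO h.contDiffOn_log_det hx
  have hd' : DifferentiableAt ℝ (fun y => Real.log (G y).det / ((n : ℝ) + 2)) x :=
    differentiableAt_of_contDiffOn hO (h.contDiffOn_log_det.div_const _) hx
  have h1 : pd i (fun y => Real.exp (Real.log (G y).det / ((n : ℝ) + 2))) x =
      2 * normalizedTrace Γ x i * Real.exp (Real.log (G x).det / ((n : ℝ) + 2)) := by
    have h2 : pd i (fun y => Real.log (G y).det / ((n : ℝ) + 2)) x = 2 * normalizedTrace Γ x i := by
      simp only [div_eq_inv_mul]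
      rw [pd_const_mul i _ hd, h.pd_log_det hO hx, normalizedTrace]
      field_simp
    rw [pd, fderiv_exp hd', smul_apply, ← pd, h2, smul_eq_mul, mul_comm]
  have h2 : pd i (fun y => weightedInverse G y j k) x = pd i (fun y =>
      Real.exp (Real.log (G y).det / ((n : ℝ) + 2)) * (G y)⁻¹ j k) x := rfl
  rw [h2, pd_mul i hd'.exp (differentiableAt_of_contDiffOn hO
    (contDiffOn_inv_apply h.smooth h.det_ne_zero j k) hx), h1, h.pd_inv hO hx]
  simp only [weightedInverse, Matrix.smul_apply, smul_eq_mul, mul_sub, mul_neg, Finset.mul_sum,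
    mul_left_comm (Real.exp _)]
  ring

/-- The metrizability equation: in terms of the Thomas symbols, the derivative of the weighted
bivector is a trace, given by the contraction with the normalized trace of the connection. -/
lemma IsChristoffel.metrizability (hO : IsOpen O) (h : IsChristoffel O G Γ) (hx : x ∈ O)
    (i j k : Fin (n + 1)) : pd i (fun y => weightedInverse G y j k) x =
      -(∑ l, thomas Γ x j i l * weightedInverse G x l k)
        - ∑ l, thomas Γ x k i l * weightedInverse G x j l
        - (if i = j then traceContraction G Γ k x else 0)
        - (if i = k then traceContraction G Γ j x else 0) := by
  rw [h.pd_weightedInverse hO hx]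
  have h1 : ∀ j k, ∑ l, Γ x j i l * weightedInverse G x l k =
      ∑ l, thomas Γ x j i l * weightedInverse G x l k
        + normalizedTrace Γ x i * weightedInverse G x j k
        + if i = j then traceContraction G Γ k x else 0 := by
    intro j k
    simp only [eq_thomas_add Γ x j i, add_mul, Finset.sum_add_distrib, ite_mul, zero_mul,
      Finset.sum_ite_eq, Finset.mem_univ, if_true, Finset.sum_ite_irrel, Finset.sum_const_zero,
      traceContraction, eq_comm (a := j) (b := i)]
  have h2 : ∀ f : Fin (n + 1) → ℝ, ∑ l, f l * weightedInverse G x j l =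
      ∑ l, f l * weightedInverse G x l j := fun f =>
    Finset.sum_congr rfl fun l _ => by rw [h.weightedInverse_symm hx]
  rw [h2, h2, h1, h1, h.weightedInverse_symm hx k j]
  ring

/-- Contraction of the Ricci curvature with the weighted bivector. -/
lemma IsChristoffel.sum_weightedInverse_mul_ricci (hO : IsOpen O) (h : IsChristoffel O G Γ)
    (hx : x ∈ O) : ∑ i, ∑ j, weightedInverse G x i j * ricciCoord Γ x i j =
      ∑ i, ∑ j, weightedInverse G x i j * ∑ k, (pd k (fun y => thomas Γ y k i j) x
        - ∑ l, thomas Γ x l k j * thomas Γ x k i l)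
      - n * (∑ k, pd k (traceContraction G Γ k) x
        + ((n : ℝ) + 1) * ∑ k, normalizedTrace Γ x k * traceContraction G Γ k x) := by
  have hbd : ∀ i, DifferentiableAt ℝ (fun y => normalizedTrace Γ y i) x := fun i =>
    differentiableAt_of_contDiffOn hO (h.contDiffOn_normalizedTrace hO i) hx
  have hσd : ∀ j k, DifferentiableAt ℝ (fun y => weightedInverse G y j k) x := fun j k =>
    differentiableAt_of_contDiffOn hO (h.contDiffOn_weightedInverse j k) hx
  have hPd : ∀ k i j, DifferentiableAt ℝ (fun y => thomas Γ y k i j) x := fun k i j =>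
    differentiableAt_of_contDiffOn hO (h.contDiffOn_thomas hO k i j) hx
  have hric : ∀ i j, ricciCoord Γ x i j = ∑ k, (pd k (fun y => thomas Γ y k i j) x
      - ∑ l, thomas Γ x l k j * thomas Γ x k i l)
      + n * (∑ l, normalizedTrace Γ x l * thomas Γ x l i j - pd i (fun y => normalizedTrace Γ y j) x
        + normalizedTrace Γ x i * normalizedTrace Γ x j) := by
    intro i j
    refine ricci_projective_change_pointwise (Γ := Γ x) (P := thomas Γ x)
      (b := normalizedTrace Γ x) (dΓ := fun p k i j => pd p (fun y => Γ y k i j) x)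
      (dP := fun p k i j => pd p (fun y => thomas Γ y k i j) x)
      (db := fun p i => pd p (fun y => normalizedTrace Γ y i) x) (eq_thomas_add Γ x)
      (fun p k i j => ?_) (h.thomas_symm hx) (sum_thomas x)
      (fun p k i j => pd_congr hO (fun y hy => h.thomas_symm hy k i j) p hx) (fun p i => ?_)
      (h.pd_normalizedTrace_comm hO hx) i j
    · have hite : ∀ (q : Prop) [Decidable q] (i : Fin (n + 1)),
          DifferentiableAt ℝ (fun y => if q then normalizedTrace Γ y i else 0) x ∧
          pd p (fun y => if q then normalizedTrace Γ y i else 0) x =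
            if q then pd p (fun y => normalizedTrace Γ y i) x else 0 := by
        intro q _ i
        split_ifs
        · exact ⟨hbd i, rfl⟩
        · exact ⟨differentiableAt_const _, pd_const _ _⟩
      have : (fun y => Γ y k i j) = fun y => thomas Γ y k i j +
          (if k = j then normalizedTrace Γ y i else 0) +
          (if k = i then normalizedTrace Γ y j else 0) := funext fun y => eq_thomas_add Γ y k i j
      simp only [this]
      rw [pd_add _ ((hPd k i j).fun_add (hite _ i).1) (hite _ j).1, pd_add _ (hPd k i j) (hite _ i).1,
        (hite _ i).2, (hite _ j).2]
    · rw [← pd_sum p fun k => hPd k i k]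
      simp only [sum_thomas, pd_const]
  have hdiv : ∀ l, ∑ k, pd k (fun y => weightedInverse G y l k) x =
      -(∑ i, ∑ j, thomas Γ x l i j * weightedInverse G x i j)
        - ((n : ℝ) + 2) * traceContraction G Γ l x := by
    intro l
    simp only [h.metrizability hO hx, Finset.sum_sub_distrib, Finset.sum_neg_distrib,
      Finset.sum_ite_eq', Finset.mem_univ, if_true, Finset.sum_const, Finset.card_univ,
      Fintype.card_fin, nsmul_eq_mul]
    have h1 : ∑ k, ∑ p, thomas Γ x k k p * weightedInverse G x l p = 0 := by
      have h0 : ∀ p, ∑ k, thomas Γ x k k p = 0 := fun p => by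
        rw [Finset.sum_congr rfl fun k _ => h.thomas_symm hx k k p, sum_thomas]
      rw [Finset.sum_comm]
      simp only [← Finset.sum_mul, h0, zero_mul, Finset.sum_const_zero]
    have h2 : ∑ k, ∑ p, thomas Γ x l k p * weightedInverse G x p k =
        ∑ i, ∑ j, thomas Γ x l i j * weightedInverse G x i j :=
      Finset.sum_congr rfl fun k _ => Finset.sum_congr rfl fun p _ => by
        rw [h.weightedInverse_symm hx]
    rw [h1, h2]
    push_cast
    ring
  have hm : ∑ k, pd k (traceContraction G Γ k) x =
      ∑ i, ∑ j, weightedInverse G x i j * pd i (fun y => normalizedTrace Γ y j) x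
      - ∑ l, normalizedTrace Γ x l * ∑ i, ∑ j, thomas Γ x l i j * weightedInverse G x i j
      - ((n : ℝ) + 2) * ∑ k, normalizedTrace Γ x k * traceContraction G Γ k x := by
    have h1 : ∀ k, pd k (traceContraction G Γ k) x =
        ∑ l, (weightedInverse G x k l * pd k (fun y => normalizedTrace Γ y l) x +
          normalizedTrace Γ x l * pd k (fun y => weightedInverse G y l k) x) := by
      intro k
      have : traceContraction G Γ k = fun y => ∑ l, normalizedTrace Γ y l * weightedInverse G y l k :=
        rfl
      rw [this, pd_sum k fun l => (hbd l).fun_mul (hσd l k)]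
      refine Finset.sum_congr rfl fun l _ => ?_
      rw [pd_mul k (hbd l) (hσd l k), h.weightedInverse_symm hx l k, mul_comm (pd _ _ _)]
    simp only [h1, Finset.sum_add_distrib]
    rw [Finset.sum_comm (f := fun k l => normalizedTrace Γ x l *
      pd k (fun y => weightedInverse G y l k) x)]
    simp only [← Finset.mul_sum, hdiv, mul_sub, mul_neg, Finset.sum_sub_distrib,
      Finset.sum_neg_distrib, mul_left_comm _ ((n : ℝ) + 2)]
    ring
  have hbP : ∑ i, ∑ j, weightedInverse G x i j * ∑ l, normalizedTrace Γ x l * thomas Γ x l i j =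
      ∑ l, normalizedTrace Γ x l * ∑ i, ∑ j, thomas Γ x l i j * weightedInverse G x i j := by
    simp only [Finset.mul_sum]
    rw [Finset.sum_congr rfl fun i _ => Finset.sum_comm, Finset.sum_comm]
    exact Finset.sum_congr rfl fun l _ => Finset.sum_congr rfl fun i _ =>
      Finset.sum_congr rfl fun j _ => by ring
  have hbb : ∑ i, ∑ j, weightedInverse G x i j * (normalizedTrace Γ x i * normalizedTrace Γ x j) =
      ∑ k, normalizedTrace Γ x k * traceContraction G Γ k x := by
    simp only [traceContraction, Finset.mul_sum]
    exact Finset.sum_congr rfl fun i _ => Finset.sum_congr rfl fun j _ => by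
      rw [h.weightedInverse_symm hx]; ring
  simp only [hric, mul_add, mul_sub, Finset.sum_add_distrib, Finset.sum_sub_distrib,
    mul_left_comm _ (n : ℝ)] at *
  simp only [← Finset.mul_sum, hbP, hbb, hm]
  ring

end WeightedBivector

end ProjectiveTractor

/-! ### Extension to the boundary in coordinates -/

namespace ProjectiveTractor

open Set Filter Topology

section CoordinateExtension

variable {n : ℕ} {K : Set (Model n)} {G : Model n → Matrix (Fin (n + 1)) (Fin (n + 1)) ℝ}
  {Γ : Model n → Fin (n + 1) → Fin (n + 1) → Fin (n + 1) → ℝ}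

/-- If the Thomas symbols of a metric connection are smooth up to the boundary, so are all entries
of the tractor form `L(τ⁻¹ g^{ij})` in the jet coordinates of the chart. -/
theorem IsChristoffel.exists_contDiffOn_extension (hn : 1 ≤ n) (hK : IsCompact K)
    (hKc : Convex ℝ K) (hKi : (interior K).Nonempty) (h : IsChristoffel (interior K) G Γ)
    {P : Fin (n + 1) → Fin (n + 1) → Fin (n + 1) → Model n → ℝ}
    (hP : ∀ k i j, ContDiffOn ℝ ∞ (P k i j) K)
    (hΓP : ∀ x ∈ interior K, ∀ k i j, thomas Γ x k i j = P k i j x) :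
    (∀ j k, ∃ f : Model n → ℝ, ContDiffOn ℝ ∞ f K ∧
      ∀ x ∈ interior K, weightedInverse G x j k = f x) ∧
    (∀ k, ∃ f : Model n → ℝ, ContDiffOn ℝ ∞ f K ∧
      ∀ x ∈ interior K, traceContraction G Γ k x = f x) ∧
    (∃ f : Model n → ℝ, ContDiffOn ℝ ∞ f K ∧ ∀ x ∈ interior K,
      1 / ((n : ℝ) + 1) * ∑ i, ∑ j, 1 / (n : ℝ) * ricciCoord Γ x i j * weightedInverse G x i j
        + ∑ k, normalizedTrace Γ x k * traceContraction G Γ k x = f x) := by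
  have hO : IsOpen (interior K) := isOpen_interior
  have hU : UniqueDiffOn ℝ K := uniqueDiffOn_convex hKc hKi
  let σ : Fin (n + 1) × Fin (n + 1) → Model n → ℝ := fun a x => weightedInverse G x a.1 a.2
  let m := traceContraction G Γ
  let q : Model n → ℝ := fun x => ∑ k, pd k (m k) x
  have hσ₀ : ∀ j k, (fun x => weightedInverse G x j k) ∈ smoothSpan K (range σ) := fun j k =>
    subset_smoothSpan ⟨(j, k), rfl⟩
  have key : ∀ f ∈ smoothSpan K (range σ ∪ range m ∪ {q}),
      ∃ g : Model n → ℝ, ContDiffOn ℝ ∞ g K ∧ ∀ x ∈ interior K, f x = g x := by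
    intro f hf
    refine exists_contDiffOn_extension_of_metrizability hn hK hKc hKi
      (fun a => h.contDiffOn_weightedInverse a.1 a.2) (h.contDiffOn_traceContraction hO) ?_ hf
    intro i j k
    refine smoothSpan_congr (sub_mem (neg_mem (sum_mem_smoothSpan fun l =>
      mul_mem_smoothSpan (hP j i l) (hσ₀ l k))) (sum_mem_smoothSpan fun l =>
      mul_mem_smoothSpan (hP k i l) (hσ₀ j l))) fun x hx => ?_
    have := h.metrizability hO hx i j k
    simp only [hΓP x hx] at this
    simp only [this, Pi.sub_apply, Pi.neg_apply]
    ring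
  have hσ : ∀ j k, (fun x => weightedInverse G x j k) ∈ smoothSpan K (range σ ∪ range m ∪ {q}) :=
    fun j k => subset_smoothSpan (Or.inl (Or.inl ⟨(j, k), rfl⟩))
  refine ⟨fun j k => key _ (hσ j k), fun k => key _ (subset_smoothSpan (Or.inl (Or.inr ⟨k, rfl⟩))),
    key _ ?_⟩
  let C : Fin (n + 1) → Fin (n + 1) → Model n → ℝ := fun i j x =>
    1 / (n * ((n : ℝ) + 1)) * ∑ k, (fderivWithin ℝ (P k i j) K x (stdVec k) -
      ∑ l, P l k j x * P k i l x)
  have hC : ∀ i j, ContDiffOn ℝ ∞ (C i j) K := fun i j => contDiffOn_const.mul <|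
    ContDiffOn.sum fun k _ => (((hP k i j).fderivWithin hU (by simp)).clm_apply
      contDiffOn_const).sub (ContDiffOn.sum fun l _ => (hP l k j).mul (hP k i l))
  refine smoothSpan_congr (sub_mem (sum_mem_smoothSpan fun i => sum_mem_smoothSpan fun j =>
    mul_mem_smoothSpan (hC i j) (hσ i j)) (const_mul_mem_smoothSpan (1 / ((n : ℝ) + 1))
      (subset_smoothSpan (Or.inr (mem_singleton q))))) fun x hx => ?_
  have hPx : ∀ k i j, pd k (fun y => thomas Γ y k i j) x =
      fderivWithin ℝ (P k i j) K x (stdVec k) := fun k i j => by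
    rw [pd_congr hO (fun y hy => hΓP y hy k i j) k hx, pd,
      fderivWithin_of_mem_nhds (mem_interior_iff_mem_nhds.1 hx)]
  have hric := h.sum_weightedInverse_mul_ricci hO hx
  simp only [hΓP x hx, hPx] at hric
  have hn' : (n : ℝ) ≠ 0 := by positivity
  have e1 : ∑ i, ∑ j, 1 / (n : ℝ) * ricciCoord Γ x i j * weightedInverse G x i j =
      1 / (n : ℝ) * ∑ i, ∑ j, weightedInverse G x i j * ricciCoord Γ x i j := by
    simp only [Finset.mul_sum]
    exact Finset.sum_congr rfl fun i _ => Finset.sum_congr rfl fun j _ => by ring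
  have e2 : ∑ i, ∑ j, C i j x * weightedInverse G x i j = 1 / (n * ((n : ℝ) + 1)) *
      ∑ i, ∑ j, weightedInverse G x i j * ∑ k, (fderivWithin ℝ (P k i j) K x (stdVec k) -
        ∑ l, P l k j x * P k i l x) := by
    simp only [C, Finset.mul_sum (Finset.univ) (fun i => ∑ j, _), Finset.mul_sum (Finset.univ)
      (fun j => weightedInverse G x _ j * _)]
    exact Finset.sum_congr rfl fun i _ => Finset.sum_congr rfl fun j _ => by ring
  rw [e1, hric, Pi.sub_apply, e2]
  simp only [q, m]
  field_simp
  ring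

end CoordinateExtension

end ProjectiveTractor

/-! ### Charts and coordinate vector fields -/

namespace ProjectiveTractor

open Set Filter Topology

section Charts

variable {n : ℕ} {M : Type*} [TopologicalSpace M] [ChartedSpace (EuclideanHalfSpace (n + 1)) M]
  [IsManifold (𝓡∂ (n + 1)) ∞ M] {φ ψ : Chart n M} {x : M}

lemma chartAt_mem_smoothCharts (x : M) :
    chartAt (EuclideanHalfSpace (n + 1)) x ∈ smoothCharts n M :=
  IsManifold.chart_mem_maximalAtlas x

/-- Local diffeomorphisms preserve interior points and have invertible differentials. -/
lemma isLocalDiffeomorphAt_chart (hφ : φ ∈ smoothCharts n M) (hx : x ∈ φ.source) :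
    IsLocalDiffeomorphAt (𝓡∂ (n + 1)) (𝓡∂ (n + 1)) ∞ φ x :=
  ⟨⟨φ.toPartialEquiv, φ.open_source, φ.open_target, contMDiffOn_of_mem_maximalAtlas hφ,
    contMDiffOn_symm_of_mem_maximalAtlas hφ⟩, hx, fun _ _ => rfl⟩

/-- Whether a point is interior can be checked in any smooth chart. -/
lemma mem_interiorSet_iff (hφ : φ ∈ smoothCharts n M) (hx : x ∈ φ.source) :
    x ∈ interiorSet n M ↔ φ.extend (𝓡∂ (n + 1)) x ∈ interior (range (𝓡∂ (n + 1))) :=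
  (isLocalDiffeomorphAt_chart hφ hx).isInteriorPoint_iff (by simp)

lemma isOpen_interiorSet : IsOpen (interiorSet n M) :=
  ModelWithCorners.isOpen_interior (I := 𝓡∂ (n + 1)) (n := ∞) (by simp)

lemma contMDiffAt_extend (hφ : φ ∈ smoothCharts n M) (hx : x ∈ φ.source) :
    ContMDiffAt (𝓡∂ (n + 1)) 𝓘(ℝ, Model n) ∞ (φ.extend (𝓡∂ (n + 1))) x :=
  OpenPartialHomeomorph.contMDiffAt_extend hφ hx

lemma isInvertible_mfderiv_extend (hφ : φ ∈ smoothCharts n M) (hx : x ∈ φ.source) :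
    (mfderiv (𝓡∂ (n + 1)) 𝓘(ℝ, Model n) (φ.extend (𝓡∂ (n + 1))) x).IsInvertible := by
  have h1 : mfderiv (𝓡∂ (n + 1)) 𝓘(ℝ, Model n) (φ.extend (𝓡∂ (n + 1))) x =
      mfderiv (𝓡∂ (n + 1)) (𝓡∂ (n + 1)) φ x := by
    have := ((𝓡∂ (n + 1)).hasMFDerivAt (x := φ x)).comp x
      ((isLocalDiffeomorphAt_chart hφ hx).mdifferentiableAt (by simp)).hasMFDerivAt
    exact this.mfderiv
  rw [h1]
  exact ⟨(isLocalDiffeomorphAt_chart hφ hx).mfderivToContinuousLinearEquiv (by simp), rfl⟩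

/-- The differential of a chart at a point. -/
noncomputable def chartDeriv (φ : Chart n M) (x : M) : TangentSpace (𝓡∂ (n + 1)) x →L[ℝ] Model n :=
  mfderiv (𝓡∂ (n + 1)) 𝓘(ℝ, Model n) (φ.extend (𝓡∂ (n + 1))) x

lemma coordForm_eq (φ : Chart n M) (k : Fin (n + 1)) (x : M) (v : TangentSpace (𝓡∂ (n + 1)) x) :
    coordForm φ k x v = chartDeriv φ x v k := rfl

lemma chartDeriv_coordField (hφ : φ ∈ smoothCharts n M) (hx : x ∈ φ.source) (i : Fin (n + 1)) :
    chartDeriv φ x (coordField φ i x) = stdVec i := by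
  obtain ⟨e, he⟩ := isInvertible_mfderiv_extend hφ hx
  have h1 : coordField φ i x = e.symm (stdVec i) := by
    change (mfderiv (𝓡∂ (n + 1)) 𝓘(ℝ, Model n) (φ.extend (𝓡∂ (n + 1))) x).inverse (stdVec i) = _
    rw [← he, ContinuousLinearMap.inverse_equiv]
    rfl
  rw [h1]
  exact (DFunLike.congr_fun he.symm _).trans (e.apply_symm_apply _)

lemma chartDeriv_injective (hφ : φ ∈ smoothCharts n M) (hx : x ∈ φ.source) :
    Function.Injective (chartDeriv φ x) := by
  obtain ⟨e, he⟩ := isInvertible_mfderiv_extend hφ hx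
  intro v w hvw
  refine e.injective ?_
  exact (DFunLike.congr_fun he v).trans (Eq.trans hvw (DFunLike.congr_fun he w).symm)

lemma coordForm_coordField (hφ : φ ∈ smoothCharts n M) (hx : x ∈ φ.source) (k i : Fin (n + 1)) :
    coordForm φ k x (coordField φ i x) = if k = i then 1 else 0 := by
  rw [coordForm_eq, chartDeriv_coordField hφ hx, stdVec]
  simp

lemma coordForm_add (k : Fin (n + 1)) (v w : TangentSpace (𝓡∂ (n + 1)) x) :
    coordForm φ k x (v + w) = coordForm φ k x v + coordForm φ k x w := by
  simp [coordForm_eq]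

lemma coordForm_sub (k : Fin (n + 1)) (v w : TangentSpace (𝓡∂ (n + 1)) x) :
    coordForm φ k x (v - w) = coordForm φ k x v - coordForm φ k x w := by
  simp [coordForm_eq]

lemma coordForm_smul (k : Fin (n + 1)) (c : ℝ) (v : TangentSpace (𝓡∂ (n + 1)) x) :
    coordForm φ k x (c • v) = c * coordForm φ k x v := by
  simp [coordForm_eq]

lemma coordForm_zero (k : Fin (n + 1)) :
    coordForm φ k x (0 : TangentSpace (𝓡∂ (n + 1)) x) = 0 := by
  simp [coordForm_eq]

lemma coordForm_sum {ι : Type*} (s : Finset ι) (k : Fin (n + 1))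
    (v : ι → TangentSpace (𝓡∂ (n + 1)) x) :
    coordForm φ k x (∑ a ∈ s, v a) = ∑ a ∈ s, coordForm φ k x (v a) := by
  simp [coordForm_eq]

lemma eq_sum_stdVec (v : Model n) : v = ∑ i, v i • stdVec i := by
  ext j
  simp [stdVec, Pi.single_apply]

/-- Expansion of a tangent vector in the coordinate basis. -/
lemma sum_coordForm_smul_coordField (hφ : φ ∈ smoothCharts n M) (hx : x ∈ φ.source)
    (v : TangentSpace (𝓡∂ (n + 1)) x) : ∑ k, coordForm φ k x v • coordField φ k x = v := by
  refine chartDeriv_injective hφ hx ?_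
  simp only [map_sum, map_smul, chartDeriv_coordField hφ hx, coordForm_eq]
  exact (eq_sum_stdVec _).symm

lemma contMDiffAt_const_vectorField {E : Type*} [NormedAddCommGroup E] [NormedSpace ℝ E]
    (c x : E) : ContMDiffAt 𝓘(ℝ, E) 𝓘(ℝ, E).tangent ∞
      (fun y => (⟨y, c⟩ : TangentBundle 𝓘(ℝ, E) E)) x :=
  contMDiffAt_vectorSpace_iff_contDiffAt.2 contDiffAt_const

lemma contMDiffAt_coordField (hφ : φ ∈ smoothCharts n M) (hx : x ∈ φ.source) (i : Fin (n + 1)) :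
    ContMDiffAt (𝓡∂ (n + 1)) ((𝓡∂ (n + 1)).prod 𝓘(ℝ, Model n)) ∞
      (fun y => Bundle.TotalSpace.mk' (Model n) y (coordField φ i y)) x :=
  ContMDiffAt.mpullback_vectorField_preimage (n := ∞) (contMDiffAt_const_vectorField _ _)
    (contMDiffAt_extend hφ hx) (isInvertible_mfderiv_extend hφ hx) (by simp)

lemma mdifferentiableAt_coordField (hφ : φ ∈ smoothCharts n M) (hx : x ∈ φ.source)
    (i : Fin (n + 1)) :
    MDifferentiableAt (𝓡∂ (n + 1)) ((𝓡∂ (n + 1)).prod 𝓘(ℝ, Model n))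
      (fun y => Bundle.TotalSpace.mk' (Model n) y (coordField φ i y)) x :=
  (contMDiffAt_coordField hφ hx i).mdifferentiableAt (by simp)

/-- Coordinate vector fields commute, being pullbacks of constant vector fields. -/
lemma mlieBracket_coordField (hφ : φ ∈ smoothCharts n M) (hx : x ∈ φ.source) (i j : Fin (n + 1)) :
    VectorField.mlieBracket (𝓡∂ (n + 1)) (coordField φ i) (coordField φ j) x = 0 := by
  have : IsManifold (𝓡∂ (n + 1)) (minSmoothness ℝ 2) M :=
    IsManifold.of_le (n := ∞) (by simpa using (ENat.LEInfty.out : (2 : ℕ∞ω) ≤ ∞))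
  have := VectorField.mpullback_mlieBracket (I := 𝓡∂ (n + 1)) (I' := 𝓘(ℝ, Model n)) (n := ∞)
    (f := φ.extend (𝓡∂ (n + 1))) (V := fun _ => stdVec i) (W := fun _ => stdVec j) (x₀ := x)
    ((contMDiffAt_const_vectorField _ _).mdifferentiableAt (by simp))
    ((contMDiffAt_const_vectorField _ _).mdifferentiableAt (by simp))
    (contMDiffAt_extend hφ hx) (by simpa using (ENat.LEInfty.out : (2 : ℕ∞ω) ≤ ∞))
  refine this.symm.trans ?_
  have h0 : VectorField.mlieBracket 𝓘(ℝ, Model n) (fun _ : Model n => (stdVec i : Model n))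
      (fun _ => stdVec j) (φ.extend (𝓡∂ (n + 1)) x) = (0 : Model n) := by
    refine (congrFun VectorField.mlieBracketWithin_eq_lieBracketWithin _).trans ?_
    simp [VectorField.lieBracketWithin]
    rfl
  exact (congrArg (mfderiv (𝓡∂ (n + 1)) 𝓘(ℝ, Model n) (φ.extend (𝓡∂ (n + 1))) x).inverse h0).trans
    (map_zero _)

/-- The differential of a map, evaluated on a coordinate vector field, in terms of the coordinate
expression of the map. -/
lemma mfderiv_apply_coordField {F : Type*} [NormedAddCommGroup F] [NormedSpace ℝ F]
    (hφ : φ ∈ smoothCharts n M) (hx : x ∈ φ.source)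
    {f : M → F} (hf : MDifferentiableAt (𝓡∂ (n + 1)) 𝓘(ℝ, F) f x) (i : Fin (n + 1)) :
    (mfderiv (𝓡∂ (n + 1)) 𝓘(ℝ, F) f x (coordField φ i x) : F) =
      fderivWithin ℝ (f ∘ (φ.extend (𝓡∂ (n + 1))).symm) (range (𝓡∂ (n + 1)))
        (φ.extend (𝓡∂ (n + 1)) x) (stdVec i) := by
  set e := φ.extend (𝓡∂ (n + 1)) with he
  have hex : e.symm (e x) = x := φ.extend_left_inv hx
  have h1 : MDifferentiableWithinAt 𝓘(ℝ, Model n) (𝓡∂ (n + 1)) e.symm (range (𝓡∂ (n + 1)))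
      (e x) := by
    have h2 := (contMDiffOn_extend_symm hφ).mdifferentiableOn (by simp) (e x)
      ⟨φ x, φ.map_source hx, rfl⟩
    refine h2.mono_of_mem_nhdsWithin ?_
    rw [← φ.extend_target']
    exact φ.extend_target_mem_nhdsWithin hx
  have h2 : MDifferentiableWithinAt 𝓘(ℝ, Model n) 𝓘(ℝ, F) (f ∘ e.symm) (range (𝓡∂ (n + 1)))
      (e x) := by
    refine MDifferentiableAt.comp_mdifferentiableWithinAt (I' := 𝓡∂ (n + 1)) (e x) ?_ h1
    rwa [hex]
  have h3 : HasMFDerivWithinAt (𝓡∂ (n + 1)) 𝓘(ℝ, F) ((f ∘ e.symm) ∘ e) univ x _ :=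
    h2.hasMFDerivWithinAt.comp x
      ((contMDiffAt_extend hφ hx).mdifferentiableAt (by simp)).hasMFDerivAt.hasMFDerivWithinAt
      (fun y _ => mem_range_self _)
  have h4 : f =ᶠ[𝓝 x] (f ∘ e.symm) ∘ e := by
    filter_upwards [φ.open_source.mem_nhds hx] with y hy
    exact (congrArg f (φ.extend_left_inv hy)).symm
  have h5 := ((hasMFDerivWithinAt_univ.1 h3).congr_of_eventuallyEq h4).mfderiv
  refine (DFunLike.congr_fun h5 (coordField φ i x)).trans ?_
  change mfderivWithin 𝓘(ℝ, Model n) 𝓘(ℝ, F) (f ∘ e.symm) (range (𝓡∂ (n + 1))) (e x)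
    (chartDeriv φ x (coordField φ i x)) = _
  rw [chartDeriv_coordField hφ hx, mfderivWithin_eq_fderivWithin]
  rfl

lemma mfderiv_coordField (hφ : φ ∈ smoothCharts n M) (hx : x ∈ φ.source)
    {f : M → ℝ} (hf : MDifferentiableAt (𝓡∂ (n + 1)) 𝓘(ℝ, ℝ) f x) (i : Fin (n + 1)) :
    (mfderiv (𝓡∂ (n + 1)) 𝓘(ℝ, ℝ) f x (coordField φ i x) : ℝ) = partialDeriv φ i f x :=
  mfderiv_apply_coordField hφ hx hf i

lemma partialDeriv_eq_pd (hφ : φ ∈ smoothCharts n M) (hx : x ∈ φ.source)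
    (hxi : x ∈ interiorSet n M) (f : M → ℝ) (i : Fin (n + 1)) : partialDeriv φ i f x =
      pd i (f ∘ (φ.extend (𝓡∂ (n + 1))).symm) (φ.extend (𝓡∂ (n + 1)) x) := by
  rw [partialDeriv, fderivWithin_of_mem_nhds
    (mem_interior_iff_mem_nhds.1 ((mem_interiorSet_iff hφ hx).1 hxi)), pd]

/-- The Jacobian matrix of a change of coordinates expresses one coordinate frame in the other. -/
lemma jacobian_eq (hφ : φ ∈ smoothCharts n M) (hψ : ψ ∈ smoothCharts n M) (hx : x ∈ φ.source)
    (hx' : x ∈ ψ.source) (k i : Fin (n + 1)) :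
    jacobian φ ψ (ψ.extend (𝓡∂ (n + 1)) x) k i = coordForm φ k x (coordField ψ i x) := by
  have := mfderiv_apply_coordField hψ hx'
    ((contMDiffAt_extend hφ hx).mdifferentiableAt (by simp)) i
  exact congrArg (fun v : Model n => v k) this.symm

lemma coordForm_eq_sum_jacobian (hφ : φ ∈ smoothCharts n M) (hψ : ψ ∈ smoothCharts n M)
    (hx : x ∈ φ.source) (hx' : x ∈ ψ.source) (k : Fin (n + 1)) (v : TangentSpace (𝓡∂ (n + 1)) x) :
    coordForm φ k x v = ∑ i, jacobian φ ψ (ψ.extend (𝓡∂ (n + 1)) x) k i * coordForm ψ i x v := by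
  conv_lhs => rw [← sum_coordForm_smul_coordField hψ hx' v]
  rw [coordForm_sum]
  exact Finset.sum_congr rfl fun i _ => by
    rw [coordForm_smul, jacobian_eq hφ hψ hx hx', mul_comm]

lemma jacobian_mul_jacobian (hφ : φ ∈ smoothCharts n M) (hψ : ψ ∈ smoothCharts n M)
    (hx : x ∈ φ.source) (hx' : x ∈ ψ.source) :
    jacobian φ ψ (ψ.extend (𝓡∂ (n + 1)) x) * jacobian ψ φ (φ.extend (𝓡∂ (n + 1)) x) = 1 := by
  ext k j
  rw [Matrix.mul_apply]
  simp only [jacobian_eq hψ hφ hx' hx]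
  rw [← coordForm_eq_sum_jacobian hφ hψ hx hx' k, coordForm_coordField hφ hx, Matrix.one_apply]

lemma det_jacobian_ne_zero (hφ : φ ∈ smoothCharts n M) (hψ : ψ ∈ smoothCharts n M)
    (hx : x ∈ φ.source) (hx' : x ∈ ψ.source) :
    (jacobian φ ψ (ψ.extend (𝓡∂ (n + 1)) x)).det ≠ 0 := fun h => by
  have := congrArg Matrix.det (jacobian_mul_jacobian hφ hψ hx hx')
  rw [Matrix.det_mul, h, zero_mul, Matrix.det_one] at this
  exact zero_ne_one this

/-- The component functions of a smooth vector field are smooth. -/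
lemma contMDiffWithinAt_coordForm (hφ : φ ∈ smoothCharts n M) (hx : x ∈ φ.source)
    {X : (x : M) → TangentSpace (𝓡∂ (n + 1)) x} {U : Set M}
    (hX : ContMDiffWithinAt (𝓡∂ (n + 1)) ((𝓡∂ (n + 1)).prod 𝓘(ℝ, Model n)) ∞
      (fun y => Bundle.TotalSpace.mk' (Model n) y (X y)) U x) (k : Fin (n + 1)) :
    ContMDiffWithinAt (𝓡∂ (n + 1)) 𝓘(ℝ, ℝ) ∞ (fun y => coordForm φ k y (X y)) U x := by
  have h1 := ContMDiffWithinAt.clm_apply_of_inCoordinates (n := ∞) (IM := 𝓡∂ (n + 1))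
    (IB₁ := 𝓡∂ (n + 1)) (IB₂ := 𝓘(ℝ, Model n)) (b₁ := fun y : M => y)
    (b₂ := φ.extend (𝓡∂ (n + 1)))
    (ϕ := fun y => mfderiv (𝓡∂ (n + 1)) 𝓘(ℝ, Model n) (φ.extend (𝓡∂ (n + 1))) y) (v := X) (s := U)
    (m₀ := x)
    ((contMDiffAt_extend hφ hx).mfderiv_const (m := ∞) (by simp)).contMDiffWithinAt hX
    (contMDiffAt_extend hφ hx).contMDiffWithinAt
  have h2 : ContMDiffWithinAt (𝓡∂ (n + 1)) 𝓘(ℝ, Model n) ∞ (fun y => chartDeriv φ y (X y)) U x :=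
    (contMDiff_snd_tangentBundle_modelSpace (Model n)
      𝓘(ℝ, Model n)).contMDiffAt.comp_contMDiffWithinAt _ h1
  have h3 : ContMDiff 𝓘(ℝ, Model n) 𝓘(ℝ, ℝ) ∞ (fun v : Model n => v k) :=
    ContDiff.contMDiff (by fun_prop)
  exact h3.contMDiffAt.comp_contMDiffWithinAt _ h2

/-- The value of a smooth bilinear form on two smooth vector fields is smooth. -/
lemma contMDiffWithinAt_bilinear_apply
    {g : (x : M) → TangentSpace (𝓡∂ (n + 1)) x →L[ℝ] TangentSpace (𝓡∂ (n + 1)) x →L[ℝ] ℝ}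
    {U : Set M}
    (hg : ContMDiffWithinAt (𝓡∂ (n + 1))
      ((𝓡∂ (n + 1)).prod 𝓘(ℝ, Model n →L[ℝ] Model n →L[ℝ] ℝ)) ∞
      (fun x => Bundle.TotalSpace.mk' (Model n →L[ℝ] Model n →L[ℝ] ℝ)
        (E := fun x : M => TangentSpace (𝓡∂ (n + 1)) x →L[ℝ]
          TangentSpace (𝓡∂ (n + 1)) x →L[ℝ] Bundle.Trivial M ℝ x) x (g x)) U x)
    {X Y : (x : M) → TangentSpace (𝓡∂ (n + 1)) x}
    (hX : ContMDiffWithinAt (𝓡∂ (n + 1)) ((𝓡∂ (n + 1)).prod 𝓘(ℝ, Model n)) ∞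
      (fun y => Bundle.TotalSpace.mk' (Model n) y (X y)) U x)
    (hY : ContMDiffWithinAt (𝓡∂ (n + 1)) ((𝓡∂ (n + 1)).prod 𝓘(ℝ, Model n)) ∞
      (fun y => Bundle.TotalSpace.mk' (Model n) y (Y y)) U x) :
    ContMDiffWithinAt (𝓡∂ (n + 1)) 𝓘(ℝ, ℝ) ∞ (fun y => g y (X y) (Y y)) U x := by
  have : ContMDiffWithinAt (𝓡∂ (n + 1)) ((𝓡∂ (n + 1)).prod 𝓘(ℝ)) ∞
      (fun m ↦ Bundle.TotalSpace.mk' ℝ (E := Bundle.Trivial M ℝ) m (g m (X m) (Y m))) U x :=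
    ContMDiffWithinAt.clm_bundle_apply₂ (F₁ := Model n) (F₂ := Model n) hg hX hY
  exact (Bundle.contMDiffWithinAt_totalSpace.1 this).2

/-- Smoothness on an open part of a chart domain is smoothness of the coordinate expression. -/
lemma contMDiffOn_iff_contDiffOn_extend (hφ : φ ∈ smoothCharts n M) {U : Set M} (hU : U ⊆ φ.source)
    (f : M → ℝ) :
    ContMDiffOn (𝓡∂ (n + 1)) 𝓘(ℝ, ℝ) ∞ f U ↔
      ContDiffOn ℝ ∞ (f ∘ (φ.extend (𝓡∂ (n + 1))).symm) (φ.extend (𝓡∂ (n + 1)) '' U) := by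
  rw [← contMDiffOn_iff_contDiffOn]
  constructor
  · intro h
    refine h.comp ((contMDiffOn_extend_symm hφ).mono ?_) ?_
    · rintro _ ⟨x, hx, rfl⟩
      exact ⟨φ x, φ.map_source (hU hx), rfl⟩
    · rintro _ ⟨x, hx, rfl⟩
      rw [mem_preimage, φ.extend_left_inv (hU hx)]
      exact hx
  · intro h
    refine (h.comp (fun x hx => (contMDiffAt_extend hφ (hU hx)).contMDiffWithinAt) (fun x hx => mem_image_of_mem _ hx)).congr ?_
    intro x hx
    exact (congrArg f (φ.extend_left_inv (hU hx))).symm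

end Charts

end ProjectiveTractor

/-! ### Connections and metrics in a chart -/

namespace ProjectiveTractor

open Set Filter Topology

section Connection

variable {n : ℕ} {M : Type*} [TopologicalSpace M] [ChartedSpace (EuclideanHalfSpace (n + 1)) M]
  [IsManifold (𝓡∂ (n + 1)) ∞ M] {φ ψ : Chart n M} {x : M}

/-- A vector field is differentiable when its component functions are. -/
lemma mdifferentiableAt_of_coordForm (hφ : φ ∈ smoothCharts n M) (hx : x ∈ φ.source)
    {V : (x : M) → TangentSpace (𝓡∂ (n + 1)) x}
    (hV : ∀ k, MDifferentiableAt (𝓡∂ (n + 1)) 𝓘(ℝ, ℝ) (fun y => coordForm φ k y (V y)) x) :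
    MDifferentiableAt (𝓡∂ (n + 1)) ((𝓡∂ (n + 1)).prod 𝓘(ℝ, Model n))
      (fun y => Bundle.TotalSpace.mk' (Model n) y (V y)) x := by
  have h := MDifferentiableAt.sum_section (s := Finset.univ) fun k _ =>
    (hV k).smul_section (mdifferentiableAt_coordField hφ hx k)
  refine h.congr_of_eventuallyEq ?_
  filter_upwards [φ.open_source.mem_nhds hx] with y hy
  exact congrArg (Bundle.TotalSpace.mk' (Model n) y)
    (sum_coordForm_smul_coordField hφ hy (V y)).symm

variable {cov : ((x : M) → TangentSpace (𝓡∂ (n + 1)) x) →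
  ((x : M) → TangentSpace (𝓡∂ (n + 1)) x →L[ℝ] TangentSpace (𝓡∂ (n + 1)) x)}

lemma cov_finset_sum (hcov : IsCovariantDerivativeOn (Model n) cov (interiorSet n M))
    (hxi : x ∈ interiorSet n M) {ι : Type*} (s : Finset ι) (f : ι → M → ℝ)
    (X : ι → (x : M) → TangentSpace (𝓡∂ (n + 1)) x)
    (hf : ∀ a, MDifferentiableAt (𝓡∂ (n + 1)) 𝓘(ℝ, ℝ) (f a) x)
    (hX : ∀ a, MDifferentiableAt (𝓡∂ (n + 1)) ((𝓡∂ (n + 1)).prod 𝓘(ℝ, Model n))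
      (fun y => Bundle.TotalSpace.mk' (Model n) y (X a y)) x) :
    cov (fun y => ∑ a ∈ s, f a y • X a y) x =
      ∑ a ∈ s, (f a x • cov (X a) x + (mvfderiv (𝓡∂ (n + 1)) (f a) x).smulRight (X a x)) := by
  classical
  induction s using Finset.induction_on with
  | empty =>
    simp only [Finset.sum_empty]
    exact hcov.zero hxi
  | insert a s ha ih =>
    have h1 : (fun y => ∑ a ∈ insert a s, f a y • X a y) =
        f a • X a + fun y => ∑ a ∈ s, f a y • X a y := funext fun y => Finset.sum_insert ha
    rw [Finset.sum_insert ha, ← ih, ← hcov.leibniz (hX a) (hf a) hxi, h1]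
    exact hcov.add ((hf a).smul_section (hX a))
      (MDifferentiableAt.sum_section fun b _ => (hf b).smul_section (hX b)) hxi

/-- The coordinate formula for a covariant derivative. -/
lemma coordForm_cov (hcov : IsCovariantDerivativeOn (Model n) cov (interiorSet n M))
    (hφ : φ ∈ smoothCharts n M) (hx : x ∈ φ.source) (hxi : x ∈ interiorSet n M)
    {V : (x : M) → TangentSpace (𝓡∂ (n + 1)) x}
    (hV : ∀ k, MDifferentiableAt (𝓡∂ (n + 1)) 𝓘(ℝ, ℝ) (fun y => coordForm φ k y (V y)) x)
    (w : TangentSpace (𝓡∂ (n + 1)) x) (k : Fin (n + 1)) :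
    coordForm φ k x (cov V x w) = ∑ i, coordForm φ i x w *
      (partialDeriv φ i (fun y => coordForm φ k y (V y)) x +
        ∑ j, christoffel cov φ x k i j * coordForm φ j x (V x)) := by
  have h1 : cov V x = cov (fun y => ∑ j, coordForm φ j y (V y) • coordField φ j y) x := by
    refine hcov.congr_of_eventuallyEq (mdifferentiableAt_of_coordForm hφ hx hV)
      (MDifferentiableAt.sum_section fun k _ =>
        (hV k).smul_section (mdifferentiableAt_coordField hφ hx k))
      (isOpen_interiorSet.mem_nhds hxi) ?_
    filter_upwards [φ.open_source.mem_nhds hx] with y hy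
    exact (sum_coordForm_smul_coordField hφ hy (V y)).symm
  have h2 : ∀ v, coordForm φ k x (cov V x v) = ∑ j, (coordForm φ j x (V x) *
      coordForm φ k x (cov (coordField φ j) x v) +
      (mvfderiv (𝓡∂ (n + 1)) (fun y => coordForm φ j y (V y)) x v) * if k = j then 1 else 0) := by
    intro v
    rw [h1, cov_finset_sum hcov hxi _ _ _ hV fun k => mdifferentiableAt_coordField hφ hx k,
      sum_apply, coordForm_sum]
    refine Finset.sum_congr rfl fun j _ => ?_
    refine (coordForm_add _ _ _).trans ?_
    refine congrArg₂ _ (coordForm_smul _ _ _) ?_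
    refine (coordForm_smul _ _ _).trans ?_
    rw [coordForm_coordField hφ hx]
    rfl
  have h3 : ∀ i, coordForm φ k x (cov V x (coordField φ i x)) =
      partialDeriv φ i (fun y => coordForm φ k y (V y)) x +
        ∑ j, christoffel cov φ x k i j * coordForm φ j x (V x) := by
    intro i
    have h4 : (mvfderiv (𝓡∂ (n + 1)) (fun y => coordForm φ k y (V y)) x (coordField φ i x)) = _ :=
      mfderiv_coordField hφ hx (hV k) i
    rw [h2, Finset.sum_add_distrib, add_comm]
    simp only [mul_ite, mul_one, mul_zero, Finset.sum_ite_eq, Finset.mem_univ, if_true]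
    rw [h4]
    exact congrArg₂ _ rfl (Finset.sum_congr rfl fun j _ => mul_comm _ _)
  conv_lhs => rw [← sum_coordForm_smul_coordField hφ hx w]
  rw [map_sum, coordForm_sum]
  refine Finset.sum_congr rfl fun i _ => ?_
  rw [map_smul, coordForm_smul, h3]

/-- The image of an open set of interior points under a chart is open. -/
lemma isOpen_extend_image (hφ : φ ∈ smoothCharts n M) {U : Set M} (hU : IsOpen U)
    (hUφ : U ⊆ φ.source) (hUi : U ⊆ interiorSet n M) :
    IsOpen (φ.extend (𝓡∂ (n + 1)) '' U) := by
  have h1 : IsOpen (φ '' U) := φ.isOpen_image_of_subset_source hU hUφ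
  obtain ⟨W, hW, hWU⟩ := (𝓡∂ (n + 1)).isClosedEmbedding.isInducing.isOpen_iff.1 h1
  have : φ.extend (𝓡∂ (n + 1)) '' U = W ∩ interior (range (𝓡∂ (n + 1))) := by
    ext p
    constructor
    · rintro ⟨y, hy, rfl⟩
      refine ⟨?_, (mem_interiorSet_iff hφ (hUφ hy)).1 (hUi hy)⟩
      have : φ y ∈ (𝓡∂ (n + 1)) ⁻¹' W := hWU ▸ mem_image_of_mem _ hy
      exact this
    · rintro ⟨hp, hp'⟩
      obtain ⟨q, rfl⟩ := interior_subset hp'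
      have : q ∈ φ '' U := hWU ▸ hp
      obtain ⟨y, hy, rfl⟩ := this
      exact ⟨y, hy, rfl⟩
  rw [this]
  exact hW.inter isOpen_interior

lemma contMDiffOn_coordForm_coordField (hφ : φ ∈ smoothCharts n M) (hψ : ψ ∈ smoothCharts n M)
    (k i : Fin (n + 1)) : ContMDiffOn (𝓡∂ (n + 1)) 𝓘(ℝ, ℝ) ∞
      (fun y => coordForm φ k y (coordField ψ i y)) (φ.source ∩ ψ.source) :=
  fun _ hx => contMDiffWithinAt_coordForm hφ hx.1
    (contMDiffAt_coordField hψ hx.2 i).contMDiffWithinAt k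

variable {g : (x : M) → TangentSpace (𝓡∂ (n + 1)) x →L[ℝ] TangentSpace (𝓡∂ (n + 1)) x →L[ℝ] ℝ}

lemma contMDiffOn_metricMatrix (hg : IsPseudoRiemannianMetric g) (hφ : φ ∈ smoothCharts n M)
    (i j : Fin (n + 1)) : ContMDiffOn (𝓡∂ (n + 1)) 𝓘(ℝ, ℝ) ∞
      (fun y => metricMatrix g φ y i j) (φ.source ∩ interiorSet n M) :=
  fun x hx => contMDiffWithinAt_bilinear_apply ((hg.smooth x hx.2).mono inter_subset_right)
    (contMDiffAt_coordField hφ hx.1 i).contMDiffWithinAt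
    (contMDiffAt_coordField hφ hx.1 j).contMDiffWithinAt

lemma metric_apply_left (hφ : φ ∈ smoothCharts n M) (hx : x ∈ φ.source)
    (v : TangentSpace (𝓡∂ (n + 1)) x) (j : Fin (n + 1)) :
    g x v (coordField φ j x) = ∑ l, coordForm φ l x v * metricMatrix g φ x l j := by
  conv_lhs => rw [← sum_coordForm_smul_coordField hφ hx v]
  simp [metricMatrix]

lemma metric_apply_right (hφ : φ ∈ smoothCharts n M) (hx : x ∈ φ.source)
    (v : TangentSpace (𝓡∂ (n + 1)) x) (j : Fin (n + 1)) :
    g x (coordField φ j x) v = ∑ l, coordForm φ l x v * metricMatrix g φ x j l := by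
  conv_lhs => rw [← sum_coordForm_smul_coordField hφ hx v]
  simp [metricMatrix]

/-- A vector in the kernel of the matrix of the metric gives a tangent vector orthogonal to all
others. -/
lemma det_metricMatrix_ne_zero (hg : IsPseudoRiemannianMetric g) (hφ : φ ∈ smoothCharts n M)
    (hx : x ∈ φ.source) (hxi : x ∈ interiorSet n M) : (metricMatrix g φ x).det ≠ 0 := by
  intro h0
  obtain ⟨v, hv, hv'⟩ := Matrix.exists_vecMul_eq_zero_iff.2 h0
  have h1 : (∑ i, v i • coordField φ i x) = 0 := by
    refine hg.nondegenerate x hxi _ fun w => ?_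
    rw [← sum_coordForm_smul_coordField hφ hx w, map_sum]
    refine Finset.sum_eq_zero fun j _ => ?_
    have := congrFun hv' j
    simp only [Matrix.vecMul, dotProduct, Pi.zero_apply] at this
    rw [map_smul, map_sum, sum_apply]
    simp only [map_smul, smul_apply, smul_eq_mul]
    exact (congrArg _ this).trans (mul_zero _)
  refine hv (funext fun k => ?_)
  have h2 := congrArg (coordForm φ k x) h1
  rw [coordForm_sum, coordForm_zero] at h2
  simpa [coordForm_smul, coordForm_coordField hφ hx] using h2

/-- In a chart, the coefficients of the Levi-Civita connection are the Christoffel symbols of the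
matrix of the metric. -/
theorem IsLeviCivita.isChristoffel (hg : IsPseudoRiemannianMetric g) (hcov : IsLeviCivita g cov)
    (hφ : φ ∈ smoothCharts n M) :
    IsChristoffel (φ.extend (𝓡∂ (n + 1)) '' (φ.source ∩ interiorSet n M))
      (fun p => metricMatrix g φ ((φ.extend (𝓡∂ (n + 1))).symm p))
      (fun p => christoffel cov φ ((φ.extend (𝓡∂ (n + 1))).symm p)) where
  smooth i j := (contMDiffOn_iff_contDiffOn_extend hφ inter_subset_left _).1
    (contMDiffOn_metricMatrix hg hφ i j)
  isSymm := by
    rintro _ ⟨x, ⟨hx, hxi⟩, rfl⟩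
    simp only [φ.extend_left_inv hx]
    exact Matrix.IsSymm.ext fun i j => hg.symm x hxi _ _
  det_ne_zero := by
    rintro _ ⟨x, ⟨hx, hxi⟩, rfl⟩
    simp only [φ.extend_left_inv hx]
    exact det_metricMatrix_ne_zero hg hφ hx hxi
  torsion_free := by
    rintro _ ⟨x, ⟨hx, hxi⟩, rfl⟩ k i j
    simp only [φ.extend_left_inv hx]
    have h := hcov.torsion_free x hxi (coordField φ i) (coordField φ j)
      (mdifferentiableAt_coordField hφ hx i) (mdifferentiableAt_coordField hφ hx j)
    rw [mlieBracket_coordField hφ hx, sub_eq_zero] at h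
    exact congrArg (coordForm φ k x) h
  metric := by
    rintro _ ⟨x, ⟨hx, hxi⟩, rfl⟩ i j k
    have h := hcov.metric x hxi (coordField φ i x) (coordField φ j) (coordField φ k)
      (mdifferentiableAt_coordField hφ hx j) (mdifferentiableAt_coordField hφ hx k)
    have hd : MDifferentiableAt (𝓡∂ (n + 1)) 𝓘(ℝ, ℝ)
        (fun y => g y (coordField φ j y) (coordField φ k y)) x :=
      ((contMDiffOn_metricMatrix hg hφ j k).contMDiffAt
        ((φ.open_source.inter isOpen_interiorSet).mem_nhds ⟨hx, hxi⟩)).mdifferentiableAt (by simp)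
    have h5 := ((partialDeriv_eq_pd hφ hx hxi _ i).symm.trans
      (mfderiv_coordField hφ hx hd i).symm).trans h
    simp only [φ.extend_left_inv hx]
    refine h5.trans ?_
    rw [metric_apply_left hφ hx, metric_apply_right hφ hx]
    exact congrArg₂ _ rfl (Finset.sum_congr rfl fun l _ => mul_comm _ _)

end Connection

end ProjectiveTractor

/-! ### Curvature in components -/

namespace ProjectiveTractor

open Set Filter Topology

section CoordinateCurvature

variable {n : ℕ}

/-- The components `R_{mi}{}^k{}_j` of the curvature in terms of connection coefficients. -/
noncomputable def riemannCoord (Γ : Model n → Fin (n + 1) → Fin (n + 1) → Fin (n + 1) → ℝ)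
    (x : Model n) (k m i j : Fin (n + 1)) : ℝ :=
  pd m (fun y => Γ y k i j) x - pd i (fun y => Γ y k m j) x
    + ∑ l, (Γ x l i j * Γ x k m l - Γ x l m j * Γ x k i l)

lemma ricciCoord_eq_sum_riemannCoord (Γ : Model n → Fin (n + 1) → Fin (n + 1) → Fin (n + 1) → ℝ)
    (x : Model n) (i j : Fin (n + 1)) : ricciCoord Γ x i j = ∑ k, riemannCoord Γ x k k i j := rfl

/-- The components of `∇_A Z` in terms of the components of `A` and `Z` and the connection
coefficients. -/
noncomputable def covCoord (Γ : Model n → Fin (n + 1) → Fin (n + 1) → Fin (n + 1) → ℝ)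
    (A Z : Fin (n + 1) → Model n → ℝ) (k : Fin (n + 1)) (x : Model n) : ℝ :=
  ∑ i, A i x * (pd i (Z k) x + ∑ j, Γ x k i j * Z j x)

variable {O : Set (Model n)} {Γ : Model n → Fin (n + 1) → Fin (n + 1) → Fin (n + 1) → ℝ}
  {A B Z : Fin (n + 1) → Model n → ℝ} {x : Model n}

lemma contDiffOn_covCoord (hO : IsOpen O) (hΓ : ∀ k i j, ContDiffOn ℝ ∞ (fun y => Γ y k i j) O)
    (hA : ∀ i, ContDiffOn ℝ ∞ (A i) O) (hZ : ∀ i, ContDiffOn ℝ ∞ (Z i) O) (k : Fin (n + 1)) :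
    ContDiffOn ℝ ∞ (covCoord Γ A Z k) O :=
  ContDiffOn.sum fun i _ => (hA i).mul ((contDiffOn_pd hO (hZ k) i).add
    (ContDiffOn.sum fun j _ => (hΓ k i j).mul (hZ j)))

/-- The second covariant derivative `∇_A ∇_B Z` in components. -/
lemma covCoord_covCoord (hO : IsOpen O) (hΓ : ∀ k i j, ContDiffOn ℝ ∞ (fun y => Γ y k i j) O)
    (hB : ∀ i, ContDiffOn ℝ ∞ (B i) O) (hZ : ∀ i, ContDiffOn ℝ ∞ (Z i) O) (hx : x ∈ O)
    (k : Fin (n + 1)) : covCoord Γ A (covCoord Γ B Z) k x =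
      ∑ i, (∑ m, A m x * pd m (B i) x) * (pd i (Z k) x + ∑ j, Γ x k i j * Z j x)
      + ∑ m, ∑ i, A m x * B i x * (pd m (pd i (Z k)) x
        + ∑ j, (pd m (fun y => Γ y k i j) x * Z j x + Γ x k i j * pd m (Z j) x)
        + ∑ l, Γ x k m l * (pd i (Z l) x + ∑ j, Γ x l i j * Z j x)) := by
  have dΓ := fun k i j => differentiableAt_of_contDiffOn hO (hΓ k i j) hx
  have dB := fun i => differentiableAt_of_contDiffOn hO (hB i) hx
  have dZ := fun i => differentiableAt_of_contDiffOn hO (hZ i) hx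
  have dD := fun i k => differentiableAt_of_contDiffOn hO (contDiffOn_pd hO (hZ k) i) hx
  have h1 : ∀ m, pd m (covCoord Γ B Z k) x = ∑ i, (pd m (B i) x *
      (pd i (Z k) x + ∑ j, Γ x k i j * Z j x) + B i x * (pd m (pd i (Z k)) x
        + ∑ j, (pd m (fun y => Γ y k i j) x * Z j x + Γ x k i j * pd m (Z j) x))) := by
    intro m
    have dS : ∀ i, DifferentiableAt ℝ (fun y => ∑ j, Γ y k i j * Z j y) x := fun i =>
      DifferentiableAt.fun_sum fun j _ => (dΓ k i j).mul (dZ j)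
    refine (pd_sum m fun i => (dB i).mul ((dD i k).add (dS i))).trans ?_
    refine Finset.sum_congr rfl fun i _ => ?_
    have e1 := pd_add m (dD i k) (dS i)
    have e2 : pd m (fun y => ∑ j, Γ y k i j * Z j y) x =
        ∑ j, (pd m (fun y => Γ y k i j) x * Z j x + Γ x k i j * pd m (Z j) x) :=
      (pd_sum m fun j => (dΓ k i j).mul (dZ j)).trans
        (Finset.sum_congr rfl fun j _ => pd_mul m (dΓ k i j) (dZ j))
    rw [e2] at e1
    exact (pd_mul m (dB i) ((dD i k).add (dS i))).trans (congrArg₂ _ rfl (congrArg _ e1))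
  have h2 : ∀ m, ∑ l, Γ x k m l * covCoord Γ B Z l x =
      ∑ i, B i x * ∑ l, Γ x k m l * (pd i (Z l) x + ∑ j, Γ x l i j * Z j x) := by
    intro m
    simp only [covCoord, Finset.mul_sum]
    rw [Finset.sum_comm]
    exact Finset.sum_congr rfl fun i _ => Finset.sum_congr rfl fun l _ => by ring
  rw [covCoord]
  simp only [h1, h2, Finset.sum_mul]
  rw [Finset.sum_comm (f := fun i m => A m x * pd m (B i) x * _)]
  rw [← Finset.sum_add_distrib]
  refine Finset.sum_congr rfl fun m _ => ?_
  rw [← Finset.sum_add_distrib, ← Finset.sum_add_distrib, Finset.mul_sum]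
  exact Finset.sum_congr rfl fun i _ => by ring

/-- The curvature of commuting vector fields in components: derivatives of the components of the
vector fields cancel. -/
lemma covCoord_commutator (hO : IsOpen O) (hΓ : ∀ k i j, ContDiffOn ℝ ∞ (fun y => Γ y k i j) O)
    (hA : ∀ i, ContDiffOn ℝ ∞ (A i) O) (hB : ∀ i, ContDiffOn ℝ ∞ (B i) O)
    (hZ : ∀ i, ContDiffOn ℝ ∞ (Z i) O) (hx : x ∈ O)
    (hAB : ∀ i, ∑ m, A m x * pd m (B i) x = ∑ m, B m x * pd m (A i) x) (k : Fin (n + 1)) :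
    covCoord Γ A (covCoord Γ B Z) k x - covCoord Γ B (covCoord Γ A Z) k x =
      ∑ m, ∑ i, ∑ j, A m x * B i x * Z j x * riemannCoord Γ x k m i j := by
  rw [covCoord_covCoord hO hΓ hB hZ hx, covCoord_covCoord hO hΓ hA hZ hx]
  simp only [hAB]
  rw [add_sub_add_left_eq_sub]
  rw [Finset.sum_comm (f := fun m i => B m x * A i x * _), ← Finset.sum_sub_distrib]
  refine Finset.sum_congr rfl fun m _ => ?_
  rw [← Finset.sum_sub_distrib]
  refine Finset.sum_congr rfl fun i _ => ?_
  have h1 : ∀ a b, ∑ l, Γ x k a l * (pd b (Z l) x + ∑ j, Γ x l b j * Z j x) =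
      ∑ l, Γ x k a l * pd b (Z l) x + ∑ j, Z j x * ∑ l, Γ x l b j * Γ x k a l := by
    intro a b
    simp only [mul_add, Finset.sum_add_distrib, Finset.mul_sum]
    rw [Finset.sum_comm (f := fun l j => Γ x k a l * (Γ x l b j * Z j x))]
    exact congrArg _ (Finset.sum_congr rfl fun j _ => Finset.sum_congr rfl fun l _ => by ring)
  have h2 : ∑ j, A m x * B i x * Z j x * riemannCoord Γ x k m i j = A m x * B i x *
      (∑ j, pd m (fun y => Γ y k i j) x * Z j x - ∑ j, pd i (fun y => Γ y k m j) x * Z j x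
        + (∑ j, Z j x * ∑ l, Γ x l i j * Γ x k m l - ∑ j, Z j x * ∑ l, Γ x l m j * Γ x k i l)) := by
    simp only [riemannCoord, ← Finset.sum_add_distrib, Finset.mul_sum,
      ← Finset.sum_sub_distrib]
    refine Finset.sum_congr rfl fun j _ => ?_
    simp only [← Finset.mul_sum, Finset.sum_sub_distrib]
    ring
  rw [h1, h1, h2, pd_comm hO (hZ k) m i hx]
  simp only [Finset.sum_add_distrib]
  ring

end CoordinateCurvature

section Ricci

variable {n : ℕ} {M : Type*} [TopologicalSpace M] [ChartedSpace (EuclideanHalfSpace (n + 1)) M]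
  [IsManifold (𝓡∂ (n + 1)) ∞ M] {φ ψ : Chart n M} {x : M}
  {cov : ((x : M) → TangentSpace (𝓡∂ (n + 1)) x) →
  ((x : M) → TangentSpace (𝓡∂ (n + 1)) x →L[ℝ] TangentSpace (𝓡∂ (n + 1)) x)}
  {g : (x : M) → TangentSpace (𝓡∂ (n + 1)) x →L[ℝ] TangentSpace (𝓡∂ (n + 1)) x →L[ℝ] ℝ}

/-- The connection coefficients as functions of the coordinates. -/
noncomputable def coordChristoffel (cov : ((x : M) → TangentSpace (𝓡∂ (n + 1)) x) →
    ((x : M) → TangentSpace (𝓡∂ (n + 1)) x →L[ℝ] TangentSpace (𝓡∂ (n + 1)) x))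
    (φ : Chart n M) (p : Model n) : Fin (n + 1) → Fin (n + 1) → Fin (n + 1) → ℝ :=
  christoffel cov φ ((φ.extend (𝓡∂ (n + 1))).symm p)

lemma coordChristoffel_extend (hx : x ∈ φ.source) (k i j : Fin (n + 1)) :
    coordChristoffel cov φ (φ.extend (𝓡∂ (n + 1)) x) k i j = christoffel cov φ x k i j := by
  rw [coordChristoffel, φ.extend_left_inv hx]

/-- The component functions of a vector field as functions of the coordinates. -/
noncomputable def coordComp (φ : Chart n M) (V : (x : M) → TangentSpace (𝓡∂ (n + 1)) x)
    (k : Fin (n + 1)) (p : Model n) : ℝ :=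
  coordForm φ k ((φ.extend (𝓡∂ (n + 1))).symm p) (V ((φ.extend (𝓡∂ (n + 1))).symm p))

lemma coordComp_extend (hx : x ∈ φ.source) (V : (x : M) → TangentSpace (𝓡∂ (n + 1)) x)
    (k : Fin (n + 1)) :
    coordComp φ V k (φ.extend (𝓡∂ (n + 1)) x) = coordForm φ k x (V x) := by
  rw [coordComp, φ.extend_left_inv hx]

/-- The covariant derivative of a vector field along another one in components. -/
lemma coordForm_cov_apply (hcov : IsCovariantDerivativeOn (Model n) cov (interiorSet n M))
    (hφ : φ ∈ smoothCharts n M) (hx : x ∈ φ.source) (hxi : x ∈ interiorSet n M)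
    {V W : (x : M) → TangentSpace (𝓡∂ (n + 1)) x}
    (hV : ∀ k, MDifferentiableAt (𝓡∂ (n + 1)) 𝓘(ℝ, ℝ) (fun y => coordForm φ k y (V y)) x)
    (k : Fin (n + 1)) : coordForm φ k x (cov V x (W x)) =
      covCoord (coordChristoffel cov φ) (coordComp φ W) (coordComp φ V) k
        (φ.extend (𝓡∂ (n + 1)) x) := by
  rw [coordForm_cov hcov hφ hx hxi hV]
  simp only [partialDeriv_eq_pd hφ hx hxi, covCoord, coordComp_extend hx,
    coordChristoffel_extend hx]
  rfl

/-- The curvature on coordinate fields of one chart, in components of another chart. -/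
lemma coordForm_curvature (hg : IsPseudoRiemannianMetric g) (hcov : IsLeviCivita g cov)
    (hφ : φ ∈ smoothCharts n M) (hψ : ψ ∈ smoothCharts n M) (hx : x ∈ φ.source)
    (hx' : x ∈ ψ.source) (hxi : x ∈ interiorSet n M) (k a b c : Fin (n + 1)) :
    coordForm φ k x (curvature cov (coordField ψ a) (coordField ψ b) (coordField ψ c) x) =
      ∑ m, ∑ i, ∑ j, coordForm φ m x (coordField ψ a x) * coordForm φ i x (coordField ψ b x) *
        coordForm φ j x (coordField ψ c x) *
        riemannCoord (coordChristoffel cov φ) (φ.extend (𝓡∂ (n + 1)) x) k m i j := by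
  set W : Set M := φ.source ∩ ψ.source ∩ interiorSet n M with hW
  have hWo : IsOpen W := (φ.open_source.inter ψ.open_source).inter isOpen_interiorSet
  have hWφ : W ⊆ φ.source := fun y hy => hy.1.1
  have hxW : x ∈ W := ⟨⟨hx, hx'⟩, hxi⟩
  set O := φ.extend (𝓡∂ (n + 1)) '' W with hO
  have hOo : IsOpen O := isOpen_extend_image hφ hWo hWφ inter_subset_right
  have hΓ : ∀ k i j, ContDiffOn ℝ ∞ (fun p => coordChristoffel cov φ p k i j) O := by
    intro k i j
    refine ((hcov.isChristoffel hg hφ).contDiffOn (isOpen_extend_image hφ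
      (φ.open_source.inter isOpen_interiorSet) inter_subset_left inter_subset_right) k i j).mono ?_
    exact image_mono fun y hy => ⟨hy.1.1, hy.2⟩
  have hF : ∀ a i, ContDiffOn ℝ ∞ (coordComp φ (coordField ψ a) i) O := fun a i =>
    (contMDiffOn_iff_contDiffOn_extend hφ hWφ _).1
      ((contMDiffOn_coordForm_coordField hφ hψ i a).mono inter_subset_left)
  have hV : ∀ a, ∀ y ∈ W, ∀ k, MDifferentiableAt (𝓡∂ (n + 1)) 𝓘(ℝ, ℝ)
      (fun y => coordForm φ k y (coordField ψ a y)) y := fun a y hy k =>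
    ((contMDiffOn_coordForm_coordField hφ hψ k a).contMDiffAt
      ((φ.open_source.inter ψ.open_source).mem_nhds hy.1)).mdifferentiableAt (by simp)
  -- components of `∇_b ∂_c`
  have h1 : ∀ b c k, ∀ y ∈ W, coordForm φ k y (cov (coordField ψ c) y (coordField ψ b y)) =
      covCoord (coordChristoffel cov φ) (coordComp φ (coordField ψ b))
        (coordComp φ (coordField ψ c)) k (φ.extend (𝓡∂ (n + 1)) y) := fun b c k y hy =>
    coordForm_cov_apply hcov.isCovariantDerivative hφ (hWφ hy) hy.2 (hV c y hy) k
  have h2 : ∀ b c k, ∀ p ∈ O,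
      coordComp φ (fun y => cov (coordField ψ c) y (coordField ψ b y)) k p =
      covCoord (coordChristoffel cov φ) (coordComp φ (coordField ψ b))
        (coordComp φ (coordField ψ c)) k p := by
    rintro b c k _ ⟨y, hy, rfl⟩
    rw [coordComp_extend (hWφ hy), h1 b c k y hy]
  have h3 : ∀ b c k, MDifferentiableAt (𝓡∂ (n + 1)) 𝓘(ℝ, ℝ)
      (fun y => coordForm φ k y (cov (coordField ψ c) y (coordField ψ b y))) x := by
    intro b c k
    have : ContMDiffOn (𝓡∂ (n + 1)) 𝓘(ℝ, ℝ) ∞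
      (fun y => coordForm φ k y (cov (coordField ψ c) y (coordField ψ b y))) W :=
      (contMDiffOn_iff_contDiffOn_extend hφ hWφ _).2
        ((contDiffOn_covCoord hOo hΓ (hF b) (hF c) k).congr (h2 b c k))
    exact (this.contMDiffAt (hWo.mem_nhds hxW)).mdifferentiableAt (by simp)
  have hxO : φ.extend (𝓡∂ (n + 1)) x ∈ O := mem_image_of_mem _ hxW
  have h4 : ∀ a b c, coordForm φ k x
      (cov (fun y => cov (coordField ψ c) y (coordField ψ b y)) x (coordField ψ a x)) =
      covCoord (coordChristoffel cov φ) (coordComp φ (coordField ψ a))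
        (covCoord (coordChristoffel cov φ) (coordComp φ (coordField ψ b))
        (coordComp φ (coordField ψ c))) k (φ.extend (𝓡∂ (n + 1)) x) := by
    intro a b c
    rw [coordForm_cov_apply hcov.isCovariantDerivative hφ hx hxi (h3 b c) k]
    refine Finset.sum_congr rfl fun i _ => ?_
    rw [pd_congr hOo (h2 b c k) i hxO]
    simp only [h2 b c _ _ hxO]
  -- the coordinate fields commute
  have h5 : ∀ i, ∑ m, coordComp φ (coordField ψ a) m (φ.extend (𝓡∂ (n + 1)) x) *
        pd m (coordComp φ (coordField ψ b) i) (φ.extend (𝓡∂ (n + 1)) x) =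
      ∑ m, coordComp φ (coordField ψ b) m (φ.extend (𝓡∂ (n + 1)) x) *
        pd m (coordComp φ (coordField ψ a) i) (φ.extend (𝓡∂ (n + 1)) x) := by
    intro i
    have h := hcov.torsion_free x hxi (coordField ψ a) (coordField ψ b)
      (mdifferentiableAt_coordField hψ hx' a) (mdifferentiableAt_coordField hψ hx' b)
    rw [mlieBracket_coordField hψ hx', sub_eq_zero] at h
    have h6 := congrArg (coordForm φ i x) h
    rw [h1 a b i x hxW, h1 b a i x hxW] at h6
    simp only [covCoord, mul_add, Finset.sum_add_distrib] at h6
    have h7 : ∑ m, coordComp φ (coordField ψ a) m (φ.extend (𝓡∂ (n + 1)) x) *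
        ∑ j, coordChristoffel cov φ (φ.extend (𝓡∂ (n + 1)) x) i m j *
          coordComp φ (coordField ψ b) j (φ.extend (𝓡∂ (n + 1)) x) =
        ∑ m, coordComp φ (coordField ψ b) m (φ.extend (𝓡∂ (n + 1)) x) *
        ∑ j, coordChristoffel cov φ (φ.extend (𝓡∂ (n + 1)) x) i m j *
          coordComp φ (coordField ψ a) j (φ.extend (𝓡∂ (n + 1)) x) := by
      simp only [Finset.mul_sum]
      rw [Finset.sum_comm]
      refine Finset.sum_congr rfl fun m _ => Finset.sum_congr rfl fun j _ => ?_
      have := (hcov.isChristoffel hg hφ).torsion_free _ (mem_image_of_mem _ ⟨hx, hxi⟩) i m j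
      change coordChristoffel cov φ _ i m j = coordChristoffel cov φ _ i j m at this
      rw [this]
      ring
    rw [h7] at h6
    exact add_right_cancel h6
  have h6 := covCoord_commutator hOo hΓ (hF a) (hF b) (hF c) hxO h5 k
  simp only [coordComp_extend hx] at h6
  rw [← h6, curvature, mlieBracket_coordField hψ hx', map_zero, sub_zero, coordForm_sub, h4, h4]

/-- The Ricci curvature of a chart in terms of the connection coefficients of another chart. -/
lemma ricci_eq_sum (hg : IsPseudoRiemannianMetric g) (hcov : IsLeviCivita g cov)
    (hφ : φ ∈ smoothCharts n M) (hψ : ψ ∈ smoothCharts n M) (hx : x ∈ φ.source)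
    (hx' : x ∈ ψ.source) (hxi : x ∈ interiorSet n M) (b c : Fin (n + 1)) :
    ricci cov ψ x b c = ∑ i, ∑ j, coordForm φ i x (coordField ψ b x) *
      coordForm φ j x (coordField ψ c x) *
      ricciCoord (coordChristoffel cov φ) (φ.extend (𝓡∂ (n + 1)) x) i j := by
  have h1 : ∀ (a k : Fin (n + 1)), coordForm ψ a x (coordField φ k x) =
    jacobian ψ φ (φ.extend (𝓡∂ (n + 1)) x) a k := fun a k => (jacobian_eq hψ hφ hx' hx a k).symm
  have h2 : ∀ a k : Fin (n + 1), coordForm φ k x (coordField ψ a x) =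
    jacobian φ ψ (ψ.extend (𝓡∂ (n + 1)) x) k a := fun a k => (jacobian_eq hφ hψ hx hx' k a).symm
  have h3 : ∀ m k, ∑ a, coordForm φ m x (coordField ψ a x) * coordForm ψ a x (coordField φ k x) =
      if m = k then 1 else 0 := by
    intro m k
    have := congrFun (congrFun (jacobian_mul_jacobian hφ hψ hx hx') m) k
    rw [Matrix.mul_apply, Matrix.one_apply] at this
    simpa only [h1, h2] using this
  set R := riemannCoord (coordChristoffel cov φ) (φ.extend (𝓡∂ (n + 1)) x) with hR
  have h4 : ricci cov ψ x b c = ∑ a, ∑ k, ∑ m, ∑ i, ∑ j,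
      (coordForm φ m x (coordField ψ a x) * coordForm ψ a x (coordField φ k x)) *
      (coordForm φ i x (coordField ψ b x) * coordForm φ j x (coordField ψ c x) * R k m i j) := by
    refine Finset.sum_congr rfl fun a _ => ?_
    rw [coordForm_eq_sum_jacobian hψ hφ hx' hx]
    refine Finset.sum_congr rfl fun k _ => ?_
    rw [coordForm_curvature hg hcov hφ hψ hx hx' hxi, ← h1, Finset.mul_sum]
    refine Finset.sum_congr rfl fun m _ => ?_
    rw [Finset.mul_sum]
    refine Finset.sum_congr rfl fun i _ => ?_
    rw [Finset.mul_sum]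
    exact Finset.sum_congr rfl fun j _ => by ring
  have h5 : ∀ k m, ∑ a, ∑ i, ∑ j,
      (coordForm φ m x (coordField ψ a x) * coordForm ψ a x (coordField φ k x)) *
      (coordForm φ i x (coordField ψ b x) * coordForm φ j x (coordField ψ c x) * R k m i j) =
      if m = k then ∑ i, ∑ j,
        coordForm φ i x (coordField ψ b x) * coordForm φ j x (coordField ψ c x) * R k m i j
      else 0 := by
    intro k m
    simp only [← Finset.mul_sum]
    rw [← Finset.sum_mul, h3]
    split_ifs <;> simp
  rw [h4, Finset.sum_comm]
  have h6 : ∀ k, ∑ a, ∑ m, ∑ i, ∑ j,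
      (coordForm φ m x (coordField ψ a x) * coordForm ψ a x (coordField φ k x)) *
      (coordForm φ i x (coordField ψ b x) * coordForm φ j x (coordField ψ c x) * R k m i j) =
      ∑ i, ∑ j,
        coordForm φ i x (coordField ψ b x) * coordForm φ j x (coordField ψ c x) * R k k i j := by
    intro k
    rw [Finset.sum_comm]
    simp only [h5, Finset.sum_ite_eq', Finset.mem_univ, if_true]
  simp only [h6, ricciCoord_eq_sum_riemannCoord, Finset.mul_sum]
  rw [Finset.sum_comm]
  exact Finset.sum_congr rfl fun i _ => Finset.sum_comm

lemma ricci_eq_ricciCoord (hg : IsPseudoRiemannianMetric g) (hcov : IsLeviCivita g cov)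
    (hφ : φ ∈ smoothCharts n M) (hx : x ∈ φ.source) (hxi : x ∈ interiorSet n M)
    (i j : Fin (n + 1)) : ricci cov φ x i j =
      ricciCoord (coordChristoffel cov φ) (φ.extend (𝓡∂ (n + 1)) x) i j := by
  rw [ricci_eq_sum hg hcov hφ hφ hx hx hxi]
  simp [coordForm_coordField hφ hx]

/-- The Ricci curvature is a tensor. -/
lemma ricci_transition (hg : IsPseudoRiemannianMetric g) (hcov : IsLeviCivita g cov)
    (hφ : φ ∈ smoothCharts n M) (hψ : ψ ∈ smoothCharts n M) (hx : x ∈ φ.source)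
    (hx' : x ∈ ψ.source) (hxi : x ∈ interiorSet n M) :
    Matrix.of (ricci cov ψ x) = (jacobian φ ψ (ψ.extend (𝓡∂ (n + 1)) x)).transpose *
      Matrix.of (ricci cov φ x) * jacobian φ ψ (ψ.extend (𝓡∂ (n + 1)) x) := by
  ext b c
  simp only [Matrix.mul_apply, Matrix.of_apply, Matrix.transpose_apply, Finset.sum_mul,
    jacobian_eq hφ hψ hx hx', ricci_eq_ricciCoord hg hcov hφ hx hxi,
    ricci_eq_sum hg hcov hφ hψ hx hx' hxi]
  rw [Finset.sum_comm]
  exact Finset.sum_congr rfl fun j _ => Finset.sum_congr rfl fun i _ => by ring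

end Ricci

end ProjectiveTractor

/-! ### The tractor form on the interior -/

namespace ProjectiveTractor

open Set Filter Topology

section InteriorFormulas

variable {n : ℕ} {M : Type*} [TopologicalSpace M] [ChartedSpace (EuclideanHalfSpace (n + 1)) M]
  [IsManifold (𝓡∂ (n + 1)) ∞ M] {φ ψ : Chart n M} {x : M}
  {cov : ((x : M) → TangentSpace (𝓡∂ (n + 1)) x) →
  ((x : M) → TangentSpace (𝓡∂ (n + 1)) x →L[ℝ] TangentSpace (𝓡∂ (n + 1)) x)}
  {g : (x : M) → TangentSpace (𝓡∂ (n + 1)) x →L[ℝ] TangentSpace (𝓡∂ (n + 1)) x →L[ℝ] ℝ}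

/-- The metric coefficients as functions of the coordinates. -/
noncomputable def coordMetric
    (g : (x : M) → TangentSpace (𝓡∂ (n + 1)) x →L[ℝ] TangentSpace (𝓡∂ (n + 1)) x →L[ℝ] ℝ)
    (φ : Chart n M) (p : Model n) : Matrix (Fin (n + 1)) (Fin (n + 1)) ℝ :=
  metricMatrix g φ ((φ.extend (𝓡∂ (n + 1))).symm p)

/-- The interior points in the image of a chart. -/
def chartInterior (φ : Chart n M) : Set (Model n) :=
  φ.extend (𝓡∂ (n + 1)) '' (φ.source ∩ interiorSet n M)

lemma isOpen_chartInterior (hφ : φ ∈ smoothCharts n M) : IsOpen (chartInterior φ) :=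
  isOpen_extend_image hφ (φ.open_source.inter isOpen_interiorSet) inter_subset_left
    inter_subset_right

lemma extend_mem_chartInterior (hx : x ∈ φ.source) (hxi : x ∈ interiorSet n M) :
    φ.extend (𝓡∂ (n + 1)) x ∈ chartInterior φ := mem_image_of_mem _ ⟨hx, hxi⟩

lemma IsLeviCivita.isChristoffel_coord (hg : IsPseudoRiemannianMetric g)
    (hcov : IsLeviCivita g cov) (hφ : φ ∈ smoothCharts n M) :
    IsChristoffel (chartInterior φ) (coordMetric g φ) (coordChristoffel cov φ) :=
  hcov.isChristoffel hg hφ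

lemma coordMetric_extend (hx : x ∈ φ.source) :
    coordMetric g φ (φ.extend (𝓡∂ (n + 1)) x) = metricMatrix g φ x := by
  rw [coordMetric, φ.extend_left_inv hx]

/-- The weight factor `τ⁻¹ = |det g|^{1/(n+2)}`; `Real.log` only sees the absolute value. -/
lemma inv_tauComponent (hd : (metricMatrix g φ x).det ≠ 0) :
    (tauComponent g φ x)⁻¹ = Real.exp (Real.log (metricMatrix g φ x).det / ((n : ℝ) + 2)) := by
  have hd' : 0 < |(metricMatrix g φ x).det| := abs_pos.2 hd
  rw [tauComponent, volComponent, Real.sqrt_eq_rpow, ← Real.rpow_mul hd'.le,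
    ← Real.rpow_neg hd'.le, Real.rpow_def_of_pos hd', Real.log_abs]
  congr 1
  field_simp

lemma metricBivectorDensity_eq (hg : IsPseudoRiemannianMetric g) (hφ : φ ∈ smoothCharts n M)
    (hx : x ∈ φ.source) (hxi : x ∈ interiorSet n M) (i j : Fin (n + 1)) :
    metricBivectorDensity g φ x i j =
      weightedInverse (coordMetric g φ) (φ.extend (𝓡∂ (n + 1)) x) i j := by
  rw [weightedInverse, coordMetric_extend hx, metricBivectorDensity,
    inv_tauComponent (det_metricMatrix_ne_zero hg hφ hx hxi)]

lemma christoffelTrace_eq (hx : x ∈ φ.source) (i : Fin (n + 1)) :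
    christoffelTrace cov φ x i / ((n : ℝ) + 2) =
      normalizedTrace (coordChristoffel cov φ) (φ.extend (𝓡∂ (n + 1)) x) i := by
  rw [normalizedTrace]
  simp only [coordChristoffel_extend hx]
  rfl

/-- The section `τ⁻¹ g^{ij}` is parallel. -/
lemma covBivectorDensity_metricBivectorDensity (hg : IsPseudoRiemannianMetric g)
    (hcov : IsLeviCivita g cov) (hφ : φ ∈ smoothCharts n M) (hx : x ∈ φ.source)
    (hxi : x ∈ interiorSet n M) (i j k : Fin (n + 1)) :
    covBivectorDensity cov (metricBivectorDensity g) φ x i j k = 0 := by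
  have h := hcov.isChristoffel_coord hg hφ
  have hO := isOpen_chartInterior hφ
  have hxO := extend_mem_chartInterior hx hxi
  have h1 : partialDeriv φ i (fun y => metricBivectorDensity g φ y j k) x =
      pd i (fun p => weightedInverse (coordMetric g φ) p j k) (φ.extend (𝓡∂ (n + 1)) x) := by
    rw [partialDeriv_eq_pd hφ hx hxi]
    refine pd_congr hO ?_ i hxO
    rintro _ ⟨y, ⟨hy, hyi⟩, rfl⟩
    rw [Function.comp_apply, φ.extend_left_inv hy, metricBivectorDensity_eq hg hφ hy hyi]
  have h2 : christoffelTrace cov φ x i = ((n : ℝ) + 2) *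
      normalizedTrace (coordChristoffel cov φ) (φ.extend (𝓡∂ (n + 1)) x) i := by
    rw [← christoffelTrace_eq hx]
    field_simp
  rw [covBivectorDensity, h1, h.pd_weightedInverse hO hxO, h2]
  simp only [metricBivectorDensity_eq hg hφ hx hxi, ← coordChristoffel_extend (cov := cov) hx]
  field_simp
  ring

lemma middleSlot_metricBivectorDensity (hg : IsPseudoRiemannianMetric g)
    (hcov : IsLeviCivita g cov) (hφ : φ ∈ smoothCharts n M) (hx : x ∈ φ.source)
    (hxi : x ∈ interiorSet n M) (j : Fin (n + 1)) :
    middleSlot cov (metricBivectorDensity g) φ j x = 0 := by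
  simp [middleSlot, covBivectorDensity_metricBivectorDensity hg hcov hφ hx hxi]

/-- The middle slot vanishes on an open set, so its derivatives vanish as well. -/
lemma divVectorDensity_middleSlot (hg : IsPseudoRiemannianMetric g)
    (hcov : IsLeviCivita g cov) (hφ : φ ∈ smoothCharts n M) (hx : x ∈ φ.source)
    (hxi : x ∈ interiorSet n M) :
    divVectorDensity cov (middleSlot cov (metricBivectorDensity g) φ) φ x = 0 := by
  have h1 : ∀ j, partialDeriv φ j (middleSlot cov (metricBivectorDensity g) φ j) x = 0 := by
    intro j
    rw [partialDeriv_eq_pd hφ hx hxi, pd_congr (g := fun _ => 0) (isOpen_chartInterior hφ) ?_ j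
      (extend_mem_chartInterior hx hxi), pd_const]
    rintro _ ⟨y, ⟨hy, hyi⟩, rfl⟩
    rw [Function.comp_apply, φ.extend_left_inv hy,
      middleSlot_metricBivectorDensity hg hcov hφ hy hyi]
  simp [divVectorDensity, h1, middleSlot_metricBivectorDensity hg hcov hφ hx hxi]

/-- The contraction `g^{ij} Ric_{ij}` in a chart. -/
noncomputable def scalarCoord (cov : ((x : M) → TangentSpace (𝓡∂ (n + 1)) x) →
    ((x : M) → TangentSpace (𝓡∂ (n + 1)) x →L[ℝ] TangentSpace (𝓡∂ (n + 1)) x))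
    (g : (x : M) → TangentSpace (𝓡∂ (n + 1)) x →L[ℝ] TangentSpace (𝓡∂ (n + 1)) x →L[ℝ] ℝ)
    (φ : Chart n M) (x : M) : ℝ :=
  ∑ i, ∑ j, (metricMatrix g φ x)⁻¹ i j * ricci cov φ x i j

lemma metricMatrix_transition (hφ : φ ∈ smoothCharts n M) (hψ : ψ ∈ smoothCharts n M)
    (hx : x ∈ φ.source) (hx' : x ∈ ψ.source) :
    metricMatrix g ψ x = (jacobian φ ψ (ψ.extend (𝓡∂ (n + 1)) x)).transpose *
      metricMatrix g φ x * jacobian φ ψ (ψ.extend (𝓡∂ (n + 1)) x) := by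
  ext a b
  simp only [Matrix.mul_apply, Matrix.transpose_apply, jacobian_eq hφ hψ hx hx']
  change g x (coordField ψ a x) (coordField ψ b x) = _
  conv_lhs => rw [← sum_coordForm_smul_coordField hφ hx (coordField ψ b x)]
  rw [map_sum]
  refine Finset.sum_congr rfl fun j _ => ?_
  rw [map_smul, metric_apply_left hφ hx]
  exact mul_comm _ _

lemma sum_inv_mul_eq_trace {ι : Type*} [Fintype ι] [DecidableEq ι] (A R : Matrix ι ι ℝ) :
    ∑ i, ∑ j, A⁻¹ i j * R i j = (A⁻¹ * R.transpose).trace := by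
  simp [Matrix.trace, Matrix.mul_apply]

/-- The contraction of a bilinear form with the inverse of a metric is invariant under change of
basis. -/
lemma sum_inv_mul_congr {ι : Type*} [Fintype ι] [DecidableEq ι] (A R : Matrix ι ι ℝ)
    {J : Matrix ι ι ℝ} (hJ : J.det ≠ 0) :
    ∑ i, ∑ j, (J.transpose * A * J)⁻¹ i j * (J.transpose * R * J) i j =
      ∑ i, ∑ j, A⁻¹ i j * R i j := by
  have h1 : IsUnit J.det := isUnit_iff_ne_zero.2 hJ
  have h2 : IsUnit J.transpose.det := by rwa [Matrix.det_transpose]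
  rw [sum_inv_mul_eq_trace, sum_inv_mul_eq_trace, Matrix.mul_inv_rev, Matrix.mul_inv_rev,
    Matrix.transpose_mul, Matrix.transpose_mul, Matrix.transpose_transpose]
  rw [show J⁻¹ * (A⁻¹ * J.transpose⁻¹) * (J.transpose * (R.transpose * J)) =
      J⁻¹ * (A⁻¹ * ((J.transpose⁻¹ * J.transpose) * (R.transpose * J))) by
        simp only [Matrix.mul_assoc], Matrix.nonsing_inv_mul _ h2, Matrix.one_mul,
    Matrix.trace_mul_comm, ← Matrix.mul_assoc, Matrix.mul_assoc, Matrix.mul_nonsing_inv _ h1,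
    Matrix.mul_one]

/-- The scalar curvature can be computed in any chart. -/
lemma scalarCurvature_eq (hg : IsPseudoRiemannianMetric g) (hcov : IsLeviCivita g cov)
    (hφ : φ ∈ smoothCharts n M) (hx : x ∈ φ.source) (hxi : x ∈ interiorSet n M) :
    scalarCurvature cov g x = scalarCoord cov g φ x := by
  have hψ := chartAt_mem_smoothCharts (n := n) x
  have hx' := mem_chart_source (EuclideanHalfSpace (n + 1)) x
  have h1 := metricMatrix_transition (g := g) hφ hψ hx hx'
  have h2 := ricci_transition hg hcov hφ hψ hx hx' hxi
  have h3 := sum_inv_mul_congr (metricMatrix g φ x) (Matrix.of (ricci cov φ x))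
    (det_jacobian_ne_zero hφ hψ hx hx')
  rw [← h1, ← h2] at h3
  exact h3

/-- The bottom slot of `L(τ⁻¹ g^{ij})` is `τ⁻¹ S / (n (n + 1))`. -/
lemma bottomSlot_metricBivectorDensity (hg : IsPseudoRiemannianMetric g)
    (hcov : IsLeviCivita g cov) (hφ : φ ∈ smoothCharts n M) (hx : x ∈ φ.source)
    (hxi : x ∈ interiorSet n M) :
    bottomSlot cov (metricBivectorDensity g) φ x =
      (tauComponent g φ x)⁻¹ * scalarCurvature cov g x / (n * (n + 1)) := by
  rw [bottomSlot, divVectorDensity_middleSlot hg hcov hφ hx hxi, sub_zero,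
    scalarCurvature_eq hg hcov hφ hx hxi, scalarCoord]
  simp only [schouten, metricBivectorDensity, Matrix.smul_apply, smul_eq_mul, Finset.mul_sum,
    Finset.sum_div]
  exact Finset.sum_congr rfl fun i _ => Finset.sum_congr rfl fun j _ => by
    rw [one_div, one_div, div_eq_mul_inv, mul_inv]
    ring

/-- The change of splitting matrix with entries `b_i = γ_i / (n+2)`. -/
noncomputable def splittingMatrix {n : ℕ} (b : Fin (n + 1) → ℝ) :
    Matrix (Unit ⊕ Fin (n + 1)) (Unit ⊕ Fin (n + 1)) ℝ :=
  Matrix.fromBlocks 1 0 (Matrix.of fun i _ => b i) 1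

/-- The block diagonal form with blocks `ρ` and `σ`. -/
noncomputable def diagonalForm {n : ℕ} (ρ : ℝ) (σ : Matrix (Fin (n + 1)) (Fin (n + 1)) ℝ) :
    Matrix (Unit ⊕ Fin (n + 1)) (Unit ⊕ Fin (n + 1)) ℝ :=
  Matrix.fromBlocks (Matrix.of fun _ _ => ρ) 0 0 σ

/-- In the splitting determined by the Levi-Civita connection, `L(τ⁻¹ g^{ij})` is block diagonal. -/
lemma splittingOperator_eq (hg : IsPseudoRiemannianMetric g)
    (hcov : IsLeviCivita g cov) (hφ : φ ∈ smoothCharts n M) (hx : x ∈ φ.source)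
    (hxi : x ∈ interiorSet n M) :
    splittingOperator cov (metricBivectorDensity g) φ x =
      (splittingMatrix fun i => christoffelTrace cov φ x i / ((n : ℝ) + 2)).transpose *
      diagonalForm (bottomSlot cov (metricBivectorDensity g) φ x) (metricBivectorDensity g φ x) *
      splittingMatrix fun i => christoffelTrace cov φ x i / ((n : ℝ) + 2) := by
  simp only [splittingOperator, fromSplitting, middleSlot_metricBivectorDensity hg hcov hφ hx hxi]
  rfl

/-- The entries of `L(τ⁻¹ g^{ij})` in jet coordinates in terms of its blocks in the splitting. -/
lemma splittingMatrix_conj {n : ℕ} (b : Fin (n + 1) → ℝ) (ρ : ℝ)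
    (σ : Matrix (Fin (n + 1)) (Fin (n + 1)) ℝ) :
    (splittingMatrix b).transpose * diagonalForm ρ σ * splittingMatrix b =
      Matrix.fromBlocks (Matrix.of fun _ _ => ρ + ∑ k, (∑ l, b l * σ l k) * b k)
        (Matrix.of fun _ j => ∑ l, b l * σ l j) (Matrix.of fun i _ => ∑ l, σ i l * b l) σ := by
  simp only [splittingMatrix, diagonalForm, Matrix.fromBlocks_transpose,
    Matrix.fromBlocks_multiply, Matrix.transpose_one, Matrix.transpose_zero]
  congr 1
  · ext i j
    simp [Matrix.mul_apply]
  · ext i j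
    simp [Matrix.mul_apply]
  · ext i j
    simp [Matrix.mul_apply]
  · simp

lemma det_splittingMatrix {n : ℕ} (b : Fin (n + 1) → ℝ) : (splittingMatrix b).det = 1 := by
  simp [splittingMatrix]

lemma det_diagonalForm {n : ℕ} (ρ : ℝ) (σ : Matrix (Fin (n + 1)) (Fin (n + 1)) ℝ) :
    (diagonalForm ρ σ).det = ρ * σ.det := by
  simp [diagonalForm, Matrix.det_unique]

/-- The tractor determinant of `L(τ⁻¹ g^{ij})` on the interior. -/
lemma scalarCurvature_eq_det (hn : 1 ≤ n) (hg : IsPseudoRiemannianMetric g)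
    (hcov : IsLeviCivita g cov) (hφ : φ ∈ smoothCharts n M) (hx : x ∈ φ.source)
    (hxi : x ∈ interiorSet n M) :
    scalarCurvature cov g x = SignType.sign (metricMatrix g φ x).det * ((n : ℝ) * ((n : ℝ) + 1)) *
      tractorDet (splittingOperator cov (metricBivectorDensity g)) φ x := by
  have hd := det_metricMatrix_ne_zero hg hφ hx hxi
  have hn' : (n : ℝ) ≠ 0 := by positivity
  rw [tractorDet, splittingOperator_eq hg hcov hφ hx hxi, Matrix.det_mul, Matrix.det_mul,
    Matrix.det_transpose, det_splittingMatrix, det_diagonalForm,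
    bottomSlot_metricBivectorDensity hg hcov hφ hx hxi, metricBivectorDensity,
    inv_tauComponent hd, Matrix.det_smul, Matrix.det_nonsing_inv, Fintype.card_fin,
    Ring.inverse_eq_inv', one_mul, mul_one]
  set d := (metricMatrix g φ x).det
  set w := Real.exp (Real.log d / ((n : ℝ) + 2)) with hw
  have h1 : w ^ (n + 2) = |d| := by
    rw [hw, ← Real.exp_nat_mul]
    push_cast
    rw [mul_div_cancel₀ _ (by positivity), Real.exp_log_eq_abs hd]
  have h2 : (SignType.sign d : ℝ) * |d| = d := sign_mul_abs d
  have h3 : (SignType.sign d : ℝ) * (w ^ (n + 2) * d⁻¹) = 1 := by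
    rw [h1, ← mul_assoc, h2, mul_inv_cancel₀ hd]
  calc scalarCurvature cov g x
      = scalarCurvature cov g x * ((SignType.sign d : ℝ) * (w ^ (n + 2) * d⁻¹)) := by
        rw [h3, mul_one]
    _ = _ := by
        field_simp
        ring

end InteriorFormulas

end ProjectiveTractor

/-! ### Transition laws on the interior -/

namespace ProjectiveTractor

open Set Filter Topology

section Transition

variable {n : ℕ} {M : Type*} [TopologicalSpace M] [ChartedSpace (EuclideanHalfSpace (n + 1)) M]
  [IsManifold (𝓡∂ (n + 1)) ∞ M] {φ ψ : Chart n M} {x : M}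
  {cov : ((x : M) → TangentSpace (𝓡∂ (n + 1)) x) →
  ((x : M) → TangentSpace (𝓡∂ (n + 1)) x →L[ℝ] TangentSpace (𝓡∂ (n + 1)) x)}
  {g : (x : M) → TangentSpace (𝓡∂ (n + 1)) x →L[ℝ] TangentSpace (𝓡∂ (n + 1)) x →L[ℝ] ℝ}

/-- The Jacobian matrix as a function on the manifold. -/
noncomputable def frameMatrix (φ ψ : Chart n M) (y : M) : Matrix (Fin (n + 1)) (Fin (n + 1)) ℝ :=
  Matrix.of fun k i => coordForm φ k y (coordField ψ i y)

/-- The transition function of `E(1)` as a function on the manifold. -/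
noncomputable def weightOneFactor (φ ψ : Chart n M) (y : M) : ℝ :=
  |(frameMatrix φ ψ y).det| ^ (-1 / ((n : ℝ) + 2))

lemma jacobian_eq_frameMatrix (hφ : φ ∈ smoothCharts n M) (hψ : ψ ∈ smoothCharts n M)
    (hx : x ∈ φ.source) (hx' : x ∈ ψ.source) :
    jacobian φ ψ (ψ.extend (𝓡∂ (n + 1)) x) = frameMatrix φ ψ x := by
  ext k i
  exact jacobian_eq hφ hψ hx hx' k i

lemma det_frameMatrix_ne_zero (hφ : φ ∈ smoothCharts n M) (hψ : ψ ∈ smoothCharts n M)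
    (hx : x ∈ φ.source) (hx' : x ∈ ψ.source) : (frameMatrix φ ψ x).det ≠ 0 := by
  rw [← jacobian_eq_frameMatrix hφ hψ hx hx']
  exact det_jacobian_ne_zero hφ hψ hx hx'

lemma contMDiffOn_frameMatrix (hφ : φ ∈ smoothCharts n M) (hψ : ψ ∈ smoothCharts n M)
    (k i : Fin (n + 1)) : ContMDiffOn (𝓡∂ (n + 1)) 𝓘(ℝ, ℝ) ∞
      (fun y => frameMatrix φ ψ y k i) (φ.source ∩ ψ.source) :=
  contMDiffOn_coordForm_coordField hφ hψ k i

lemma contMDiffOn_det {ι : Type*} [Fintype ι] [DecidableEq ι] {A : M → Matrix ι ι ℝ} {U : Set M}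
    (hA : ∀ i j, ContMDiffOn (𝓡∂ (n + 1)) 𝓘(ℝ, ℝ) ∞ (fun y => A y i j) U) :
    ContMDiffOn (𝓡∂ (n + 1)) 𝓘(ℝ, ℝ) ∞ (fun y => (A y).det) U := by
  have h1 : ContMDiffOn (𝓡∂ (n + 1)) 𝓘(ℝ, ι → ι → ℝ) ∞ (fun y i j => A y i j) U :=
    contMDiffOn_pi_space.2 fun i => contMDiffOn_pi_space.2 fun j => hA i j
  have h2 : ContDiff ℝ ∞ (fun B : ι → ι → ℝ => (Matrix.of fun i j => B i j).det) := by
    simp only [Matrix.det_apply, Matrix.of_apply]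
    fun_prop
  exact h2.contMDiff.comp_contMDiffOn h1

lemma weightOneFactor_eq_exp (hφ : φ ∈ smoothCharts n M) (hψ : ψ ∈ smoothCharts n M)
    (hx : x ∈ φ.source) (hx' : x ∈ ψ.source) : weightOneFactor φ ψ x =
      Real.exp (Real.log (frameMatrix φ ψ x).det * (-1 / ((n : ℝ) + 2))) := by
  rw [weightOneFactor, Real.rpow_def_of_pos (abs_pos.2 (det_frameMatrix_ne_zero hφ hψ hx hx')),
    Real.log_abs]

lemma contMDiffOn_weightOneFactor (hφ : φ ∈ smoothCharts n M) (hψ : ψ ∈ smoothCharts n M) :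
    ContMDiffOn (𝓡∂ (n + 1)) 𝓘(ℝ, ℝ) ∞ (weightOneFactor φ ψ) (φ.source ∩ ψ.source) := by
  have h1 := contMDiffOn_det (contMDiffOn_frameMatrix hφ hψ)
  refine ContMDiffOn.congr (f := fun y =>
    Real.exp (Real.log (frameMatrix φ ψ y).det * (-1 / ((n : ℝ) + 2)))) ?_
    fun y hy => weightOneFactor_eq_exp hφ hψ hy.1 hy.2
  intro y hy
  have h2 : ContDiffAt ℝ ∞ (fun t : ℝ => Real.exp (Real.log t * (-1 / ((n : ℝ) + 2))))
      (frameMatrix φ ψ y).det :=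
    ((Real.contDiffAt_log.2 (det_frameMatrix_ne_zero hφ hψ hy.1 hy.2)).mul contDiffAt_const).exp
  have h3 := ContMDiffAt.comp_contMDiffWithinAt y h2.contMDiffAt (h1 y hy)
  exact h3

lemma densityFactor_one_eq (hφ : φ ∈ smoothCharts n M) (hψ : ψ ∈ smoothCharts n M)
    (hx : x ∈ φ.source) (hx' : x ∈ ψ.source) :
    densityFactor 1 φ ψ (ψ.extend (𝓡∂ (n + 1)) x) = weightOneFactor φ ψ x := by
  rw [densityFactor, jacobian_eq_frameMatrix hφ hψ hx hx', weightOneFactor]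

lemma densityFactor_neg_two_eq (hφ : φ ∈ smoothCharts n M) (hψ : ψ ∈ smoothCharts n M)
    (hx : x ∈ φ.source) (hx' : x ∈ ψ.source) :
    densityFactor (-2) φ ψ (ψ.extend (𝓡∂ (n + 1)) x) = (weightOneFactor φ ψ x ^ 2)⁻¹ := by
  have h := det_frameMatrix_ne_zero hφ hψ hx hx'
  rw [densityFactor, jacobian_eq_frameMatrix hφ hψ hx hx', weightOneFactor_eq_exp hφ hψ hx hx',
    Real.rpow_def_of_pos (abs_pos.2 h), Real.log_abs, ← Real.exp_nat_mul, ← Real.exp_neg]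
  congr 1
  push_cast
  ring

lemma weightOneFactor_pos (hφ : φ ∈ smoothCharts n M) (hψ : ψ ∈ smoothCharts n M)
    (hx : x ∈ φ.source) (hx' : x ∈ ψ.source) : 0 < weightOneFactor φ ψ x := by
  rw [weightOneFactor_eq_exp hφ hψ hx hx']
  exact Real.exp_pos _

/-- The derivative of the transition function of `E(1)`. -/
lemma fderivWithin_densityFactor (hφ : φ ∈ smoothCharts n M) (hψ : ψ ∈ smoothCharts n M)
    (hx : x ∈ φ.source) (hx' : x ∈ ψ.source) (i : Fin (n + 1)) :
    fderivWithin ℝ (densityFactor 1 φ ψ) (range (𝓡∂ (n + 1))) (ψ.extend (𝓡∂ (n + 1)) x)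
      (stdVec i) = partialDeriv ψ i (weightOneFactor φ ψ) x := by
  have h1 : densityFactor 1 φ ψ =ᶠ[𝓝[range (𝓡∂ (n + 1))] (ψ.extend (𝓡∂ (n + 1)) x)]
      weightOneFactor φ ψ ∘ (ψ.extend (𝓡∂ (n + 1))).symm := by
    have h2 : ∀ᶠ p in 𝓝[range (𝓡∂ (n + 1))] (ψ.extend (𝓡∂ (n + 1)) x),
        (ψ.extend (𝓡∂ (n + 1))).symm p ∈ φ.source :=
      ((ψ.continuousAt_extend_symm hx').mono_left nhdsWithin_le_nhds).eventually
        (φ.open_source.mem_nhds (by rwa [ψ.extend_left_inv hx']))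
    filter_upwards [h2, ψ.extend_target_mem_nhdsWithin hx'] with p hp hp'
    have h3 : (ψ.extend (𝓡∂ (n + 1))).symm p ∈ ψ.source := by
      have := (ψ.extend (𝓡∂ (n + 1))).map_target hp'
      rwa [ψ.extend_source] at this
    rw [Function.comp_apply, ← densityFactor_one_eq hφ hψ hp h3,
      (ψ.extend (𝓡∂ (n + 1))).right_inv hp']
  rw [partialDeriv, h1.fderivWithin_eq_of_mem (mem_range_self _)]

/-- The chain rule for partial derivatives. -/
lemma partialDeriv_eq_sum (hφ : φ ∈ smoothCharts n M) (hψ : ψ ∈ smoothCharts n M)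
    (hx : x ∈ φ.source) (hx' : x ∈ ψ.source) {f : M → ℝ}
    (hf : MDifferentiableAt (𝓡∂ (n + 1)) 𝓘(ℝ, ℝ) f x) (i : Fin (n + 1)) :
    partialDeriv ψ i f x = ∑ k, frameMatrix φ ψ x k i * partialDeriv φ k f x := by
  rw [← mfderiv_coordField hψ hx' hf]
  conv_lhs => rw [← sum_coordForm_smul_coordField hφ hx (coordField ψ i x)]
  simp only [← mfderiv_coordField hφ hx hf]
  exact (map_sum _ _ _).trans (Finset.sum_congr rfl fun k _ => map_smul _ _ _)

/-- The function `log |det g_{ij}| / (2 (n+2))`, that is, the logarithm of the component of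
`τ^{-1/2}`. -/
noncomputable def logWeight
    (g : (x : M) → TangentSpace (𝓡∂ (n + 1)) x →L[ℝ] TangentSpace (𝓡∂ (n + 1)) x →L[ℝ] ℝ)
    (φ : Chart n M) (y : M) : ℝ :=
  (2 * ((n : ℝ) + 2))⁻¹ * Real.log (metricMatrix g φ y).det

lemma contMDiffOn_logWeight (hg : IsPseudoRiemannianMetric g) (hφ : φ ∈ smoothCharts n M) :
    ContMDiffOn (𝓡∂ (n + 1)) 𝓘(ℝ, ℝ) ∞ (logWeight g φ) (φ.source ∩ interiorSet n M) := by
  have h1 := contMDiffOn_det (contMDiffOn_metricMatrix hg hφ)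
  intro y hy
  have h2 : ContDiffAt ℝ ∞ (fun t : ℝ => (2 * ((n : ℝ) + 2))⁻¹ * Real.log t)
      (metricMatrix g φ y).det :=
    contDiffAt_const.mul (Real.contDiffAt_log.2 (det_metricMatrix_ne_zero hg hφ hy.1 hy.2))
  have h3 := ContMDiffAt.comp_contMDiffWithinAt y h2.contMDiffAt (h1 y hy)
  exact h3

lemma mdifferentiableAt_logWeight (hg : IsPseudoRiemannianMetric g) (hφ : φ ∈ smoothCharts n M)
    (hx : x ∈ φ.source) (hxi : x ∈ interiorSet n M) :
    MDifferentiableAt (𝓡∂ (n + 1)) 𝓘(ℝ, ℝ) (logWeight g φ) x :=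
  ((contMDiffOn_logWeight hg hφ).contMDiffAt
    ((φ.open_source.inter isOpen_interiorSet).mem_nhds ⟨hx, hxi⟩)).mdifferentiableAt (by simp)

/-- The normalized trace of the Levi-Civita connection is a logarithmic derivative. -/
lemma christoffelTrace_eq_partialDeriv (hg : IsPseudoRiemannianMetric g)
    (hcov : IsLeviCivita g cov) (hφ : φ ∈ smoothCharts n M) (hx : x ∈ φ.source)
    (hxi : x ∈ interiorSet n M) (i : Fin (n + 1)) :
    christoffelTrace cov φ x i / ((n : ℝ) + 2) = partialDeriv φ i (logWeight g φ) x := by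
  rw [christoffelTrace_eq hx, (hcov.isChristoffel_coord hg hφ).normalizedTrace_eq
    (isOpen_chartInterior hφ) (extend_mem_chartInterior hx hxi), partialDeriv_eq_pd hφ hx hxi]
  rfl

lemma inv_tauComponent_eq_exp (hd : (metricMatrix g φ x).det ≠ 0) :
    (tauComponent g φ x)⁻¹ = Real.exp (logWeight g φ x) ^ 2 := by
  rw [inv_tauComponent hd, ← Real.exp_nat_mul, logWeight]
  congr 1
  push_cast
  field_simp

/-- The transition function of `E(1)` is the ratio of the components of a global density. -/
lemma weightOneFactor_eq_exp_sub (hg : IsPseudoRiemannianMetric g) (hφ : φ ∈ smoothCharts n M)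
    (hψ : ψ ∈ smoothCharts n M) (hx : x ∈ φ.source) (hx' : x ∈ ψ.source)
    (hxi : x ∈ interiorSet n M) :
    weightOneFactor φ ψ x = Real.exp (logWeight g φ x - logWeight g ψ x) := by
  have h1 := det_metricMatrix_ne_zero hg hφ hx hxi
  have h2 := det_frameMatrix_ne_zero hφ hψ hx hx'
  rw [weightOneFactor_eq_exp hφ hψ hx hx', logWeight, logWeight,
    metricMatrix_transition hφ hψ hx hx', jacobian_eq_frameMatrix hφ hψ hx hx', Matrix.det_mul,
    Matrix.det_mul, Matrix.det_transpose, Real.log_mul (mul_ne_zero h2 h1) h2,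
    Real.log_mul h2 h1]
  congr 1
  field_simp
  ring

lemma inv_tauComponent_transition (hg : IsPseudoRiemannianMetric g) (hφ : φ ∈ smoothCharts n M)
    (hψ : ψ ∈ smoothCharts n M) (hx : x ∈ φ.source) (hx' : x ∈ ψ.source)
    (hxi : x ∈ interiorSet n M) :
    weightOneFactor φ ψ x ^ 2 * (tauComponent g ψ x)⁻¹ = (tauComponent g φ x)⁻¹ := by
  rw [inv_tauComponent_eq_exp (det_metricMatrix_ne_zero hg hφ hx hxi),
    inv_tauComponent_eq_exp (det_metricMatrix_ne_zero hg hψ hx' hxi),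
    weightOneFactor_eq_exp_sub hg hφ hψ hx hx' hxi, ← mul_pow, ← Real.exp_add, sub_add_cancel]

/-- The transition law of `τ⁻¹ g^{ij}`. -/
lemma metricBivectorDensity_transition (hg : IsPseudoRiemannianMetric g)
    (hφ : φ ∈ smoothCharts n M) (hψ : ψ ∈ smoothCharts n M) (hx : x ∈ φ.source)
    (hx' : x ∈ ψ.source) (hxi : x ∈ interiorSet n M) :
    metricBivectorDensity g φ x = weightOneFactor φ ψ x ^ 2 •
      (frameMatrix φ ψ x * metricBivectorDensity g ψ x * (frameMatrix φ ψ x).transpose) := by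
  have h1 : IsUnit (frameMatrix φ ψ x).det :=
    isUnit_iff_ne_zero.2 (det_frameMatrix_ne_zero hφ hψ hx hx')
  have h2 : IsUnit (frameMatrix φ ψ x).transpose.det := by rwa [Matrix.det_transpose]
  rw [metricBivectorDensity, metricBivectorDensity, metricMatrix_transition hφ hψ hx hx',
    jacobian_eq_frameMatrix hφ hψ hx hx', Matrix.mul_inv_rev, Matrix.mul_inv_rev,
    Matrix.mul_smul, Matrix.smul_mul, smul_smul, inv_tauComponent_transition hg hφ hψ hx hx' hxi,
    Matrix.mul_nonsing_inv_cancel_left _ _ h1, Matrix.mul_assoc, Matrix.nonsing_inv_mul _ h2,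
    Matrix.mul_one]

/-- The bottom slot `τ⁻¹ S / (n (n + 1))` has weight `-2`, since `S` is a function. -/
lemma bottomSlot_transition (hg : IsPseudoRiemannianMetric g) (hcov : IsLeviCivita g cov)
    (hφ : φ ∈ smoothCharts n M) (hψ : ψ ∈ smoothCharts n M) (hx : x ∈ φ.source)
    (hx' : x ∈ ψ.source) (hxi : x ∈ interiorSet n M) :
    bottomSlot cov (metricBivectorDensity g) φ x =
      weightOneFactor φ ψ x ^ 2 * bottomSlot cov (metricBivectorDensity g) ψ x := by
  rw [bottomSlot_metricBivectorDensity hg hcov hφ hx hxi,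
    bottomSlot_metricBivectorDensity hg hcov hψ hx' hxi,
    ← inv_tauComponent_transition hg hφ hψ hx hx' hxi]
  ring

/-- The behaviour of the splittings of two charts under the cotractor transition: the form `γ_i` is
the logarithmic derivative of a volume density. -/
lemma partialDeriv_weightOneFactor (hg : IsPseudoRiemannianMetric g) (hcov : IsLeviCivita g cov)
    (hφ : φ ∈ smoothCharts n M) (hψ : ψ ∈ smoothCharts n M) (hx : x ∈ φ.source)
    (hx' : x ∈ ψ.source) (hxi : x ∈ interiorSet n M) (i : Fin (n + 1)) :
    partialDeriv ψ i (weightOneFactor φ ψ) x = weightOneFactor φ ψ x *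
      (∑ k, frameMatrix φ ψ x k i * (christoffelTrace cov φ x k / ((n : ℝ) + 2)) -
        christoffelTrace cov ψ x i / ((n : ℝ) + 2)) := by
  simp only [christoffelTrace_eq_partialDeriv hg hcov hφ hx hxi,
    christoffelTrace_eq_partialDeriv hg hcov hψ hx' hxi]
  rw [← partialDeriv_eq_sum hφ hψ hx hx' (mdifferentiableAt_logWeight hg hφ hx hxi)]
  have hWo : IsOpen (φ.source ∩ ψ.source ∩ interiorSet n M) :=
    (φ.open_source.inter ψ.open_source).inter isOpen_interiorSet
  have hWψ : φ.source ∩ ψ.source ∩ interiorSet n M ⊆ ψ.source := fun y hy => hy.1.2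
  have hO := isOpen_extend_image hψ hWo hWψ inter_subset_right
  have hxO := mem_image_of_mem (ψ.extend (𝓡∂ (n + 1)))
    (show x ∈ φ.source ∩ ψ.source ∩ interiorSet n M from ⟨⟨hx, hx'⟩, hxi⟩)
  have d1 := differentiableAt_of_contDiffOn hO ((contMDiffOn_iff_contDiffOn_extend hψ hWψ _).1
    ((contMDiffOn_logWeight hg hφ).mono fun y hy => ⟨hy.1.1, hy.2⟩)) hxO
  have d2 := differentiableAt_of_contDiffOn hO ((contMDiffOn_iff_contDiffOn_extend hψ hWψ _).1
    ((contMDiffOn_logWeight hg hψ).mono fun y hy => ⟨hy.1.2, hy.2⟩)) hxO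
  rw [partialDeriv_eq_pd hψ hx' hxi, partialDeriv_eq_pd hψ hx' hxi,
    partialDeriv_eq_pd hψ hx' hxi,
    pd_congr (g := fun p => Real.exp ((logWeight g φ ∘ (ψ.extend (𝓡∂ (n + 1))).symm) p -
      (logWeight g ψ ∘ (ψ.extend (𝓡∂ (n + 1))).symm) p)) hO ?_ i hxO]
  · rw [weightOneFactor_eq_exp_sub hg hφ hψ hx hx' hxi, pd, fderiv_exp (d1.fun_sub d2),
      fderiv_fun_sub d1 d2]
    simp only [Function.comp_apply, ψ.extend_left_inv hx']
    rfl
  · rintro _ ⟨y, ⟨⟨hy, hy'⟩, hyi⟩, rfl⟩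
    simp only [Function.comp_apply, ψ.extend_left_inv hy']
    exact weightOneFactor_eq_exp_sub hg hφ hψ hy hy' hyi

/-- The cotractor transition in terms of functions on the manifold. -/
lemma cotractorTransition_eq (hφ : φ ∈ smoothCharts n M) (hψ : ψ ∈ smoothCharts n M)
    (hx : x ∈ φ.source) (hx' : x ∈ ψ.source) : cotractorTransition φ ψ x =
      Matrix.fromBlocks (Matrix.of fun _ _ => weightOneFactor φ ψ x) 0
        (Matrix.of fun i _ => partialDeriv ψ i (weightOneFactor φ ψ) x)
        (weightOneFactor φ ψ x • (frameMatrix φ ψ x).transpose) := by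
  simp only [cotractorTransition, densityFactor_one_eq hφ hψ hx hx',
    fderivWithin_densityFactor hφ hψ hx hx', jacobian_eq_frameMatrix hφ hψ hx hx']

/-- In the splittings of two charts, the cotractor transition is block diagonal. -/
lemma splittingMatrix_mul_cotractorTransition (hg : IsPseudoRiemannianMetric g)
    (hcov : IsLeviCivita g cov) (hφ : φ ∈ smoothCharts n M) (hψ : ψ ∈ smoothCharts n M)
    (hx : x ∈ φ.source) (hx' : x ∈ ψ.source) (hxi : x ∈ interiorSet n M) :
    (splittingMatrix fun i => christoffelTrace cov ψ x i / ((n : ℝ) + 2)) *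
        cotractorTransition φ ψ x =
      (weightOneFactor φ ψ x • Matrix.fromBlocks 1 0 0 (frameMatrix φ ψ x).transpose) *
        splittingMatrix fun i => christoffelTrace cov φ x i / ((n : ℝ) + 2) := by
  rw [cotractorTransition_eq hφ hψ hx hx', splittingMatrix, splittingMatrix,
    Matrix.fromBlocks_smul, Matrix.fromBlocks_multiply, Matrix.fromBlocks_multiply]
  congr 1
  · ext i j
    simp
  · ext i j
    simp
  · ext i j
    simp only [Matrix.add_apply, Matrix.mul_apply, Matrix.of_apply, Finset.univ_unique,
      Finset.sum_const, Finset.card_singleton, one_smul, Matrix.one_mul, Matrix.smul_apply,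
      Matrix.zero_apply, zero_mul, smul_zero, zero_add, Matrix.transpose_apply, smul_eq_mul,
      partialDeriv_weightOneFactor hg hcov hφ hψ hx hx' hxi]
    rw [mul_sub, Finset.mul_sum]
    simp only [mul_assoc]
    ring
  · ext i j
    simp

/-- The transition law of `L(τ⁻¹ g^{ij})`. -/
lemma splittingOperator_transition (hg : IsPseudoRiemannianMetric g) (hcov : IsLeviCivita g cov)
    (hφ : φ ∈ smoothCharts n M) (hψ : ψ ∈ smoothCharts n M) (hx : x ∈ φ.source)
    (hx' : x ∈ ψ.source) (hxi : x ∈ interiorSet n M) :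
    splittingOperator cov (metricBivectorDensity g) φ x =
      (cotractorTransition φ ψ x).transpose *
        splittingOperator cov (metricBivectorDensity g) ψ x * cotractorTransition φ ψ x := by
  set T := cotractorTransition φ ψ x
  set Bφ := splittingMatrix fun i => christoffelTrace cov φ x i / ((n : ℝ) + 2) with hBφ
  set Bψ := splittingMatrix fun i => christoffelTrace cov ψ x i / ((n : ℝ) + 2) with hBψ
  set D := weightOneFactor φ ψ x • Matrix.fromBlocks (1 : Matrix Unit Unit ℝ) 0 0
    (frameMatrix φ ψ x).transpose with hD
  have h1 : Bψ * T = D * Bφ :=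
    splittingMatrix_mul_cotractorTransition hg hcov hφ hψ hx hx' hxi
  rw [splittingOperator_eq hg hcov hφ hx hxi, splittingOperator_eq hg hcov hψ hx' hxi,
    ← hBφ, ← hBψ]
  set Fψ := diagonalForm (bottomSlot cov (metricBivectorDensity g) ψ x)
    (metricBivectorDensity g ψ x) with hFψ
  have h2 : T.transpose * (Bψ.transpose * Fψ * Bψ) * T = (Bψ * T).transpose * Fψ * (Bψ * T) := by
    rw [Matrix.transpose_mul]
    simp only [Matrix.mul_assoc]
  have h3 : D.transpose * Fψ * D = diagonalForm (bottomSlot cov (metricBivectorDensity g) φ x)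
      (metricBivectorDensity g φ x) := by
    rw [hD, hFψ, diagonalForm, diagonalForm, bottomSlot_transition hg hcov hφ hψ hx hx' hxi,
      metricBivectorDensity_transition hg hφ hψ hx hx' hxi, Matrix.transpose_smul,
      Matrix.fromBlocks_transpose, Matrix.smul_mul, Matrix.smul_mul, Matrix.mul_smul, smul_smul,
      Matrix.fromBlocks_multiply, Matrix.fromBlocks_multiply, Matrix.fromBlocks_smul, ← pow_two]
    congr 1
    · ext i j
      simp
    · simp
    · simp
    · simp
  rw [h2, h1, ← h3, Matrix.transpose_mul]
  simp only [Matrix.mul_assoc]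

end Transition

end ProjectiveTractor

/-! ### Half-balls and regularity at the boundary -/

namespace ProjectiveTractor

open Set Filter Topology

section HalfBalls

variable {n : ℕ} {M : Type*} [TopologicalSpace M] [ChartedSpace (EuclideanHalfSpace (n + 1)) M]
  [IsManifold (𝓡∂ (n + 1)) ∞ M] {φ ψ : Chart n M} {x : M} {K : Set (Model n)}

/-- `K` is a compact convex neighbourhood, in coordinates, of the point `x` of the manifold with
boundary, for instance a half-ball. -/
structure IsConvexCoordNhd (φ : Chart n M) (x : M) (K : Set (Model n)) : Prop where
  isCompact : IsCompact K
  convex : Convex ℝ K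
  nonempty : (interior K).Nonempty
  mem_nhdsWithin : K ∈ 𝓝[range (𝓡∂ (n + 1))] (φ.extend (𝓡∂ (n + 1)) x)
  interior_subset : interior K ⊆ chartInterior φ

/-- Every neighbourhood of a point contains a half-ball. -/
lemma exists_isConvexCoordNhd (hφ : φ ∈ smoothCharts n M) (hx : x ∈ φ.source) {N : Set M}
    (hN : N ∈ 𝓝 x) (hNφ : N ⊆ φ.source) :
    ∃ K, IsConvexCoordNhd φ x K ∧ K ⊆ φ.extend (𝓡∂ (n + 1)) '' N := by
  set e := φ.extend (𝓡∂ (n + 1)) with he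
  have h1 : e '' N ∈ 𝓝[range (𝓡∂ (n + 1))] (e x) := by
    rw [he, ← φ.map_extend_nhds hx]
    exact image_mem_map hN
  obtain ⟨r, hr, hrN⟩ := Metric.mem_nhdsWithin_iff.1 h1
  have hr2 : 0 < r / 2 := by positivity
  set K : Set (Model n) := Metric.closedBall (e x) (r / 2) ∩ range (𝓡∂ (n + 1)) with hK
  have hKN : K ⊆ e '' N := by
    rintro p ⟨hp, hp'⟩
    exact hrN ⟨Metric.closedBall_subset_ball (by linarith) hp, hp'⟩
  refine ⟨K, ⟨(isCompact_closedBall _ _).inter_right (𝓡∂ (n + 1)).isClosed_range,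
    (convex_closedBall _ _).inter (𝓡∂ (n + 1)).convex_range, ?_, ?_, ?_⟩, hKN⟩
  · have h2 : e x ∈ closure (interior (range (𝓡∂ (n + 1)))) :=
      (𝓡∂ (n + 1)).range_subset_closure_interior (mem_range_self _)
    obtain ⟨p, hp, hp'⟩ := mem_closure_iff.1 h2 _ Metric.isOpen_ball (Metric.mem_ball_self hr2)
    refine ⟨p, mem_interior.2 ⟨Metric.ball (e x) (r / 2) ∩ interior (range (𝓡∂ (n + 1))), ?_,
      Metric.isOpen_ball.inter isOpen_interior, hp, hp'⟩⟩
    exact inter_subset_inter Metric.ball_subset_closedBall interior_subset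
  · exact inter_mem (mem_nhdsWithin_of_mem_nhds (Metric.closedBall_mem_nhds _ hr2))
      self_mem_nhdsWithin
  · intro p hp
    obtain ⟨y, hy, rfl⟩ := hKN (interior_subset hp)
    refine ⟨y, ⟨hNφ hy, (mem_interiorSet_iff hφ (hNφ hy)).2 ?_⟩, rfl⟩
    exact interior_mono inter_subset_right hp

/-- Half-balls have interior points, which shows that the interior of the manifold is dense. -/
lemma dense_interiorSet : Dense (interiorSet n M) := by
  intro x
  have hφ := chartAt_mem_smoothCharts (n := n) x
  have hx := mem_chart_source (EuclideanHalfSpace (n + 1)) x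
  rw [mem_closure_iff_nhds]
  intro N hN
  obtain ⟨K, hK, hKN⟩ := exists_isConvexCoordNhd hφ hx
    (inter_mem hN ((chartAt (EuclideanHalfSpace (n + 1)) x).open_source.mem_nhds hx))
    inter_subset_right
  obtain ⟨p, hp⟩ := hK.nonempty
  obtain ⟨y, hy, hyp⟩ := hKN (interior_subset hp)
  obtain ⟨z, hz, hzp⟩ := hK.interior_subset hp
  have hyz : y = z := by
    have := congrArg ((chartAt (EuclideanHalfSpace (n + 1)) x).extend (𝓡∂ (n + 1))).symm
      (hyp.trans hzp.symm)
    rwa [OpenPartialHomeomorph.extend_left_inv _ hy.2,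
      OpenPartialHomeomorph.extend_left_inv _ hz.1] at this
  exact ⟨y, hy.1, hyz ▸ hz.2⟩

/-- Two continuous functions which agree at interior points agree. -/
lemma eq_of_eqOn_interior {f g : M → ℝ} {U : Set M} (hU : IsOpen U) (hf : ContinuousOn f U)
    (hg : ContinuousOn g U) (h : ∀ y ∈ U ∩ interiorSet n M, f y = g y) (hx : x ∈ U) :
    f x = g x := by
  have : (𝓝[interiorSet n M] x).NeBot := mem_closure_iff_nhdsWithin_neBot.1 (dense_interiorSet x)
  have h1 := (hf.continuousAt (hU.mem_nhds hx)).tendsto.mono_left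
    (nhdsWithin_le_nhds (s := interiorSet n M))
  have h2 := (hg.continuousAt (hU.mem_nhds hx)).tendsto.mono_left
    (nhdsWithin_le_nhds (s := interiorSet n M))
  refine tendsto_nhds_unique_of_eventuallyEq h1 h2 ?_
  filter_upwards [mem_nhdsWithin_of_mem_nhds (hU.mem_nhds hx), self_mem_nhdsWithin] with y hy hyi
  exact h y ⟨hy, hyi⟩

variable {f : M → ℝ} {F : Model n → ℝ}

/-- A half-ball around a point is also a neighbourhood of all nearby points, including nearby
boundary points. -/
lemma IsConvexCoordNhd.eventually (hK : IsConvexCoordNhd φ x K) (hx : x ∈ φ.source) :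
    ∀ᶠ y in 𝓝 x, y ∈ φ.source ∧ IsConvexCoordNhd φ y K := by
  have h1 := eventually_eventually_nhdsWithin.2 hK.mem_nhdsWithin
  rw [← φ.map_extend_nhds hx, eventually_map] at h1
  filter_upwards [h1, φ.open_source.mem_nhds hx] with y hy hy'
  exact ⟨hy', hK.isCompact, hK.convex, hK.nonempty, hy, hK.interior_subset⟩

lemma IsConvexCoordNhd.mem (hK : IsConvexCoordNhd φ x K) : φ.extend (𝓡∂ (n + 1)) x ∈ K :=
  mem_of_mem_nhdsWithin (mem_range_self (φ x)) hK.mem_nhdsWithin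

lemma IsConvexCoordNhd.mem_interior (hφ : φ ∈ smoothCharts n M) (hK : IsConvexCoordNhd φ x K)
    (hx : x ∈ φ.source) (hxi : x ∈ interiorSet n M) : φ.extend (𝓡∂ (n + 1)) x ∈ interior K := by
  have h1 := mem_interior_iff_mem_nhds.1 ((mem_interiorSet_iff hφ hx).1 hxi)
  rw [mem_interior_iff_mem_nhds, ← nhdsWithin_eq_nhds.2 h1]
  exact hK.mem_nhdsWithin

lemma IsConvexCoordNhd.continuousAt_comp (hφ : φ ∈ smoothCharts n M)
    (hK : IsConvexCoordNhd φ x K) (hx : x ∈ φ.source) (hF : ContinuousOn F K) :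
    ContinuousAt (F ∘ φ.extend (𝓡∂ (n + 1))) x := by
  have h1 : Tendsto (φ.extend (𝓡∂ (n + 1))) (𝓝 x)
      (𝓝[K] (φ.extend (𝓡∂ (n + 1)) x)) := by
    refine tendsto_nhdsWithin_iff.2 ⟨(contMDiffAt_extend hφ hx).continuousAt, ?_⟩
    filter_upwards [hK.eventually hx] with y hy
    exact hy.2.mem
  exact Tendsto.comp (hF _ hK.mem) h1

/-- A function on the interior which has a continuous extension in coordinates near `x` is extended
by its limit. -/
lemma IsConvexCoordNhd.extendFrom_eq (hφ : φ ∈ smoothCharts n M) (hK : IsConvexCoordNhd φ x K)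
    (hx : x ∈ φ.source) (hF : ContinuousOn F K)
    (hf : ∀ p ∈ interior K, f ((φ.extend (𝓡∂ (n + 1))).symm p) = F p) :
    extendFrom (interiorSet n M) f x = F (φ.extend (𝓡∂ (n + 1)) x) := by
  refine _root_.extendFrom_eq (dense_interiorSet x) ?_
  refine ((hK.continuousAt_comp hφ hx hF).tendsto.mono_left nhdsWithin_le_nhds).congr' ?_
  filter_upwards [mem_nhdsWithin_of_mem_nhds (hK.eventually hx), self_mem_nhdsWithin] with y hy hyi
  rw [Function.comp_apply, ← hf _ (hy.2.mem_interior hφ hy.1 hyi), φ.extend_left_inv hy.1]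

lemma IsConvexCoordNhd.eventually_extendFrom_eq (hφ : φ ∈ smoothCharts n M)
    (hK : IsConvexCoordNhd φ x K) (hx : x ∈ φ.source) (hF : ContinuousOn F K)
    (hf : ∀ p ∈ interior K, f ((φ.extend (𝓡∂ (n + 1))).symm p) = F p) :
    ∀ᶠ y in 𝓝 x, extendFrom (interiorSet n M) f y = F (φ.extend (𝓡∂ (n + 1)) y) := by
  filter_upwards [hK.eventually hx] with y hy
  exact hy.2.extendFrom_eq hφ hy.1 hF hf

lemma IsConvexCoordNhd.extendFrom_eq_self (hφ : φ ∈ smoothCharts n M)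
    (hK : IsConvexCoordNhd φ x K) (hx : x ∈ φ.source) (hxi : x ∈ interiorSet n M)
    (hF : ContinuousOn F K)
    (hf : ∀ p ∈ interior K, f ((φ.extend (𝓡∂ (n + 1))).symm p) = F p) :
    extendFrom (interiorSet n M) f x = f x := by
  rw [hK.extendFrom_eq hφ hx hF hf, ← hf _ (hK.mem_interior hφ hx hxi), φ.extend_left_inv hx]

/-- Extension by limits produces a smooth function when there are local smooth extensions. -/
lemma IsConvexCoordNhd.contMDiffAt_extendFrom (hφ : φ ∈ smoothCharts n M)
    (hK : IsConvexCoordNhd φ x K) (hx : x ∈ φ.source) (hF : ContDiffOn ℝ ∞ F K)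
    (hf : ∀ p ∈ interior K, f ((φ.extend (𝓡∂ (n + 1))).symm p) = F p) :
    ContMDiffAt (𝓡∂ (n + 1)) 𝓘(ℝ, ℝ) ∞ (extendFrom (interiorSet n M) f) x := by
  have h1 : ContMDiffAt (𝓡∂ (n + 1)) 𝓘(ℝ, ℝ) ∞ (F ∘ φ.extend (𝓡∂ (n + 1))) x := by
    have h2 : φ.extend (𝓡∂ (n + 1)) ⁻¹' K ∈ 𝓝 x := by
      filter_upwards [hK.eventually hx] with y hy
      exact hy.2.mem
    exact ((hF _ hK.mem).contMDiffWithinAt.comp x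
      (contMDiffAt_extend hφ hx).contMDiffWithinAt (fun y hy => hy)).contMDiffAt h2
  exact h1.congr_of_eventuallyEq (hK.eventually_extendFrom_eq hφ hx hF.continuousOn hf)

end HalfBalls

section BoundaryRegularity

variable {n : ℕ} {M : Type*} [TopologicalSpace M] [ChartedSpace (EuclideanHalfSpace (n + 1)) M]
  [IsManifold (𝓡∂ (n + 1)) ∞ M] {φ ψ : Chart n M} {x : M}
  {cov : ((x : M) → TangentSpace (𝓡∂ (n + 1)) x) →
  ((x : M) → TangentSpace (𝓡∂ (n + 1)) x →L[ℝ] TangentSpace (𝓡∂ (n + 1)) x)}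
  {g : (x : M) → TangentSpace (𝓡∂ (n + 1)) x →L[ℝ] TangentSpace (𝓡∂ (n + 1)) x →L[ℝ] ℝ}

/-- The Thomas symbols of the Levi-Civita connection are smooth up to the boundary: they only depend
on the projective class, which contains connections smooth up to the boundary. -/
theorem exists_contDiffOn_thomas [T2Space M] (hg : IsPseudoRiemannianMetric g)
    (hcov : IsLeviCivita g cov) (hext : ProjectiveStructureExtends cov)
    (hφ : φ ∈ smoothCharts n M) (hx : x ∈ φ.source) :
    ∃ K, IsConvexCoordNhd φ x K ∧ ∃ P : Fin (n + 1) → Fin (n + 1) → Fin (n + 1) → Model n → ℝ,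
      (∀ k i j, ContDiffOn ℝ ∞ (P k i j) K) ∧
      ∀ p ∈ interior K, ∀ k i j, thomas (coordChristoffel cov φ) p k i j = P k i j p := by
  by_cases hxi : x ∈ interiorSet n M
  -- at interior points the connection itself is smooth
  · obtain ⟨K, hK, hKN⟩ := exists_isConvexCoordNhd hφ hx
      ((φ.open_source.inter isOpen_interiorSet).mem_nhds ⟨hx, hxi⟩) inter_subset_left
    exact ⟨K, hK, fun k i j p => thomas (coordChristoffel cov φ) p k i j, fun k i j =>
      ((hcov.isChristoffel_coord hg hφ).contDiffOn_thomas (isOpen_chartInterior hφ) k i j).mono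
        hKN, fun _ _ _ _ _ => rfl⟩
  have hxb : x ∈ (𝓡∂ (n + 1)).boundary M := by
    rw [← ModelWithCorners.compl_interior]
    exact hxi
  obtain ⟨U, hU, hxU, Υ, -, hζ⟩ := hext x hxb
  -- a cutoff function makes the coordinate fields of `φ` into vector fields on `U`
  obtain ⟨χ, hχ, -⟩ := (SmoothBumpFunction.nhds_basis_support (I := 𝓡∂ (n + 1))
    ((φ.open_source.inter hU).mem_nhds ⟨hx, hxU⟩)).mem_iff.1
      ((φ.open_source.inter hU).mem_nhds ⟨hx, hxU⟩)
  have hX : ∀ i, SmoothField (fun y => χ y • coordField φ i y) U := by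
    intro i y hy
    by_cases hyφ : y ∈ φ.source
    · exact (χ.contMDiff.contMDiffAt.smul_section
        (contMDiffAt_coordField hφ hyφ i)).contMDiffWithinAt
    · have h0 : ∀ᶠ z in 𝓝 y, χ z = 0 := by
        have : y ∈ (tsupport χ)ᶜ := fun h => hyφ (hχ h).1
        filter_upwards [(isClosed_tsupport χ).isOpen_compl.mem_nhds this] with z hz
        exact image_eq_zero_of_notMem_tsupport hz
      have h1 : ContMDiffAt (𝓡∂ (n + 1)) ((𝓡∂ (n + 1)).prod 𝓘(ℝ, Model n)) ∞
          (fun z => Bundle.TotalSpace.mk' (Model n) z (0 : TangentSpace (𝓡∂ (n + 1)) z)) y :=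
        (Bundle.contMDiff_zeroSection ℝ (TangentSpace (𝓡∂ (n + 1)) (M := M))).contMDiffAt
      refine (h1.congr_of_eventuallyEq ?_).contMDiffWithinAt
      filter_upwards [h0] with z hz
      simp only [hz, zero_smul]
  choose ζ hζs hζe using fun i j => hζ _ _ (hX i) (hX j)
  obtain ⟨N, hN1, hNo, hxN⟩ := eventually_nhds_iff.1 (χ.eventuallyEq_one)
  set V : Set M := N ∩ (φ.source ∩ U) with hV
  have hVo : IsOpen V := hNo.inter (φ.open_source.inter hU)
  have hVφ : V ⊆ φ.source := fun y hy => hy.2.1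
  obtain ⟨K, hK, hKV⟩ := exists_isConvexCoordNhd hφ hx (hVo.mem_nhds ⟨hxN, hx, hxU⟩) hVφ
  -- the coefficients of the extended connection, which differ from those of `cov` by `Υ`
  let Γ' : Model n → Fin (n + 1) → Fin (n + 1) → Fin (n + 1) → ℝ := fun p k i j =>
    coordComp φ (ζ i j) k p
  refine ⟨K, hK, fun k i j p => thomas Γ' p k i j, contDiffOn_thomas fun k i j => ?_, ?_⟩
  · refine ((contMDiffOn_iff_contDiffOn_extend hφ hVφ
      (fun y => coordForm φ k y (ζ i j y))).1 fun y hy => ?_).mono hKV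
    exact (contMDiffWithinAt_coordForm hφ (hVφ hy) (hζs i j y hy.2.2) k).mono fun z hz => hz.2.2
  · intro p hp k i j
    obtain ⟨y, hy, rfl⟩ := hKV (interior_subset hp)
    have hyi : y ∈ interiorSet n M := by
      obtain ⟨z, hz, hzy⟩ := hK.interior_subset hp
      have := congrArg (φ.extend (𝓡∂ (n + 1))).symm hzy
      rw [φ.extend_left_inv hz.1, φ.extend_left_inv (hVφ hy)] at this
      exact this ▸ hz.2
    refine (thomas_eq_of_projectively_equivalent (υ := fun i => Υ y (coordField φ i y))
      (fun k i j => ?_) k i j).symm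
    have h1 : ∀ z ∈ V, ∀ i, χ z • coordField φ i z = coordField φ i z := fun z hz i => by
      have : χ z = 1 := hN1 z hz.1
      rw [this, one_smul]
    have h2 : cov (fun z => χ z • coordField φ j z) y = cov (coordField φ j) y :=
      hcov.isCovariantDerivative.congr_of_eventuallyEq
        ((hX j).contMDiffAt (hU.mem_nhds hy.2.2) |>.mdifferentiableAt (by simp))
        (mdifferentiableAt_coordField hφ (hVφ hy) j) (isOpen_interiorSet.mem_nhds hyi)
        (eventually_of_mem (hVo.mem_nhds hy) fun z hz => h1 z hz j)
    change coordComp φ (ζ i j) k _ = _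
    rw [coordComp_extend (hVφ hy), hζe i j y ⟨hy.2.2, hyi⟩, h2, h1 y hy, h1 y hy, coordForm_add,
      coordForm_add, coordForm_smul, coordForm_smul, coordForm_coordField hφ (hVφ hy),
      coordForm_coordField hφ (hVφ hy), coordChristoffel_extend (hVφ hy), christoffel]
    simp only [mul_ite, mul_one, mul_zero]

/-- The projection of `L(τ⁻¹ g^{ij})` is `τ⁻¹ g^{ij}`. -/
lemma splittingOperator_inr_inr (hg : IsPseudoRiemannianMetric g)
    (hcov : IsLeviCivita g cov) (hφ : φ ∈ smoothCharts n M) (hx : x ∈ φ.source)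
    (hxi : x ∈ interiorSet n M) (i j : Fin (n + 1)) :
    splittingOperator cov (metricBivectorDensity g) φ x (Sum.inr i) (Sum.inr j) =
      metricBivectorDensity g φ x i j := by
  rw [splittingOperator_eq hg hcov hφ hx hxi, splittingMatrix_conj]
  rfl

lemma metricBivectorDensity_symm (hg : IsPseudoRiemannianMetric g) (φ : Chart n M)
    (hxi : x ∈ interiorSet n M) : (metricBivectorDensity g φ x).IsSymm := by
  have h1 : (metricMatrix g φ x).IsSymm := Matrix.IsSymm.ext fun i j => hg.symm x hxi _ _
  rw [Matrix.IsSymm, metricBivectorDensity, Matrix.transpose_smul, Matrix.transpose_nonsing_inv,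
    h1.eq]

lemma splittingOperator_symm (hg : IsPseudoRiemannianMetric g)
    (hcov : IsLeviCivita g cov) (hφ : φ ∈ smoothCharts n M) (hx : x ∈ φ.source)
    (hxi : x ∈ interiorSet n M) :
    (splittingOperator cov (metricBivectorDensity g) φ x).IsSymm := by
  rw [splittingOperator_eq hg hcov hφ hx hxi, Matrix.IsSymm, Matrix.transpose_mul,
    Matrix.transpose_mul, Matrix.transpose_transpose, diagonalForm, Matrix.fromBlocks_transpose,
    (metricBivectorDensity_symm hg φ hxi).eq, Matrix.mul_assoc]
  rfl

/-- The entries of `L(τ⁻¹ g^{ij})` in the jet coordinates of a chart extend smoothly to the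
boundary in coordinates. -/
theorem exists_contDiffOn_splittingOperator [T2Space M] (hn : 1 ≤ n)
    (hg : IsPseudoRiemannianMetric g) (hcov : IsLeviCivita g cov)
    (hext : ProjectiveStructureExtends cov) (hφ : φ ∈ smoothCharts n M) (hx : x ∈ φ.source) :
    ∃ K, IsConvexCoordNhd φ x K ∧ ∃ H : Unit ⊕ Fin (n + 1) → Unit ⊕ Fin (n + 1) → Model n → ℝ,
      (∀ a b, ContDiffOn ℝ ∞ (H a b) K) ∧ ∀ p ∈ interior K, ∀ a b,
        splittingOperator cov (metricBivectorDensity g) φ ((φ.extend (𝓡∂ (n + 1))).symm p) a b =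
          H a b p := by
  obtain ⟨K, hK, P, hP, hPe⟩ := exists_contDiffOn_thomas hg hcov hext hφ hx
  have hC : IsChristoffel (interior K) (coordMetric g φ) (coordChristoffel cov φ) := by
    have h := hcov.isChristoffel_coord hg hφ
    have hs := hK.interior_subset
    exact ⟨fun i j => (h.smooth i j).mono hs, fun p hp => h.isSymm p (hs hp),
      fun p hp => h.det_ne_zero p (hs hp), fun p hp => h.torsion_free p (hs hp),
      fun p hp => h.metric p (hs hp)⟩
  obtain ⟨h1, h2, f, hf, hfe⟩ := hC.exists_contDiffOn_extension hn hK.isCompact hK.convex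
    hK.nonempty hP hPe
  choose s hs hse using h1
  choose m hm hme using h2
  refine ⟨K, hK, fun a b p => Matrix.fromBlocks (Matrix.of fun _ _ => f p)
    (Matrix.of fun _ j => m j p) (Matrix.of fun i _ => m i p) (Matrix.of fun i j => s i j p) a b,
    ?_, ?_⟩
  · rintro (_ | i) (_ | j)
    exacts [hf, hm j, hm i, hs i j]
  · intro p hp
    obtain ⟨y, ⟨hy, hyi⟩, rfl⟩ := hK.interior_subset hp
    rw [φ.extend_left_inv hy]
    have e1 : ∀ i j, metricBivectorDensity g φ y i j = s i j (φ.extend (𝓡∂ (n + 1)) y) :=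
      fun i j => (metricBivectorDensity_eq hg hφ hy hyi i j).trans (hse i j _ hp)
    have e2 : ∀ j, ∑ l, christoffelTrace cov φ y l / ((n : ℝ) + 2) *
        metricBivectorDensity g φ y l j = m j (φ.extend (𝓡∂ (n + 1)) y) := by
      intro j
      rw [← hme j _ hp, traceContraction]
      simp only [christoffelTrace_eq hy, metricBivectorDensity_eq hg hφ hy hyi]
    have e3 : ∀ j, ∑ l, metricBivectorDensity g φ y j l *
        (christoffelTrace cov φ y l / ((n : ℝ) + 2)) = m j (φ.extend (𝓡∂ (n + 1)) y) := by
      intro j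
      rw [← e2 j]
      exact Finset.sum_congr rfl fun l _ => by
        rw [mul_comm, (metricBivectorDensity_symm hg φ hyi).apply]
    have e4 : bottomSlot cov (metricBivectorDensity g) φ y +
        ∑ k, m k (φ.extend (𝓡∂ (n + 1)) y) * (christoffelTrace cov φ y k / ((n : ℝ) + 2)) =
        f (φ.extend (𝓡∂ (n + 1)) y) := by
      rw [← hfe _ hp, bottomSlot, divVectorDensity_middleSlot hg hcov hφ hy hyi, sub_zero]
      simp only [schouten, ricci_eq_ricciCoord hg hcov hφ hy hyi,
        metricBivectorDensity_eq hg hφ hy hyi, christoffelTrace_eq hy, ← hme _ _ hp]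
      exact congrArg _ (Finset.sum_congr rfl fun k _ => mul_comm _ _)
    intro a b
    rw [splittingOperator_eq hg hcov hφ hy hyi, splittingMatrix_conj]
    rcases a with a | i <;> rcases b with b | j
    · simp only [e2, e4, Matrix.fromBlocks_apply₁₁, Matrix.of_apply]
    · simp only [e2, Matrix.fromBlocks_apply₁₂, Matrix.of_apply]
    · simp only [e3, Matrix.fromBlocks_apply₂₁, Matrix.of_apply]
    · simp only [e1, Matrix.fromBlocks_apply₂₂, Matrix.of_apply]

end BoundaryRegularity

end ProjectiveTractor

/-! ### The extended sections -/

namespace ProjectiveTractor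

open Set Filter Topology

section GlobalExtension

variable {n : ℕ} {M : Type*} [TopologicalSpace M] [ChartedSpace (EuclideanHalfSpace (n + 1)) M]
  [IsManifold (𝓡∂ (n + 1)) ∞ M] {φ ψ : Chart n M} {x : M}
  {cov : ((x : M) → TangentSpace (𝓡∂ (n + 1)) x) →
  ((x : M) → TangentSpace (𝓡∂ (n + 1)) x →L[ℝ] TangentSpace (𝓡∂ (n + 1)) x)}
  {g : (x : M) → TangentSpace (𝓡∂ (n + 1)) x →L[ℝ] TangentSpace (𝓡∂ (n + 1)) x →L[ℝ] ℝ}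

/-- Partial derivatives of a smooth function are continuous up to the boundary. -/
lemma continuousOn_partialDeriv (hφ : φ ∈ smoothCharts n M) {U : Set M} (hU : IsOpen U)
    (hUφ : U ⊆ φ.source) {f : M → ℝ} (hf : ContMDiffOn (𝓡∂ (n + 1)) 𝓘(ℝ, ℝ) ∞ f U)
    (i : Fin (n + 1)) : ContinuousOn (partialDeriv φ i f) U := by
  intro x hx
  have hfx : ∀ y ∈ U, ContMDiffAt (𝓡∂ (n + 1)) 𝓘(ℝ, ℝ) ∞ f y := fun y hy =>
    hf.contMDiffAt (hU.mem_nhds hy)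
  have h1 := ContMDiffAt.clm_apply_of_inCoordinates (n := ∞) (IM := 𝓡∂ (n + 1))
    (IB₁ := 𝓡∂ (n + 1)) (IB₂ := 𝓘(ℝ, ℝ)) (b₁ := fun y : M => y) (b₂ := f)
    (ϕ := fun y => mfderiv (𝓡∂ (n + 1)) 𝓘(ℝ, ℝ) f y) (v := coordField φ i)
    (m₀ := x) ((hfx x hx).mfderiv_const (m := ∞) (by simp)) (contMDiffAt_coordField hφ (hUφ hx) i)
    (hfx x hx)
  have h2 : ContMDiffAt (𝓡∂ (n + 1)) 𝓘(ℝ, ℝ) ∞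
      (fun y => (mfderiv (𝓡∂ (n + 1)) 𝓘(ℝ, ℝ) f y (coordField φ i y) : ℝ)) x :=
    (contMDiff_snd_tangentBundle_modelSpace ℝ 𝓘(ℝ, ℝ)).contMDiffAt.comp x h1
  refine (h2.continuousAt.congr ?_).continuousWithinAt
  filter_upwards [hU.mem_nhds hx] with y hy
  exact mfderiv_coordField hφ (hUφ hy) ((hfx y hy).mdifferentiableAt (by simp)) i

lemma continuousOn_cotractorTransition (hφ : φ ∈ smoothCharts n M) (hψ : ψ ∈ smoothCharts n M)
    (a b : Unit ⊕ Fin (n + 1)) :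
    ContinuousOn (fun y => cotractorTransition φ ψ y a b) (φ.source ∩ ψ.source) := by
  have h1 := contMDiffOn_weightOneFactor hφ hψ
  have h2 : ContinuousOn (fun y => Matrix.fromBlocks (Matrix.of fun _ _ => weightOneFactor φ ψ y) 0
      (Matrix.of fun i _ => partialDeriv ψ i (weightOneFactor φ ψ) y)
      (weightOneFactor φ ψ y • (frameMatrix φ ψ y).transpose) a b) (φ.source ∩ ψ.source) := by
    rcases a with a | i <;> rcases b with b | j
    · exact h1.continuousOn
    · exact continuousOn_const
    · exact continuousOn_partialDeriv hψ (φ.open_source.inter ψ.open_source) inter_subset_right h1 i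
    · exact h1.continuousOn.mul (contMDiffOn_frameMatrix hφ hψ j i).continuousOn
  exact h2.congr fun y hy => by rw [cotractorTransition_eq hφ hψ hy.1 hy.2]

/-- The extension by limits of `τ⁻¹ g^{ij}` to the boundary. -/
noncomputable def extendedBivector
    (g : (x : M) → TangentSpace (𝓡∂ (n + 1)) x →L[ℝ] TangentSpace (𝓡∂ (n + 1)) x →L[ℝ] ℝ)
    (φ : Chart n M) (x : M) : Matrix (Fin (n + 1)) (Fin (n + 1)) ℝ :=
  Matrix.of fun i j => extendFrom (interiorSet n M) (fun y => metricBivectorDensity g φ y i j) x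

/-- The extension by limits of `L(τ⁻¹ g^{ij})` to the boundary. -/
noncomputable def extendedTractorForm (cov : ((x : M) → TangentSpace (𝓡∂ (n + 1)) x) →
    ((x : M) → TangentSpace (𝓡∂ (n + 1)) x →L[ℝ] TangentSpace (𝓡∂ (n + 1)) x))
    (g : (x : M) → TangentSpace (𝓡∂ (n + 1)) x →L[ℝ] TangentSpace (𝓡∂ (n + 1)) x →L[ℝ] ℝ)
    (φ : Chart n M) (x : M) : Matrix (Unit ⊕ Fin (n + 1)) (Unit ⊕ Fin (n + 1)) ℝ :=
  Matrix.of fun a b => extendFrom (interiorSet n M)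
    (fun y => splittingOperator cov (metricBivectorDensity g) φ y a b) x

/-- The sign of the determinant of the metric. -/
noncomputable def metricSign
    (g : (x : M) → TangentSpace (𝓡∂ (n + 1)) x →L[ℝ] TangentSpace (𝓡∂ (n + 1)) x →L[ℝ] ℝ)
    (x : M) : ℝ :=
  SignType.sign (metricMatrix g (chartAt (EuclideanHalfSpace (n + 1)) x) x).det

/-- The sign of the determinant is computed by any chart: a change of coordinates multiplies the
determinant by a square. -/
lemma metricSign_eq (hφ : φ ∈ smoothCharts n M) (hx : x ∈ φ.source) :
    metricSign g x = SignType.sign (metricMatrix g φ x).det := by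
  have hψ := chartAt_mem_smoothCharts (n := n) x
  have hx' := mem_chart_source (EuclideanHalfSpace (n + 1)) x
  rw [metricSign, metricMatrix_transition hφ hψ hx hx', Matrix.det_mul, Matrix.det_mul,
    Matrix.det_transpose, mul_right_comm, sign_mul,
    sign_pos (mul_self_pos.2 (det_jacobian_ne_zero hφ hψ hx hx')), one_mul]

/-- The sign of the determinant is constant on the interior of a half-ball, which is connected. -/
lemma IsConvexCoordNhd.exists_metricSign_eq (hg : IsPseudoRiemannianMetric g)
    (hφ : φ ∈ smoothCharts n M) {K : Set (Model n)} (hK : IsConvexCoordNhd φ x K) :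
    ∃ c : ℝ, (c = 1 ∨ c = -1) ∧
      ∀ p ∈ interior K, metricSign g ((φ.extend (𝓡∂ (n + 1))).symm p) = c := by
  have h0 : ∀ p ∈ interior K, metricSign g ((φ.extend (𝓡∂ (n + 1))).symm p) =
      SignType.sign (coordMetric g φ p).det ∧ (coordMetric g φ p).det ≠ 0 := by
    intro p hp
    obtain ⟨y, ⟨hy, hyi⟩, rfl⟩ := hK.interior_subset hp
    rw [φ.extend_left_inv hy, coordMetric_extend hy]
    exact ⟨metricSign_eq hφ hy, det_metricMatrix_ne_zero hg hφ hy hyi⟩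
  have h1 : ContinuousOn (fun p => (coordMetric g φ p).det) (interior K) := by
    refine (contDiffOn_det (s := chartInterior φ) fun i j => ?_).continuousOn.mono
      hK.interior_subset
    exact (contMDiffOn_iff_contDiffOn_extend hφ inter_subset_left _).1
      (contMDiffOn_metricMatrix hg hφ i j)
  have h2 : ContinuousOn (fun p => SignType.sign (coordMetric g φ p).det) (interior K) :=
    fun p hp => ContinuousAt.comp_continuousWithinAt
      (continuousAt_sign_of_ne_zero (h0 p hp).2) (h1 p hp)
  obtain ⟨q, hq⟩ := hK.nonempty
  refine ⟨SignType.sign (coordMetric g φ q).det, ?_, fun p hp => ?_⟩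
  · rcases lt_or_gt_of_ne (h0 q hq).2 with h | h
    · right; simp [sign_neg h]
    · left; simp [sign_pos h]
  · rw [(h0 p hp).1, hK.convex.interior.isPreconnected.constant h2 hp hq]

variable [T2Space M]

lemma contMDiffAt_extendedTractorForm (hn : 1 ≤ n) (hg : IsPseudoRiemannianMetric g)
    (hcov : IsLeviCivita g cov) (hext : ProjectiveStructureExtends cov)
    (hφ : φ ∈ smoothCharts n M) (hx : x ∈ φ.source) (a b : Unit ⊕ Fin (n + 1)) :
    ContMDiffAt (𝓡∂ (n + 1)) 𝓘(ℝ, ℝ) ∞ (fun y => extendedTractorForm cov g φ y a b) x := by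
  obtain ⟨K, hK, H, hH, hHe⟩ := exists_contDiffOn_splittingOperator hn hg hcov hext hφ hx
  exact hK.contMDiffAt_extendFrom hφ hx (hH a b) fun p hp => hHe p hp a b

lemma contMDiffOn_extendedTractorForm (hn : 1 ≤ n) (hg : IsPseudoRiemannianMetric g)
    (hcov : IsLeviCivita g cov) (hext : ProjectiveStructureExtends cov)
    (hφ : φ ∈ smoothCharts n M) (a b : Unit ⊕ Fin (n + 1)) : ContMDiffOn (𝓡∂ (n + 1)) 𝓘(ℝ, ℝ) ∞
      (fun y => extendedTractorForm cov g φ y a b) φ.source := fun _ hx =>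
  (contMDiffAt_extendedTractorForm hn hg hcov hext hφ hx a b).contMDiffWithinAt

lemma extendedTractorForm_eq (hn : 1 ≤ n) (hg : IsPseudoRiemannianMetric g)
    (hcov : IsLeviCivita g cov) (hext : ProjectiveStructureExtends cov)
    (hφ : φ ∈ smoothCharts n M) (hx : x ∈ φ.source) (hxi : x ∈ interiorSet n M) :
    extendedTractorForm cov g φ x = splittingOperator cov (metricBivectorDensity g) φ x := by
  obtain ⟨K, hK, H, hH, hHe⟩ := exists_contDiffOn_splittingOperator hn hg hcov hext hφ hx
  ext a b
  exact hK.extendFrom_eq_self hφ hx hxi (hH a b).continuousOn fun p hp => hHe p hp a b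

/-- The projection of the extended tractor form is the extension of `τ⁻¹ g^{ij}`: both are limits of
the same functions. -/
lemma extendedTractorForm_inr_inr (hn : 1 ≤ n) (hg : IsPseudoRiemannianMetric g)
    (hcov : IsLeviCivita g cov) (hext : ProjectiveStructureExtends cov)
    (hφ : φ ∈ smoothCharts n M) (hx : x ∈ φ.source) (i j : Fin (n + 1)) :
    extendedTractorForm cov g φ x (Sum.inr i) (Sum.inr j) = extendedBivector g φ x i j := by
  obtain ⟨K, hK, H, hH, hHe⟩ := exists_contDiffOn_splittingOperator hn hg hcov hext hφ hx
  refine (hK.extendFrom_eq hφ hx (hH (Sum.inr i) (Sum.inr j)).continuousOn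
    fun p hp => hHe p hp _ _).trans (hK.extendFrom_eq hφ hx (hH (Sum.inr i) (Sum.inr j)).continuousOn
    fun p hp => ?_).symm
  rw [← hHe p hp]
  obtain ⟨y, ⟨hy, hyi⟩, rfl⟩ := hK.interior_subset hp
  rw [φ.extend_left_inv hy, splittingOperator_inr_inr hg hcov hφ hy hyi]

lemma extendedBivector_eq (hn : 1 ≤ n) (hg : IsPseudoRiemannianMetric g)
    (hcov : IsLeviCivita g cov) (hext : ProjectiveStructureExtends cov)
    (hφ : φ ∈ smoothCharts n M) (hx : x ∈ φ.source) (hxi : x ∈ interiorSet n M) :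
    extendedBivector g φ x = metricBivectorDensity g φ x := by
  ext i j
  rw [← extendedTractorForm_inr_inr hn hg hcov hext hφ hx,
    extendedTractorForm_eq hn hg hcov hext hφ hx hxi, splittingOperator_inr_inr hg hcov hφ hx hxi]

lemma contMDiffOn_extendedBivector (hn : 1 ≤ n) (hg : IsPseudoRiemannianMetric g)
    (hcov : IsLeviCivita g cov) (hext : ProjectiveStructureExtends cov)
    (hφ : φ ∈ smoothCharts n M) (i j : Fin (n + 1)) : ContMDiffOn (𝓡∂ (n + 1)) 𝓘(ℝ, ℝ) ∞
      (fun y => extendedBivector g φ y i j) φ.source :=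
  (contMDiffOn_extendedTractorForm hn hg hcov hext hφ (Sum.inr i) (Sum.inr j)).congr fun _ hy =>
    (extendedTractorForm_inr_inr hn hg hcov hext hφ hy i j).symm

theorem isSmoothTractorForm_extendedTractorForm (hn : 1 ≤ n) (hg : IsPseudoRiemannianMetric g)
    (hcov : IsLeviCivita g cov) (hext : ProjectiveStructureExtends cov) :
    IsSmoothTractorForm (extendedTractorForm cov g) (univ : Set M) where
  symm φ hφ x hx := by
    refine Matrix.IsSymm.ext fun a b => ?_
    exact eq_of_eqOn_interior (n := n) (f := fun y => extendedTractorForm cov g φ y b a)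
      (g := fun y => extendedTractorForm cov g φ y a b) φ.open_source
      (contMDiffOn_extendedTractorForm hn hg hcov hext hφ b a).continuousOn
      (contMDiffOn_extendedTractorForm hn hg hcov hext hφ a b).continuousOn
      (fun y hy => by
        rw [extendedTractorForm_eq hn hg hcov hext hφ hy.1 hy.2]
        exact (splittingOperator_symm hg hcov hφ hy.1 hy.2).apply a b) hx.1
  transition φ hφ ψ hψ x hx := by
    ext a b
    refine eq_of_eqOn_interior (n := n) (f := fun y => extendedTractorForm cov g φ y a b)
      (g := fun y => ((cotractorTransition φ ψ y).transpose * extendedTractorForm cov g ψ y *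
        cotractorTransition φ ψ y) a b) (φ.open_source.inter ψ.open_source)
      ((contMDiffOn_extendedTractorForm hn hg hcov hext hφ a b).continuousOn.mono
        inter_subset_left) ?_ (fun y hy => ?_) hx.1
    · simp only [Matrix.mul_apply, Matrix.transpose_apply]
      refine continuousOn_finsetSum _ fun c _ => ContinuousOn.mul
        (continuousOn_finsetSum _ fun d _ => ContinuousOn.mul ?_ ?_) ?_
      · exact continuousOn_cotractorTransition hφ hψ d a
      · exact (contMDiffOn_extendedTractorForm hn hg hcov hext hψ d c).continuousOn.mono
          inter_subset_right
      · exact continuousOn_cotractorTransition hφ hψ c b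
    · rw [extendedTractorForm_eq hn hg hcov hext hφ hy.1.1 hy.2,
        extendedTractorForm_eq hn hg hcov hext hψ hy.1.2 hy.2,
        ← splittingOperator_transition hg hcov hφ hψ hy.1.1 hy.1.2 hy.2]
  smooth φ hφ a b :=
    (contMDiffOn_extendedTractorForm hn hg hcov hext hφ a b).mono inter_subset_left

theorem isSmoothBivectorDensity_extendedBivector (hn : 1 ≤ n) (hg : IsPseudoRiemannianMetric g)
    (hcov : IsLeviCivita g cov) (hext : ProjectiveStructureExtends cov) :
    IsSmoothBivectorDensity (extendedBivector g) (univ : Set M) where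
  symm φ hφ x hx := by
    refine Matrix.IsSymm.ext fun i j => ?_
    exact eq_of_eqOn_interior (n := n) (f := fun y => extendedBivector g φ y j i)
      (g := fun y => extendedBivector g φ y i j) φ.open_source
      (contMDiffOn_extendedBivector hn hg hcov hext hφ j i).continuousOn
      (contMDiffOn_extendedBivector hn hg hcov hext hφ i j).continuousOn
      (fun y hy => by
        rw [extendedBivector_eq hn hg hcov hext hφ hy.1 hy.2]
        exact (metricBivectorDensity_symm hg φ hy.2).apply i j) hx.1
  transition φ hφ ψ hψ x hx k l := by
    have hc : weightOneFactor φ ψ x ^ 2 ≠ 0 :=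
      (pow_pos (weightOneFactor_pos hφ hψ hx.1.1 hx.1.2) 2).ne'
    have h1 : extendedBivector g φ x k l = weightOneFactor φ ψ x ^ 2 *
        ∑ i, ∑ j, frameMatrix φ ψ x k i * frameMatrix φ ψ x l j * extendedBivector g ψ x i j := by
      refine eq_of_eqOn_interior (n := n)
        (f := fun y => extendedBivector g φ y k l)
        (g := fun y => weightOneFactor φ ψ y ^ 2 *
          ∑ i, ∑ j, frameMatrix φ ψ y k i * frameMatrix φ ψ y l j * extendedBivector g ψ y i j)
        (φ.open_source.inter ψ.open_source)
        ((contMDiffOn_extendedBivector hn hg hcov hext hφ k l).continuousOn.mono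
          inter_subset_left) ?_ (fun y hy => ?_) hx.1
      · refine ((contMDiffOn_weightOneFactor hφ hψ).continuousOn.pow 2).mul
          (continuousOn_finsetSum _ fun i _ => continuousOn_finsetSum _ fun j _ => ?_)
        exact ((contMDiffOn_frameMatrix hφ hψ k i).continuousOn.mul
          (contMDiffOn_frameMatrix hφ hψ l j).continuousOn).mul
          ((contMDiffOn_extendedBivector hn hg hcov hext hψ i j).continuousOn.mono
            inter_subset_right)
      · rw [extendedBivector_eq hn hg hcov hext hφ hy.1.1 hy.2,
          extendedBivector_eq hn hg hcov hext hψ hy.1.2 hy.2,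
          metricBivectorDensity_transition hg hφ hψ hy.1.1 hy.1.2 hy.2, Matrix.smul_apply,
          smul_eq_mul]
        simp only [Matrix.mul_apply, Matrix.transpose_apply, Finset.sum_mul]
        rw [Finset.sum_comm]
        exact congrArg _ (Finset.sum_congr rfl fun i _ => Finset.sum_congr rfl fun j _ => by ring)
    rw [densityFactor_neg_two_eq hφ hψ hx.1.1 hx.1.2, h1, inv_mul_cancel_left₀ hc]
    simp only [jacobian_eq_frameMatrix hφ hψ hx.1.1 hx.1.2]
  smooth φ hφ i j :=
    (contMDiffOn_extendedBivector hn hg hcov hext hφ i j).mono inter_subset_left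

/-- Near each point, the scalar curvature is, up to a constant, a smooth function of the entries of
the extended tractor form. -/
lemma exists_contDiffOn_scalarCurvature (hn : 1 ≤ n) (hg : IsPseudoRiemannianMetric g)
    (hcov : IsLeviCivita g cov) (hext : ProjectiveStructureExtends cov)
    (hφ : φ ∈ smoothCharts n M) (hx : x ∈ φ.source) :
    ∃ K, IsConvexCoordNhd φ x K ∧ ∃ F : Model n → ℝ, ContDiffOn ℝ ∞ F K ∧ ∀ p ∈ interior K,
      scalarCurvature cov g ((φ.extend (𝓡∂ (n + 1))).symm p) = F p := by
  obtain ⟨K, hK, H, hH, hHe⟩ := exists_contDiffOn_splittingOperator hn hg hcov hext hφ hx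
  obtain ⟨c, -, hce⟩ := hK.exists_metricSign_eq hg hφ
  refine ⟨K, hK, fun p => c * ((n : ℝ) * ((n : ℝ) + 1)) * (Matrix.of fun a b => H a b p).det,
    contDiffOn_const.mul ?_, fun p hp => ?_⟩
  · simp only [Matrix.det_apply, Matrix.of_apply]
    exact ContDiffOn.sum fun σ _ => (contDiffOn_prod fun a _ => hH _ _).const_smul _
  · have h1 := hHe p hp
    have h2 := hce p hp
    obtain ⟨y, ⟨hy, hyi⟩, rfl⟩ := hK.interior_subset hp
    simp only [φ.extend_left_inv hy] at h1 h2 ⊢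
    have h3 : (Matrix.of fun a b => H a b (φ.extend (𝓡∂ (n + 1)) y)) =
        splittingOperator cov (metricBivectorDensity g) φ y := by
      ext a b
      exact (h1 a b).symm
    rw [h3, ← h2, metricSign_eq hφ hy, scalarCurvature_eq_det hn hg hcov hφ hy hyi, tractorDet]

end GlobalExtension

end ProjectiveTractor

/-! ### The scalar curvature as a tractor determinant -/

theorem proposition2p2 (n : ℕ) (hn : 1 ≤ n)
    (M : Type*) [TopologicalSpace M] [T2Space M]
    [ChartedSpace (EuclideanHalfSpace (n + 1)) M] [IsManifold (𝓡∂ (n + 1)) ∞ M]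
    (g : (x : M) → TangentSpace (𝓡∂ (n + 1)) x →L[ℝ] TangentSpace (𝓡∂ (n + 1)) x →L[ℝ] ℝ)
    (hg : ProjectiveTractor.IsPseudoRiemannianMetric g)
    (cov : ((x : M) → TangentSpace (𝓡∂ (n + 1)) x) →
      ((x : M) → TangentSpace (𝓡∂ (n + 1)) x →L[ℝ] TangentSpace (𝓡∂ (n + 1)) x))
    (hcov : ProjectiveTractor.IsLeviCivita g cov)
    (hext : ProjectiveTractor.ProjectiveStructureExtends cov) :
    ∃ (s : ProjectiveTractor.Chart n M → M → Matrix (Fin (n + 1)) (Fin (n + 1)) ℝ)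
      (h : ProjectiveTractor.Chart n M → M →
        Matrix (Unit ⊕ Fin (n + 1)) (Unit ⊕ Fin (n + 1)) ℝ)
      (S ε : M → ℝ),
      -- `s` is a smooth extension of `τ⁻¹ g^{ij}`
      ProjectiveTractor.IsSmoothBivectorDensity s Set.univ ∧
      (∀ φ ∈ ProjectiveTractor.smoothCharts n M,
        ∀ x ∈ φ.source ∩ ProjectiveTractor.interiorSet n M,
          s φ x = ProjectiveTractor.metricBivectorDensity g φ x) ∧
      -- `h` is a smooth extension of `L(τ⁻¹ g^{ij})`, and it projects onto `s`
      ProjectiveTractor.IsSmoothTractorForm h Set.univ ∧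
      (∀ φ ∈ ProjectiveTractor.smoothCharts n M,
        ∀ x ∈ φ.source ∩ ProjectiveTractor.interiorSet n M,
          h φ x = ProjectiveTractor.splittingOperator cov
            (ProjectiveTractor.metricBivectorDensity g) φ x) ∧
      (∀ φ ∈ ProjectiveTractor.smoothCharts n M, ∀ x ∈ φ.source,
          ProjectiveTractor.tractorProjection h φ x = s φ x) ∧
      -- `S` is a smooth extension of the scalar curvature
      ContMDiff (𝓡∂ (n + 1)) 𝓘(ℝ, ℝ) ∞ S ∧
      (∀ x ∈ ProjectiveTractor.interiorSet n M, S x = ProjectiveTractor.scalarCurvature cov g x) ∧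
      -- up to a locally constant factor, `S` is the tractor determinant of `h`
      IsLocallyConstant ε ∧
      (∀ x, ε x = 1 ∨ ε x = -1) ∧
      (∀ φ ∈ ProjectiveTractor.smoothCharts n M,
        ∀ x ∈ φ.source ∩ ProjectiveTractor.interiorSet n M,
          ε x = SignType.sign (ProjectiveTractor.metricMatrix g φ x).det) ∧
      (∀ φ ∈ ProjectiveTractor.smoothCharts n M, ∀ x ∈ φ.source,
          S x = ε x * ((n : ℝ) * ((n : ℝ) + 1)) * ProjectiveTractor.tractorDet h φ x) := by
  -- near each point, the sign of `det g` is constant on the interior of a half-ball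
  have hloc : ∀ x : M, ∃ K, ProjectiveTractor.IsConvexCoordNhd
      (chartAt (EuclideanHalfSpace (n + 1)) x) x K ∧ ∃ c : ℝ, (c = 1 ∨ c = -1) ∧ ∀ p ∈ interior K,
      ProjectiveTractor.metricSign g
        (((chartAt (EuclideanHalfSpace (n + 1)) x).extend (𝓡∂ (n + 1))).symm p) = c := fun x => by
    obtain ⟨K, hK, -⟩ := ProjectiveTractor.exists_contDiffOn_scalarCurvature hn hg hcov hext
      (ProjectiveTractor.chartAt_mem_smoothCharts x) (mem_chart_source (EuclideanHalfSpace (n + 1)) x)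
    exact ⟨K, hK, hK.exists_metricSign_eq hg (ProjectiveTractor.chartAt_mem_smoothCharts x)⟩
  set S : M → ℝ := extendFrom (ProjectiveTractor.interiorSet n M)
    (ProjectiveTractor.scalarCurvature cov g) with hS
  set ε : M → ℝ := extendFrom (ProjectiveTractor.interiorSet n M)
    (ProjectiveTractor.metricSign g) with hε
  have hSsmooth : ContMDiff (𝓡∂ (n + 1)) 𝓘(ℝ, ℝ) ∞ S := fun x => by
    have hφ := ProjectiveTractor.chartAt_mem_smoothCharts (n := n) x
    have hx := mem_chart_source (EuclideanHalfSpace (n + 1)) x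
    obtain ⟨K, hK, F, hF, hFe⟩ :=
      ProjectiveTractor.exists_contDiffOn_scalarCurvature hn hg hcov hext hφ hx
    exact hK.contMDiffAt_extendFrom hφ hx hF hFe
  have hSint : ∀ x ∈ ProjectiveTractor.interiorSet n M,
      S x = ProjectiveTractor.scalarCurvature cov g x := fun x hxi => by
    have hφ := ProjectiveTractor.chartAt_mem_smoothCharts (n := n) x
    have hx := mem_chart_source (EuclideanHalfSpace (n + 1)) x
    obtain ⟨K, hK, F, hF, hFe⟩ :=
      ProjectiveTractor.exists_contDiffOn_scalarCurvature hn hg hcov hext hφ hx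
    exact hK.extendFrom_eq_self hφ hx hxi hF.continuousOn hFe
  have hεloc : ∀ x, ∃ c : ℝ, (c = 1 ∨ c = -1) ∧ ∀ᶠ y in nhds x, ε y = c := fun x => by
    obtain ⟨K, hK, c, hc, hce⟩ := hloc x
    exact ⟨c, hc, hK.eventually_extendFrom_eq (F := fun _ => c)
      (ProjectiveTractor.chartAt_mem_smoothCharts x)
      (mem_chart_source (EuclideanHalfSpace (n + 1)) x) continuousOn_const hce⟩
  have hεconst : IsLocallyConstant ε := (IsLocallyConstant.iff_eventually_eq ε).2 fun x => by
    obtain ⟨c, -, hc⟩ := hεloc x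
    rw [hc.self_of_nhds]
    exact hc
  have hεint : ∀ φ ∈ ProjectiveTractor.smoothCharts n M,
      ∀ x ∈ φ.source ∩ ProjectiveTractor.interiorSet n M,
        ε x = SignType.sign (ProjectiveTractor.metricMatrix g φ x).det := fun φ hφ x hx => by
    obtain ⟨K, hK, c, hc, hce⟩ := hloc x
    rw [← ProjectiveTractor.metricSign_eq hφ hx.1]
    exact hK.extendFrom_eq_self (F := fun _ => c) (ProjectiveTractor.chartAt_mem_smoothCharts x)
      (mem_chart_source (EuclideanHalfSpace (n + 1)) x) hx.2 continuousOn_const hce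
  refine ⟨ProjectiveTractor.extendedBivector g, ProjectiveTractor.extendedTractorForm cov g, S, ε,
    ProjectiveTractor.isSmoothBivectorDensity_extendedBivector hn hg hcov hext,
    fun φ hφ x hx => ProjectiveTractor.extendedBivector_eq hn hg hcov hext hφ hx.1 hx.2,
    ProjectiveTractor.isSmoothTractorForm_extendedTractorForm hn hg hcov hext,
    fun φ hφ x hx => ProjectiveTractor.extendedTractorForm_eq hn hg hcov hext hφ hx.1 hx.2,
    fun φ hφ x hx => ?_, hSsmooth, hSint, hεconst, fun x => ?_, hεint, fun φ hφ x hx => ?_⟩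
  · ext i j
    exact ProjectiveTractor.extendedTractorForm_inr_inr hn hg hcov hext hφ hx i j
  · obtain ⟨c, hc, hce⟩ := hεloc x
    rwa [hce.self_of_nhds]
  · refine ProjectiveTractor.eq_of_eqOn_interior (n := n) (f := S)
      (g := fun y => ε y * ((n : ℝ) * ((n : ℝ) + 1)) *
        ProjectiveTractor.tractorDet (ProjectiveTractor.extendedTractorForm cov g) φ y)
      φ.open_source hSsmooth.continuous.continuousOn ?_ (fun y hy => ?_) hx
    · exact (hεconst.continuous.continuousOn.mul continuousOn_const).mul
        (ProjectiveTractor.contMDiffOn_det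
          (ProjectiveTractor.contMDiffOn_extendedTractorForm hn hg hcov hext hφ)).continuousOn
    · rw [hSint y hy.2, hεint φ hφ y hy,
        ProjectiveTractor.scalarCurvature_eq_det hn hg hcov hφ hy.1 hy.2,
        ProjectiveTractor.tractorDet, ProjectiveTractor.tractorDet,
        ProjectiveTractor.extendedTractorForm_eq hn hg hcov hext hφ hy.1 hy.2]
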